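/- Fix $\alpha\in(0,1)$, $b>0$ and $\nu>0$. Let $\lambda_\alpha(t)=\alpha t^{-\alpha-1}/\Gamma(1-\alpha)$, $t>0$, be the $\alpha$-stable Lévy density, let $f_\alpha(t)\,dt$ be the positive $\alpha$-stable law, with Laplace transform $s\mapsto e^{-s^\alpha}$, and let $X_{\alpha,b}$ have law $e^{-bt+b^\alpha}f_\alpha(t)\,dt$. For $\kappa\in\mathbb R$ with $\mathbb E[X_{\alpha,b}^{-\kappa}]<\infty$, let $X_{\alpha,b}^{[\kappa]}$ be a variable with $\mathbb P(X_{\alpha,b}^{[\kappa]}\in dt)=t^{-\kappa}\,\mathbb P(X_{\alpha,b}\in dt)/\mathbb E[X_{\alpha,b}^{-\kappa}]$. Let $\tau_\alpha$ denote a generalized gamma subordinator, i.e. a driftless subordinator with Lévy density $\alpha t^{-\alpha-1}e^{-t}/\Gamma(1-\alpha)$, let $G_a$ denote a $\mathrm{Gamma}(a,1)$ variable, and let $U$ denote a uniform variable on $[0,1]$. For a law $\gamma$ on $(0,\infty)$ that has a density $h$ with respect to $f_\alpha(t)\,dt$, the Poisson--Kingman law $\mathrm{PK}(\lambda_\alpha,\gamma)$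 is the law of the ranked normalized points $(J_n/\sum_k J_k)_n$, where $J_1\ge J_2\ge\cdots$ are the points of a Poisson process on $(0,\infty)$ with mean measure $\lambda_\alpha(t)\,dt$ whose law has been reweighted by the density $h(\sum_k J_k)$. A random probability measure $P$ on $[0,1]$ has weights with law $\mathrm{PK}(\lambda_\alpha,\gamma)$ if $P\stackrel{d}{=}\sum_n P_n\delta_{\omega_n}$ with $(P_n)\sim\mathrm{PK}(\lambda_\alpha,\gamma)$ independent of the i.i.d. uniform variables $\omega_1,\omega_2,\ldots$ **Proposition.** Let $P$ be a random probability measure on $[0,1]$ whose weights have law $\mathrm{PK}(\lambda_\alpha,\mathcal L(X_{\alpha,b}^{[\nu-1]}))$. Then, on a suitable extension of the probability space on which $P$ is defined, there are a positive random variable $\xi$ with law $$\mathbb P(\xi\in ds)=\frac{\alpha(b+s)^{\alpha-1}e^{-(b+s)^\alpha+b^\alpha}s^{\nu-1}}{\Gamma(\nu)\,\mathbb E[X_{\alpha,b}^{1-\nu}]}\,ds,\qquad s>0,$$ and a random measure $M$ on $[0,1]$ with total mass $T=M[0,1]$ such that $P=M/T$ almost surely, where $M$ has both of the following representations: almost surely,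 for all $y\in[0,1]$, $$M[0,y]=\frac{\tau_\alpha(y(b+\xi)^\alpha)}{b+\xi}+\frac{G_{1-\alpha}}{b+\xi}\mathbf 1\{U\le y\},$$ with $\xi,\tau_\alpha,G_{1-\alpha},U$ mutually independent, and $$M[0,y]=\frac{\tau_\alpha\bigl(y(b+\xi)^\alpha+G_{(1-\alpha)/\alpha}\mathbf 1\{U\le y\}\bigr)}{b+\xi},$$ with $\xi,\tau_\alpha,G_{(1-\alpha)/\alpha},U$ mutually independent (where $\tau_\alpha$ and $U$ need not be the same variables in the two representations). Moreover, $P$ is independent of $\xi T$, $\xi T\stackrel{d}{=}G_\nu$, and $T\stackrel{d}{=}X_{\alpha,b}^{[\nu-1]}$. -/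

import Mathlib

open MeasureTheory ProbabilityTheory Set
open scoped NNReal ENNReal

universe u

noncomputable section

/-! ### Ranked Poisson points and Poisson-Kingman laws -/

/-- Law of an i.i.d. sequence of standard exponential variables (the spacings of a unit-rate
Poisson process on the half-line). -/
def expSeqLaw : Measure (ℕ → ℝ) := Measure.infinitePi fun _ => expMeasure 1

/-- The `n`-th arrival time of the Poisson process with spacings `e`. -/
def arrival (e : ℕ → ℝ) (n : ℕ) : ℝ := ∑ i ∈ Finset.range (n + 1), e i

/-- Generalized inverse of the tail `x ↦ ∫_x^∞ lam(t) dt` of a Lévy density. -/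
def invTail (lam : ℝ → ℝ) (u : ℝ) : ℝ := sInf {x : ℝ | 0 < x ∧ (∫ t in Ioi x, lam t) ≤ u}

/-- The points, ranked in decreasing order, of a Poisson process on `(0, ∞)` with mean measure
`lam(t) dt`: the image of a unit-rate Poisson process under the inverse tail. -/
def rankedJump (lam : ℝ → ℝ) (e : ℕ → ℝ) (n : ℕ) : ℝ := invTail lam (arrival e n)

/-- The sum of all the points, i.e. the total mass `N(Ω)` of the random measure with
Lévy density `lam`. -/
def totalJump (lam : ℝ → ℝ) (e : ℕ → ℝ) : ℝ := ∑' n, rankedJump lam e n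

/-- The law of the total mass of the random measure with Lévy density `lam`. -/
def totalMassLaw (lam : ℝ → ℝ) : Measure ℝ := expSeqLaw.map (totalJump lam)

/-- The Poisson-Kingman law `PK(lam, γ)`: the law of the ranked normalized points when the
law of the Poisson process is reweighted by `h(total mass)`, where the density `h` is such that
the total mass has law `γ` after reweighting. -/
def poissonKingman (lam : ℝ → ℝ) (γ : Measure ℝ) : Measure (ℕ → ℝ) :=
  (expSeqLaw.withDensity fun e => γ.rnDeriv (totalMassLaw lam) (totalJump lam e)).map
    fun e n => rankedJump lam e n / totalJump lam e

/-- The random measure `P` on `[0,1]` is of the form `∑ Pₙ δ_{ωₙ}` in distribution, where the weight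
sequence `(Pₙ)` has law `Q` and is independent of the i.i.d. uniform locations `(ωₙ)`. -/
def HasWeightLaw {Ω : Type*} [MeasurableSpace Ω] (μ : Measure Ω)
    (P : Ω → Measure unitInterval) (Q : Measure (ℕ → ℝ)) : Prop :=
  Measurable P ∧
  μ.map P = (Q.prod (Measure.infinitePi fun _ : ℕ => (volume : Measure unitInterval))).map
    fun z => Measure.sum fun n => ENNReal.ofReal (z.1 n) • Measure.dirac (z.2 n)

/-! ### Stable laws and their tilts -/

/-- The `α`-stable Lévy density. -/
def stableDensity (α t : ℝ) : ℝ := α * t ^ (-α - 1) / Real.Gamma (1 - α)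

/-- The positive `α`-stable law `f_α(t) dt` (with Laplace transform `exp(-s^α)`): the law of the
total mass of the random measure with `α`-stable Lévy density. -/
def stableLaw (α : ℝ) : Measure ℝ := totalMassLaw (stableDensity α)

/-- The law `exp(-b t + b^α) f_α(t) dt` of `X_{α,b}`. -/
def tiltedStableLaw (α b : ℝ) : Measure ℝ :=
  (stableLaw α).withDensity fun t => ENNReal.ofReal (Real.exp (-b * t + b ^ α))

/-- The polynomial tilt `ρ^{[κ]}` of a law `ρ` on `(0, ∞)`: the law `t^{-κ} ρ(dt) / ∫ x^{-κ} ρ(dx)`. -/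
def polyTilt (κ : ℝ) (ρ : Measure ℝ) : Measure ℝ :=
  ρ.withDensity fun t => ENNReal.ofReal (t ^ (-κ) / ∫ x, x ^ (-κ) ∂ρ)

/-- The law of the scaling variable `ξ`. -/
def xiLaw (α b ν : ℝ) : Measure ℝ :=
  (volume.restrict (Ioi 0)).withDensity fun s => ENNReal.ofReal
    (α * (b + s) ^ (α - 1) * Real.exp (-(b + s) ^ α + b ^ α) * s ^ (ν - 1) /
      (Real.Gamma ν * ∫ t, t ^ (1 - ν) ∂(tiltedStableLaw α b)))

/-! ### Subordinators and the size-biased bridge -/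

/-- `τ` is a (driftless) subordinator with Lévy density `lam`: a nondecreasing right-continuous
process started at `0` with stationary independent increments and Laplace exponent
`∫_0^∞ (1 - exp(-q x)) lam(x) dx`. -/
structure IsSubordinator {Ω : Type*} [MeasurableSpace Ω] (μ : Measure Ω) (lam : ℝ → ℝ)
    (τ : ℝ≥0 → Ω → ℝ) : Prop where
  measurable : ∀ t, Measurable (τ t)
  zero : ∀ᵐ ω ∂μ, τ 0 ω = 0
  mono : ∀ᵐ ω ∂μ, Monotone fun t => τ t ω
  rightCont : ∀ᵐ ω ∂μ, ∀ t, ContinuousWithinAt (fun r => τ r ω) (Ici t) t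
  indep : HasIndepIncrements τ μ
  laplace : ∀ s t : ℝ≥0, s ≤ t → ∀ q : ℝ, 0 ≤ q →
    ∫ ω, Real.exp (-q * (τ t ω - τ s ω)) ∂μ =
      Real.exp (-((t : ℝ) - s) * ∫ x in Ioi (0 : ℝ), (1 - Real.exp (-q * x)) * lam x)

/-- Lévy density of the generalized gamma subordinator `τ_α`. -/
def genGammaDensity (α t : ℝ) : ℝ := α * t ^ (-α - 1) * Real.exp (-t) / Real.Gamma (1 - α)

/-- The four variables `ξ`, `τ = τ_α`, `G ~ Gamma(a, 1)` and `U ~ Uniform[0,1]` are mutually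
independent with the stated laws. -/
structure BridgeInputs {Ω : Type*} [MeasurableSpace Ω] (μ : Measure Ω) (α b ν a : ℝ)
    (ξ : Ω → ℝ) (τ : ℝ≥0 → Ω → ℝ) (G : Ω → ℝ) (U : Ω → unitInterval) : Prop where
  xi_law : HasLaw ξ (xiLaw α b ν) μ
  subordinator : IsSubordinator μ (genGammaDensity α) τ
  gamma_law : HasLaw G (gammaMeasure a 1) μ
  uniform_law : HasLaw U volume μ
  indep_xi : IndepFun ξ (fun ω => (G ω, U ω, fun t => τ t ω)) μ
  indep_gamma : IndepFun G (fun ω => (U ω, fun t => τ t ω)) μ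
  indep_uniform : IndepFun U (fun ω t => τ t ω) μ

/-- `M[0,y] = τ_α(y (b+ξ)^α) / (b+ξ) + G_{1-α} / (b+ξ) · 1{U ≤ y}` for all `y ∈ [0,1]`. -/
def IsSizeBiasedBridge {Ω : Type*} [MeasurableSpace Ω] (μ : Measure Ω) (α b ν : ℝ)
    (ξ : Ω → ℝ) (M : Ω → Measure unitInterval) : Prop :=
  ∃ (τ : ℝ≥0 → Ω → ℝ) (G : Ω → ℝ) (U : Ω → unitInterval),
    BridgeInputs μ α b ν (1 - α) ξ τ G U ∧
    ∀ᵐ ω ∂μ, ∀ y : unitInterval, M ω (Iic y) = ENNReal.ofReal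
      (τ (Real.toNNReal ((y : ℝ) * (b + ξ ω) ^ α)) ω / (b + ξ ω) +
        G ω / (b + ξ ω) * (Ici (U ω)).indicator 1 y)

/-- `M[0,y] = τ_α(y (b+ξ)^α + G_{(1-α)/α} · 1{U ≤ y}) / (b+ξ)` for all `y ∈ [0,1]`. -/
def IsTimeShiftedBridge {Ω : Type*} [MeasurableSpace Ω] (μ : Measure Ω) (α b ν : ℝ)
    (ξ : Ω → ℝ) (M : Ω → Measure unitInterval) : Prop :=
  ∃ (τ : ℝ≥0 → Ω → ℝ) (G : Ω → ℝ) (U : Ω → unitInterval),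
    BridgeInputs μ α b ν ((1 - α) / α) ξ τ G U ∧
    ∀ᵐ ω ∂μ, ∀ y : unitInterval, M ω (Iic y) = ENNReal.ofReal
      (τ (Real.toNNReal ((y : ℝ) * (b + ξ ω) ^ α + G ω * (Ici (U ω)).indicator 1 y)) ω /
        (b + ξ ω))

end

/-!
The three descriptions of `(ξ, M)` are compared through the joint law of `ξ` and `M`, which is
determined by the integrals `E[exp (-∫ f dM); ξ ∈ B]` over bounded measurable `f ≥ 0` and Borel
sets `B` (`map_prodMk_eq_of_laplace`).

Let `M = ∑ Jₙ δ_{ωₙ}` be the stable random measure on `[0,1]` and `S = M[0,1]`. Its Laplace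
functional is `exp (-∫ f ^ α)` (`laplace_stableCRM`), so replacing `f` by `β + f` and
differentiating in `β` gives
`E[S exp (-βS - ∫ f dM)] = (∫ α (β + f) ^ (α - 1)) exp (-∫ (β + f) ^ α)`
(`laplace_stableCRM_mul_exp_tilt`). Reweight the law so that `S` has the law of `X_{α,b}^{[ν-1]}`;
then `P = M / S` has Poisson-Kingman weights. With an independent `G_ν` put `ξ = G_ν / S`, so that
`ξ S = G_ν` is independent of `P`. The polynomial weight `S ^ (1 - ν)` is absorbed by the density of
`ξ` given `S`: on `{ξ ∈ ds}` what remains is the weight `S exp (-(b + s) S)`. By the formula above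
with `β = b + s`, the variable `ξ` has the asserted law, and given `ξ = s` the Laplace functional of
`M` is the product of `exp (-∫ ((β + f) ^ α - β ^ α))` and `∫ (1 + f / β) ^ (α - 1)`
(`bridgeLaplace`, `lintegral_tiltedMarkedLaw_gamma`).

The first factor is the Laplace functional of `τ_α(y β ^ α) / β`. The second is that of an atom of
mass `G / β` at a uniform location, with `G ~ Gamma(1 - α)` for a direct atom, and also with
`G' ~ Gamma((1 - α)/α)` for an atom produced by letting the clock of the subordinator jump by `G'`,
since `((1 + q) ^ α) ^ (-(1 - α)/α) = (1 + q) ^ (α - 1)`. So both bridges have the law of `(ξ, M)`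
(`map_sizeBiasedBridge`, `map_timeShiftedBridge`).

The spaces carrying these constructions are standard Borel, so variables with the same law can be
identified on an extension of the given probability space (`exists_coupling`): first `P` with
`M / S`, then `(ξ, M)` with each of the two bridges.
-/

noncomputable section

/-! ### Laplace functionals -/

open BoundedContinuousFunction in
/-- The function `x ↦ exp (-∑ i, c i * x i)` on the nonnegative orthant. -/
def expNegBCF {ι : Type*} [Fintype ι] (c : ι → ℝ≥0) : (ι → ℝ≥0) →ᵇ ℝ :=
  .ofNormedAddCommGroup (fun x => Real.exp (-((∑ i, c i * x i : ℝ≥0) : ℝ)))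
    (by fun_prop) 1 (fun x => by
      rw [Real.norm_of_nonneg (Real.exp_nonneg _), Real.exp_le_one_iff, neg_nonpos]
      exact NNReal.coe_nonneg _)

lemma expNegBCF_apply {ι : Type*} [Fintype ι] (c x : ι → ℝ≥0) :
    expNegBCF c x = Real.exp (-((∑ i, c i * x i : ℝ≥0) : ℝ)) := rfl

open BoundedContinuousFunction in
/-- Finite measures on a nonnegative orthant are determined by their Laplace transforms: the
exponentials span an algebra of bounded continuous functions that separates points. -/
theorem ext_of_laplace {ι : Type*} [Fintype ι] {m₁ m₂ : Measure (ι → ℝ≥0)}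
    [IsFiniteMeasure m₁] [IsFiniteMeasure m₂]
    (h : ∀ c : ι → ℝ≥0, ∫ x, expNegBCF c x ∂m₁ = ∫ x, expNegBCF c x ∂m₂) : m₁ = m₂ := by
  classical
  let N : Submonoid ((ι → ℝ≥0) →ᵇ ℝ) :=
    { carrier := Set.range expNegBCF
      mul_mem' := by
        rintro _ _ ⟨c, rfl⟩ ⟨d, rfl⟩
        refine ⟨c + d, ?_⟩
        ext x
        simp only [mul_apply, expNegBCF_apply, ← Real.exp_add, Pi.add_apply, add_mul,
          Finset.sum_add_distrib]
        congr 1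
        push_cast
        ring
      one_mem' := ⟨0, by ext x; simp [expNegBCF_apply]⟩ }
  let A₀ : Subalgebra ℝ ((ι → ℝ≥0) →ᵇ ℝ) := Algebra.adjoin ℝ N
  let A : StarSubalgebra ℝ ((ι → ℝ≥0) →ᵇ ℝ) :=
    { A₀ with
      star_mem' := by
        intro a ha
        have : star a = a := by ext x; simp
        rw [this]
        exact ha }
  refine ext_of_forall_mem_subalgebra_integral_eq_of_polish (𝕜 := ℝ) (A := A) ?_ ?_
  · intro x y hxy
    obtain ⟨i, hi⟩ := Function.ne_iff.1 hxy
    refine ⟨_, ⟨_, ⟨expNegBCF (Pi.single i 1), ?_, rfl⟩, rfl⟩, ?_⟩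
    · exact Algebra.subset_adjoin ⟨_, rfl⟩
    · have key (z : ι → ℝ≥0) : expNegBCF (Pi.single i 1) z = Real.exp (-(z i : ℝ)) := by
        rw [expNegBCF_apply]
        simp [Pi.single_apply]
      have : expNegBCF (Pi.single i 1) x ≠ expNegBCF (Pi.single i 1) y := by
        rw [key, key]
        simpa using hi
      exact this
  · intro g hg
    have hg' : g ∈ Submodule.span ℝ (N : Set ((ι → ℝ≥0) →ᵇ ℝ)) := by
      have : g ∈ Subalgebra.toSubmodule A₀ := hg
      rwa [Algebra.adjoin_eq_span, Submonoid.closure_eq] at this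
    clear hg
    induction hg' using Submodule.span_induction with
    | mem g hg => obtain ⟨c, rfl⟩ := hg; exact h c
    | zero => simp
    | add f g _ _ hf hg =>
      simp only [coe_add, Pi.add_apply]
      rw [integral_add (f.integrable _) (g.integrable _),
        integral_add (f.integrable _) (g.integrable _), hf, hg]
    | smul a f _ hf =>
      simp only [coe_smul, smul_eq_mul, integral_const_mul]
      rw [hf]

/-- `exp (-x)` for `x ∈ [0, ∞]`, with `exp (-∞) = 0`. -/
def expNeg (x : ℝ≥0∞) : ℝ≥0∞ := EReal.exp (-(x : EReal))

lemma continuous_expNeg : Continuous expNeg :=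
  ENNReal.continuous_exp.comp (continuous_neg.comp continuous_coe_ennreal_ereal)

@[fun_prop]
lemma measurable_expNeg : Measurable expNeg := continuous_expNeg.measurable

lemma expNeg_add (x y : ℝ≥0∞) : expNeg (x + y) = expNeg x * expNeg y := by
  rw [expNeg, EReal.coe_ennreal_add, EReal.neg_add (by simp) (by simp), sub_eq_add_neg,
    EReal.exp_add]
  rfl

@[simp] lemma expNeg_zero : expNeg 0 = 1 := by simp [expNeg]

@[simp] lemma expNeg_top : expNeg ∞ = 0 := by simp [expNeg]

lemma expNeg_ofReal {x : ℝ} (hx : 0 ≤ x) :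
    expNeg (ENNReal.ofReal x) = ENNReal.ofReal (Real.exp (-x)) := by
  rw [expNeg, EReal.coe_ennreal_ofReal, max_eq_left hx, ← EReal.coe_neg, EReal.exp_coe]

lemma expNeg_of_ne_top {x : ℝ≥0∞} (hx : x ≠ ∞) :
    expNeg x = ENNReal.ofReal (Real.exp (-x.toReal)) := by
  rw [← expNeg_ofReal ENNReal.toReal_nonneg, ENNReal.ofReal_toReal hx]

lemma expNeg_coe (x : ℝ≥0) : expNeg x = ENNReal.ofReal (Real.exp (-(x : ℝ))) := by
  rw [expNeg_of_ne_top ENNReal.coe_ne_top, ENNReal.coe_toReal]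

lemma expNeg_le_one (x : ℝ≥0∞) : expNeg x ≤ 1 := by
  by_cases hx : x = ∞
  · simp [hx]
  · rw [expNeg_of_ne_top hx]
    simp

lemma expNeg_sum {ι : Type*} (s : Finset ι) (x : ι → ℝ≥0∞) :
    expNeg (∑ i ∈ s, x i) = ∏ i ∈ s, expNeg (x i) := by
  classical
  induction s using Finset.induction_on with
  | empty => simp
  | insert a s ha ih => rw [Finset.sum_insert ha, Finset.prod_insert ha, expNeg_add, ih]

lemma integral_expNegBCF_map {ι Ω : Type*} [Fintype ι] [MeasurableSpace Ω] {m : Measure Ω}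
    {X : Ω → ι → ℝ≥0} (hX : AEMeasurable X m) (c : ι → ℝ≥0) :
    ∫ x, expNegBCF c x ∂(m.map X) = (∫⁻ ω, expNeg (∑ i, c i * X ω i) ∂m).toReal := by
  rw [integral_map hX (expNegBCF c).continuous.aestronglyMeasurable,
    integral_eq_lintegral_of_nonneg_ae (f := fun ω => expNegBCF c (X ω))
      (ae_of_all _ fun ω => Real.exp_nonneg _)
      ((expNegBCF c).continuous.comp_aestronglyMeasurable hX.aestronglyMeasurable)]
  congr 1
  refine lintegral_congr fun ω => ?_
  rw [expNegBCF_apply, ← expNeg_coe]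
  push_cast
  rfl

/-- Finite families of `[0, ∞)`-valued variables have the same law when their joint Laplace
transforms agree. -/
theorem map_eq_of_laplace {ι Ω₁ Ω₂ : Type*} [Fintype ι] [MeasurableSpace Ω₁] [MeasurableSpace Ω₂]
    {m₁ : Measure Ω₁} {m₂ : Measure Ω₂} [IsFiniteMeasure m₁] [IsFiniteMeasure m₂]
    {X : Ω₁ → ι → ℝ≥0} {Y : Ω₂ → ι → ℝ≥0} (hX : AEMeasurable X m₁) (hY : AEMeasurable Y m₂)
    (h : ∀ c : ι → ℝ≥0, ∫⁻ ω, expNeg (∑ i, c i * X ω i) ∂m₁ = ∫⁻ ω, expNeg (∑ i, c i * Y ω i) ∂m₂) :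
    m₁.map X = m₂.map Y := by
  refine ext_of_laplace fun c => ?_
  rw [integral_expNegBCF_map hX, integral_expNegBCF_map hY, h c]

lemma map_toNNReal_apply_map_coe {E Ω : Type*} [MeasurableSpace E] [MeasurableSpace Ω]
    {m : Measure Ω} (I : Finset {B : Set E // MeasurableSet B}) {M : Ω → Measure E}
    (hM : Measurable M) (hM' : ∀ᵐ ω ∂m, M ω univ < ∞) :
    (m.map fun ω (B : I) => (M ω B.1.1).toNNReal).map (fun g B => (g B : ℝ≥0∞)) =
      m.map ((I.restrict ∘ fun m B => m B.1) ∘ M) := by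
  have h : Measurable fun ω (B : I) => (M ω B.1.1).toNNReal :=
    measurable_pi_lambda _ fun B => ((Measure.measurable_coe B.1.2).comp hM).ennreal_toNNReal
  rw [Measure.map_map (by fun_prop) h]
  refine Measure.map_congr ?_
  filter_upwards [hM'] with ω hω
  ext B
  simp only [Function.comp_apply, Finset.restrict_def]
  rw [ENNReal.coe_toNNReal ((measure_mono (subset_univ _)).trans_lt hω).ne]

/-- Laws of almost surely finite random measures are determined by their Laplace functionals. -/
theorem randomMeasure_map_eq_of_laplace {E Ω₁ Ω₂ : Type*} [MeasurableSpace E] [MeasurableSpace Ω₁]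
    [MeasurableSpace Ω₂] {m₁ : Measure Ω₁} {m₂ : Measure Ω₂} [IsFiniteMeasure m₁]
    [IsFiniteMeasure m₂] {M : Ω₁ → Measure E} {N : Ω₂ → Measure E}
    (hM : Measurable M) (hN : Measurable N)
    (hM' : ∀ᵐ ω ∂m₁, M ω univ < ∞) (hN' : ∀ᵐ ω ∂m₂, N ω univ < ∞)
    (h : ∀ f : E → ℝ≥0, Measurable f → (∃ C, ∀ x, f x ≤ C) →
      ∫⁻ ω, expNeg (∫⁻ x, f x ∂(M ω)) ∂m₁ = ∫⁻ ω, expNeg (∫⁻ x, f x ∂(N ω)) ∂m₂) :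
    m₁.map M = m₂.map N := by
  classical
  let κ := {B : Set E // MeasurableSet B}
  let ev : Measure E → κ → ℝ≥0∞ := fun m B => m B.1
  have hev : Measurable ev := measurable_pi_lambda _ fun B => Measure.measurable_coe B.2
  have hcomap : (Measure.instMeasurableSpace : MeasurableSpace (Measure E)) ≤
      MeasurableSpace.comap ev inferInstance := by
    refine iSup_le fun s => iSup_le fun hs => ?_
    have : (fun m : Measure E => m s) = (fun g : κ → ℝ≥0∞ => g ⟨s, hs⟩) ∘ ev := rfl
    rw [this, ← MeasurableSpace.comap_comp]
    exact MeasurableSpace.comap_mono (measurable_pi_apply (⟨s, hs⟩ : κ)).comap_le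
  -- the finite-dimensional distributions agree
  have hfin : (m₁.map M).map ev = (m₂.map N).map ev := by
    refine IsProjectiveLimit.unique
      (P := fun I => ((m₂.map N).map ev).map I.restrict) (fun I => ?_) (fun I => rfl)
    beta_reduce
    rw [Measure.map_map (by fun_prop) hev, Measure.map_map (by fun_prop) hev,
      Measure.map_map (by fun_prop) hM, Measure.map_map (by fun_prop) hN]
    rw [← map_toNNReal_apply_map_coe I hM hM', ← map_toNNReal_apply_map_coe I hN hN']
    congr 1
    refine map_eq_of_laplace
      (measurable_pi_lambda _ fun B =>
        ((Measure.measurable_coe B.1.2).comp hM).ennreal_toNNReal).aemeasurable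
      (measurable_pi_lambda _ fun B =>
        ((Measure.measurable_coe B.1.2).comp hN).ennreal_toNNReal).aemeasurable fun c => ?_
    let f : E → ℝ≥0 := fun x => ∑ B : I, B.1.1.indicator (fun _ => c B) x
    have hf : Measurable f :=
      Finset.measurable_sum _ fun B _ => measurable_const.indicator B.1.2
    have hfC (x) : f x ≤ ∑ B : I, c B :=
      Finset.sum_le_sum fun B _ => indicator_le_self _ _ _
    have hint (m : Measure E) (hm : m univ < ∞) :
        ∫⁻ x, f x ∂m = ∑ B : I, (c B : ℝ≥0∞) * (m B.1.1).toNNReal := by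
      simp only [f, ENNReal.ofNNReal_finsetSum]
      rw [lintegral_finsetSum _ fun B _ => (measurable_const.indicator B.1.2).coe_nnreal_ennreal]
      refine Finset.sum_congr rfl fun B _ => ?_
      rw [ENNReal.coe_toNNReal ((measure_mono (subset_univ _)).trans_lt hm).ne,
        ← lintegral_indicator_const B.1.2]
      refine lintegral_congr fun x => ?_
      by_cases hx : x ∈ B.1.1 <;> simp [hx]
    have := h f hf ⟨_, hfC⟩
    rw [lintegral_congr_ae (g := fun ω => expNeg (∑ B : I, (c B : ℝ≥0∞) * (M ω B.1.1).toNNReal))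
      (by filter_upwards [hM'] with ω hω; rw [hint _ hω]),
      lintegral_congr_ae (g := fun ω => expNeg (∑ B : I, (c B : ℝ≥0∞) * (N ω B.1.1).toNNReal))
      (by filter_upwards [hN'] with ω hω; rw [hint _ hω])] at this
    exact this
  ext A hA
  obtain ⟨B, hB, rfl⟩ := hcomap A hA
  rw [← Measure.map_apply hev hB, ← Measure.map_apply hev hB, hfin]

/-- The joint law of a random variable and an almost surely finite random measure is determined by
the Laplace functionals of the random measure on the events that depend on the variable. -/
theorem map_prodMk_eq_of_laplace {E F Ω₁ Ω₂ : Type*} [MeasurableSpace E] [MeasurableSpace F]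
    [MeasurableSpace Ω₁] [MeasurableSpace Ω₂] {m₁ : Measure Ω₁} {m₂ : Measure Ω₂}
    [IsFiniteMeasure m₁] [IsFiniteMeasure m₂] {X : Ω₁ → F} {Y : Ω₂ → F}
    {M : Ω₁ → Measure E} {N : Ω₂ → Measure E}
    (hX : Measurable X) (hY : Measurable Y) (hM : Measurable M) (hN : Measurable N)
    (hM' : ∀ᵐ ω ∂m₁, M ω univ < ∞) (hN' : ∀ᵐ ω ∂m₂, N ω univ < ∞)
    (h : ∀ f : E → ℝ≥0, Measurable f → (∃ C, ∀ x, f x ≤ C) → ∀ B, MeasurableSet B →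
      ∫⁻ ω in X ⁻¹' B, expNeg (∫⁻ x, f x ∂(M ω)) ∂m₁ =
      ∫⁻ ω in Y ⁻¹' B, expNeg (∫⁻ x, f x ∂(N ω)) ∂m₂) :
    m₁.map (fun ω => (X ω, M ω)) = m₂.map (fun ω => (Y ω, N ω)) := by
  refine Measure.ext_prod fun {B A} hB hA => ?_
  have := randomMeasure_map_eq_of_laplace hM hN (m₁ := m₁.restrict (X ⁻¹' B))
    (m₂ := m₂.restrict (Y ⁻¹' B)) (ae_restrict_of_ae hM') (ae_restrict_of_ae hN')
    (fun f hf hC => h f hf hC B hB)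
  have := congrArg (fun m => m A) this
  simp only [Measure.map_apply hM hA, Measure.map_apply hN hA,
    Measure.restrict_apply (hM hA), Measure.restrict_apply (hN hA)] at this
  rw [Measure.map_apply (hX.prodMk hM) (hB.prod hA), Measure.map_apply (hY.prodMk hN) (hB.prod hA),
    mk_preimage_prod, mk_preimage_prod, inter_comm, this, inter_comm]

/-- Independence of nonnegative variables from the factorization of their joint Laplace
transform. -/
theorem iIndepFun_of_laplace {n : ℕ} {Ω : Type*} [MeasurableSpace Ω] {μ : Measure Ω}
    [IsProbabilityMeasure μ] {X : Fin n → Ω → ℝ≥0} (hX : ∀ i, AEMeasurable (X i) μ)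
    (h : ∀ c : Fin n → ℝ≥0, ∫⁻ ω, expNeg (∑ i, c i * X i ω) ∂μ =
      ∏ i, ∫⁻ ω, expNeg (c i * X i ω) ∂μ) : iIndepFun X μ := by
  rw [iIndepFun_iff_map_fun_eq_pi_map hX]
  have _ (i) : IsProbabilityMeasure (μ.map (X i)) := Measure.isProbabilityMeasure_map (hX i)
  conv_rhs => rw [← Measure.map_id (μ := Measure.pi fun i => μ.map (X i))]
  refine map_eq_of_laplace (aemeasurable_pi_lambda _ hX) aemeasurable_id fun c => ?_
  simp only [id, expNeg_sum]
  have hind : iIndepFun (fun i (ω : Fin n → ℝ≥0) => expNeg (c i * ω i))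
      (Measure.pi fun i => μ.map (X i)) :=
    iIndepFun_pi (X := fun i (x : ℝ≥0) => expNeg (c i * x)) fun i => by fun_prop
  rw [lintegral_prod_eq_prod_lintegral_of_indepFun Finset.univ _ hind (fun i => by fun_prop)]
  have h' := h c
  simp only [expNeg_sum] at h'
  rw [h']
  refine Finset.prod_congr rfl fun i _ => ?_
  rw [← lintegral_map' (f := fun x : ℝ≥0 => expNeg (c i * x)) (by fun_prop) (hX i),
    ← (measurePreserving_eval (fun i => μ.map (X i)) i).lintegral_comp (by fun_prop)]

/-! ### Transfer of random variables to an extension of a probability space -/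

/-- If `X` on `Ω` and `Y` on the standard Borel space `Z` have the same law, then the two
probability spaces can be coupled so that `X = Y`: the second component is drawn from the regular
conditional distribution given `Y`. The equality `X = Y` is understood through a measurable subset
`D` of the diagonal, as the diagonal itself need not be measurable. -/
theorem exists_coupling {Ω Z E : Type*} [MeasurableSpace Ω] [MeasurableSpace Z] [MeasurableSpace E]
    [StandardBorelSpace Z] [Nonempty Z] {μ : Measure Ω} {ν : Measure Z} [IsProbabilityMeasure μ]
    [IsProbabilityMeasure ν] {X : Ω → E} {Y : Z → E} (hX : Measurable X) (hY : Measurable Y)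
    (h : μ.map X = ν.map Y) {D : Set (E × E)} (hD : MeasurableSet D) (hDeq : ∀ p ∈ D, p.1 = p.2)
    (hYD : ∀ᵐ z ∂ν, (Y z, Y z) ∈ D) :
    ∃ μ' : Measure (Ω × Z), IsProbabilityMeasure μ' ∧ MeasurePreserving Prod.fst μ' μ ∧
      MeasurePreserving Prod.snd μ' ν ∧ ∀ᵐ p ∂μ', X p.1 = Y p.2 := by
  let κ : Kernel E Z := condDistrib id Y ν
  let μ' := μ ⊗ₘ (κ.comap X hX)
  have hmap : μ'.map (Prod.map X id) = ν.map fun z => (Y z, z) := by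
    rw [← compProd_map_condDistrib (Y := fun z => z) (X := Y) (μ := ν) aemeasurable_id, ← h]
    ext s hs
    rw [Measure.map_apply (by fun_prop) hs, Measure.compProd_apply (by measurability),
      Measure.compProd_apply hs, lintegral_map (Kernel.measurable_kernel_prodMk_left hs) hX]
    rfl
  have hprob : IsProbabilityMeasure μ' := by infer_instance
  refine ⟨μ', hprob, ⟨measurable_fst, Measure.fst_compProd _ _⟩, ⟨measurable_snd, ?_⟩, ?_⟩
  · have : (Prod.snd : Ω × Z → Z) = Prod.snd ∘ Prod.map X id := rfl
    rw [this, ← Measure.map_map measurable_snd (by fun_prop), hmap,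
      Measure.map_map measurable_snd (by fun_prop)]
    exact Measure.map_id
  · have h1 : ∀ᵐ q ∂(ν.map fun z => (Y z, z)), (q.1, Y q.2) ∈ D :=
      (ae_map_iff (by fun_prop) ((measurable_fst.prodMk (hY.comp measurable_snd)) hD)).2 hYD
    rw [← hmap] at h1
    filter_upwards [ae_of_ae_map (by fun_prop) h1] with p hp
    exact hDeq _ hp

/-- Finite measures on `[0,1]` agree on the measurable set of pairs that agree on a countable
generating class of intervals. -/
def unitMeasureDiag : Set (Measure unitInterval × Measure unitInterval) :=
  {p | p.1 univ < ∞ ∧ p.1 univ = p.2 univ ∧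
    ∀ q : ℚ, p.1 {x : unitInterval | (x : ℝ) ≤ q} = p.2 {x : unitInterval | (x : ℝ) ≤ q}}

lemma measurableSet_unitInterval_le (q : ℝ) : MeasurableSet {x : unitInterval | (x : ℝ) ≤ q} :=
  measurableSet_le measurable_subtype_coe measurable_const

lemma measurableSet_unitMeasureDiag : MeasurableSet unitMeasureDiag := by
  have h (B : Set unitInterval) (hB : MeasurableSet B) :
      MeasurableSet {p : Measure unitInterval × Measure unitInterval | p.1 B = p.2 B} :=
    measurableSet_eq_fun ((Measure.measurable_coe hB).comp measurable_fst)
      ((Measure.measurable_coe hB).comp measurable_snd)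
  refine MeasurableSet.inter (measurableSet_lt ((Measure.measurable_coe .univ).comp measurable_fst)
    measurable_const) (MeasurableSet.inter (h _ .univ) ?_)
  change MeasurableSet {p : Measure unitInterval × Measure unitInterval | ∀ q : ℚ,
      p.1 {x : unitInterval | (x : ℝ) ≤ q} = p.2 {x : unitInterval | (x : ℝ) ≤ q}}
  have : {p : Measure unitInterval × Measure unitInterval | ∀ q : ℚ,
      p.1 {x : unitInterval | (x : ℝ) ≤ q} = p.2 {x : unitInterval | (x : ℝ) ≤ q}} =
      ⋂ q : ℚ, {p | p.1 {x : unitInterval | (x : ℝ) ≤ q} = p.2 {x : unitInterval | (x : ℝ) ≤ q}} := by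
    ext; simp
  exact this ▸ MeasurableSet.iInter fun q => h _ (measurableSet_unitInterval_le q)

lemma eq_of_mem_unitMeasureDiag (p : Measure unitInterval × Measure unitInterval)
    (hp : p ∈ unitMeasureDiag) : p.1 = p.2 := by
  obtain ⟨h1, h2, h3⟩ := hp
  have : IsFiniteMeasure p.1 := ⟨h1⟩
  let g : unitInterval → ℝ := Subtype.val
  refine ext_of_generate_finite ((preimage g) '' ⋃ a : ℚ, {Iic (a : ℝ)}) ?_
    (Real.isPiSystem_Iic_rat.comap g) ?_ h2
  · rw [← MeasurableSpace.comap_generateFrom, ← Real.borel_eq_generateFrom_Iic_rat,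
      ← (inferInstance : BorelSpace ℝ).measurable_eq]
    rfl
  · rintro _ ⟨t, ht, rfl⟩
    simp only [mem_iUnion, mem_singleton_iff] at ht
    obtain ⟨q, rfl⟩ := ht
    exact h3 q

lemma mem_unitMeasureDiag {m : Measure unitInterval} (hm : m univ < ∞) :
    (m, m) ∈ unitMeasureDiag := ⟨hm, rfl, fun _ => rfl⟩

section Pullback

variable {Ω Ω' : Type*} [MeasurableSpace Ω] [MeasurableSpace Ω'] {μ : Measure Ω} {μ' : Measure Ω'}
  {ρ : Ω' → Ω}

lemma MeasureTheory.MeasurePreserving.indepFun_comp {E F : Type*} [MeasurableSpace E]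
    [MeasurableSpace F] (hρ : MeasurePreserving ρ μ' μ) {X : Ω → E} {Y : Ω → F}
    (hX : Measurable X) (hY : Measurable Y) (h : IndepFun X Y μ) :
    IndepFun (fun ω => X (ρ ω)) (fun ω => Y (ρ ω)) μ' := by
  rw [indepFun_iff_measure_inter_preimage_eq_mul] at h ⊢
  intro s t hs ht
  have := h s t hs ht
  rw [← hρ.measure_preimage ((hX hs).inter (hY ht)).nullMeasurableSet,
    ← hρ.measure_preimage (hX hs).nullMeasurableSet,
    ← hρ.measure_preimage (hY ht).nullMeasurableSet] at this
  exact this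

lemma MeasureTheory.MeasurePreserving.iIndepFun_comp {ι : Type*} {E : ι → Type*}
    [∀ i, MeasurableSpace (E i)] (hρ : MeasurePreserving ρ μ' μ) {X : ∀ i, Ω → E i}
    (hX : ∀ i, Measurable (X i)) (h : iIndepFun X μ) :
    iIndepFun (fun i ω => X i (ρ ω)) μ' := by
  rw [iIndepFun_iff_measure_inter_preimage_eq_mul] at h ⊢
  intro s t ht
  have := h s ht
  rw [← hρ.measure_preimage (Finset.measurableSet_biInter s
      fun i hi => hX i (ht i hi)).nullMeasurableSet,
    Finset.prod_congr rfl fun i hi =>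
      (hρ.measure_preimage (hX i (ht i hi)).nullMeasurableSet).symm] at this
  simp only [preimage_iInter] at this
  exact this

lemma IsSubordinator.comp {lam : ℝ → ℝ} {τ : ℝ≥0 → Ω → ℝ} (h : IsSubordinator μ lam τ)
    (hρ : MeasurePreserving ρ μ' μ) : IsSubordinator μ' lam (fun t ω => τ t (ρ ω)) where
  measurable t := (h.measurable t).comp hρ.measurable
  zero := hρ.quasiMeasurePreserving.ae h.zero
  mono := hρ.quasiMeasurePreserving.ae h.mono
  rightCont := hρ.quasiMeasurePreserving.ae h.rightCont
  indep n t ht := hρ.iIndepFun_comp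
    (fun i => (h.measurable _).sub (h.measurable _)) (h.indep n t ht)
  laplace s t hst q hq := by
    rw [← h.laplace s t hst q hq, ← hρ.map_eq, integral_map hρ.measurable.aemeasurable]
    have := h.measurable s
    have := h.measurable t
    exact Measurable.aestronglyMeasurable (by fun_prop)

lemma BridgeInputs.comp {α b ν a : ℝ} {ξ : Ω → ℝ} {τ : ℝ≥0 → Ω → ℝ} {G : Ω → ℝ}
    {U : Ω → unitInterval} (hξ : Measurable ξ) (hG : Measurable G) (hU : Measurable U)
    (h : BridgeInputs μ α b ν a ξ τ G U) (hρ : MeasurePreserving ρ μ' μ) :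
    BridgeInputs μ' α b ν a (fun ω => ξ (ρ ω)) (fun t ω => τ t (ρ ω)) (fun ω => G (ρ ω))
      (fun ω => U (ρ ω)) where
  xi_law := h.xi_law.comp hρ.hasLaw
  subordinator := h.subordinator.comp hρ
  gamma_law := h.gamma_law.comp hρ.hasLaw
  uniform_law := h.uniform_law.comp hρ.hasLaw
  indep_xi := hρ.indepFun_comp hξ
    (hG.prodMk (hU.prodMk (measurable_pi_lambda _ h.subordinator.measurable))) h.indep_xi
  indep_gamma := hρ.indepFun_comp hG
    (hU.prodMk (measurable_pi_lambda _ h.subordinator.measurable)) h.indep_gamma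
  indep_uniform := hρ.indepFun_comp hU (measurable_pi_lambda _ h.subordinator.measurable)
    h.indep_uniform

lemma BridgeInputs.congr {α b ν a : ℝ} {ξ ξ' : Ω → ℝ} {τ : ℝ≥0 → Ω → ℝ} {G : Ω → ℝ}
    {U : Ω → unitInterval} (h : BridgeInputs μ α b ν a ξ τ G U) (hξ : ξ' =ᵐ[μ] ξ) :
    BridgeInputs μ α b ν a ξ' τ G U where
  xi_law := h.xi_law.congr hξ
  subordinator := h.subordinator
  gamma_law := h.gamma_law
  uniform_law := h.uniform_law
  indep_xi := h.indep_xi.congr hξ.symm .rfl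
  indep_gamma := h.indep_gamma
  indep_uniform := h.indep_uniform

end Pullback

/-! ### The gamma and exponential laws -/

lemma gammaMeasure_one_eq (a : ℝ) : gammaMeasure a 1 = (volume.restrict (Ioi 0)).withDensity
    fun x => ENNReal.ofReal (x ^ (a - 1) * Real.exp (-x) / Real.Gamma a) := by
  have h : gammaMeasure a 1 = (volume.restrict (Ici 0)).withDensity
      fun x => ENNReal.ofReal (x ^ (a - 1) * Real.exp (-x) / Real.Gamma a) := by
    rw [gammaMeasure, ← withDensity_indicator measurableSet_Ici]
    congr 1
    ext x
    by_cases hx : 0 ≤ x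
    · rw [indicator_of_mem (mem_Ici.2 hx), gammaPDF_of_nonneg hx]
      congr 1
      simp
      ring
    · rw [indicator_of_notMem (mt mem_Ici.1 hx), gammaPDF_of_neg (not_le.1 hx)]
  rw [h, restrict_Ioi_eq_restrict_Ici]

instance (a : ℝ) : SFinite (gammaMeasure a 1) := by rw [gammaMeasure_one_eq]; infer_instance

lemma expMeasure_one_eq : expMeasure 1 = (volume.restrict (Ioi 0)).withDensity
    fun x => ENNReal.ofReal (Real.exp (-x)) := by
  rw [expMeasure, gammaMeasure_one_eq]
  simp

instance : IsProbabilityMeasure (expMeasure 1) := isProbabilityMeasure_expMeasure one_pos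

instance : IsProbabilityMeasure expSeqLaw := by unfold expSeqLaw; infer_instance

lemma ae_pos_gammaMeasure (a : ℝ) : ∀ᵐ x ∂(gammaMeasure a 1), 0 < x := by
  rw [gammaMeasure_one_eq]
  exact (withDensity_absolutelyContinuous _ _).ae_le (ae_restrict_mem measurableSet_Ioi)

lemma lintegral_gammaMeasure_one (a : ℝ) {g : ℝ → ℝ≥0∞} (hg : Measurable g) :
    ∫⁻ x, g x ∂(gammaMeasure a 1) =
      ∫⁻ x in Ioi 0, ENNReal.ofReal (x ^ (a - 1) * Real.exp (-x) / Real.Gamma a) * g x := by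
  rw [gammaMeasure_one_eq, lintegral_withDensity_eq_lintegral_mul _ (by fun_prop) hg]
  rfl

lemma lintegral_rpow_mul_exp_neg {a r : ℝ} (ha : 0 < a) (hr : 0 < r) :
    ∫⁻ t in Ioi 0, ENNReal.ofReal (t ^ (a - 1) * Real.exp (-(r * t))) =
      ENNReal.ofReal (r ^ (-a) * Real.Gamma a) := by
  have h := Real.integral_rpow_mul_exp_neg_mul_Ioi ha hr
  have hpos : 0 < (1 / r) ^ a * Real.Gamma a := by
    have := Real.Gamma_pos_of_pos ha
    positivity
  rw [← ofReal_integral_eq_lintegral_ofReal, h, one_div, Real.inv_rpow hr.le, Real.rpow_neg hr.le]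
  · by_contra hc
    rw [integral_undef hc] at h
    exact hpos.ne h
  · filter_upwards [ae_restrict_mem measurableSet_Ioi] with t (ht : 0 < t)
    positivity

/-- Laplace transform of the gamma law. -/
lemma lintegral_expNeg_gammaMeasure {a q : ℝ} (ha : 0 < a) (hq : 0 ≤ q) :
    ∫⁻ x, expNeg (ENNReal.ofReal (x * q)) ∂(gammaMeasure a 1) =
      ENNReal.ofReal ((1 + q) ^ (-a)) := by
  have hG := Real.Gamma_pos_of_pos ha
  rw [lintegral_gammaMeasure_one _ (by fun_prop)]
  have : ∀ x ∈ Ioi (0 : ℝ), ENNReal.ofReal (x ^ (a - 1) * Real.exp (-x) / Real.Gamma a) *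
      expNeg (ENNReal.ofReal (x * q)) = ENNReal.ofReal (Real.Gamma a)⁻¹ *
        ENNReal.ofReal (x ^ (a - 1) * Real.exp (-((1 + q) * x))) := by
    intro x (hx : 0 < x)
    rw [expNeg_ofReal (by positivity), ← ENNReal.ofReal_mul (by positivity),
      ← ENNReal.ofReal_mul (by positivity), add_mul, neg_add, Real.exp_add]
    ring_nf
  rw [setLIntegral_congr_fun measurableSet_Ioi this, lintegral_const_mul _ (by fun_prop),
    lintegral_rpow_mul_exp_neg ha (by linarith), ← ENNReal.ofReal_mul (by positivity)]
  congr 1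
  field_simp

/-- Layer-cake form of the Laplace exponent: a family of points whose number above each level `r`
is `r ^ (-α) / Γ(1 - α)` has Laplace exponent `q ^ α`. -/
lemma lintegral_one_sub_exp_of_tail {X : Type*} [MeasurableSpace X] {m : Measure X} {J : X → ℝ}
    {α q : ℝ} (hα0 : 0 < α) (hα1 : α < 1) (hq : 0 ≤ q) (hJ : Measurable J) (hJ0 : ∀ x, 0 ≤ J x)
    (htail : ∀ r, 0 < r → m {x | r < J x} = ENNReal.ofReal (r ^ (-α) / Real.Gamma (1 - α))) :
    ∫⁻ x, ENNReal.ofReal (1 - Real.exp (-(q * J x))) ∂m = ENNReal.ofReal (q ^ α) := by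
  obtain rfl | hq := hq.eq_or_lt
  · simp [Real.zero_rpow hα0.ne']
  have hG := Real.Gamma_pos_of_pos (sub_pos.2 hα1)
  have hint (y : ℝ) : ∫ t in (0 : ℝ)..y, q * Real.exp (-(q * t)) = 1 - Real.exp (-(q * y)) := by
    have h (t : ℝ) : HasDerivAt (fun t => -Real.exp (-(q * t))) (q * Real.exp (-(q * t))) t := by
      have := (((hasDerivAt_id t).const_mul q).neg.exp).neg
      convert! this using 1
      simp
      ring
    rw [intervalIntegral.integral_eq_sub_of_hasDerivAt (fun t _ => h t)
      (by apply Continuous.intervalIntegrable; fun_prop)]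
    simp
    ring
  simp_rw [← hint]
  rw [lintegral_comp_eq_lintegral_meas_lt_mul m (ae_of_all _ hJ0) hJ.aemeasurable
    (fun t _ => by apply Continuous.intervalIntegrable; fun_prop)
    (ae_of_all _ fun t => by positivity)]
  have : ∀ t ∈ Ioi (0 : ℝ), m {x | t < J x} * ENNReal.ofReal (q * Real.exp (-(q * t))) =
      ENNReal.ofReal (q / Real.Gamma (1 - α)) *
        ENNReal.ofReal (t ^ ((1 - α) - 1) * Real.exp (-(q * t))) := by
    intro t (ht : 0 < t)
    rw [htail t ht, ← ENNReal.ofReal_mul (by positivity), ← ENNReal.ofReal_mul (by positivity)]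
    congr 1
    rw [show (1 - α) - 1 = -α by ring]
    ring
  rw [setLIntegral_congr_fun measurableSet_Ioi this, lintegral_const_mul _ (by fun_prop),
    lintegral_rpow_mul_exp_neg (by linarith) hq, ← ENNReal.ofReal_mul (by positivity)]
  congr 1
  have : q ^ α = q * q ^ (-(1 - α)) := by
    nth_rewrite 2 [← Real.rpow_one q]
    rw [← Real.rpow_add hq]
    congr 1
    ring
  rw [this]
  field_simp

/-! ### The stable Lévy density and its inverse tail -/

lemma integral_stableDensity {α x : ℝ} (hα0 : 0 < α) (hx : 0 < x) :
    ∫ t in Ioi x, stableDensity α t = x ^ (-α) / Real.Gamma (1 - α) := by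
  simp only [stableDensity]
  rw [integral_div, integral_const_mul, integral_Ioi_rpow_of_lt (by linarith) hx]
  have : -α - 1 + 1 = -α := by ring
  rw [this]
  field_simp

lemma integrableOn_stableDensity {α x : ℝ} (hα0 : 0 < α) (hx : 0 < x) :
    IntegrableOn (stableDensity α) (Ioi x) :=
  ((integrableOn_Ioi_rpow_of_lt (by linarith) hx).const_mul α).div_const _

lemma stableDensity_nonneg {α x : ℝ} (hα0 : 0 < α) (hα1 : α < 1) (hx : 0 < x) :
    0 ≤ stableDensity α x := by
  have hG := Real.Gamma_pos_of_pos (sub_pos.2 hα1)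
  unfold stableDensity
  positivity

lemma measurable_stableDensity (α : ℝ) : Measurable (stableDensity α) := by
  unfold stableDensity
  fun_prop

/-- The Laplace exponent of the stable Lévy density. -/
lemma lintegral_one_sub_exp_stableDensity {α q : ℝ} (hα0 : 0 < α) (hα1 : α < 1) (hq : 0 ≤ q) :
    ∫⁻ x in Ioi 0, ENNReal.ofReal ((1 - Real.exp (-(q * x))) * stableDensity α x) =
      ENNReal.ofReal (q ^ α) := by
  rw [← lintegral_one_sub_exp_of_tail (X := ℝ) (J := fun x => max x 0)
    (m := (volume.restrict (Ioi 0)).withDensity fun x => ENNReal.ofReal (stableDensity α x))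
    hα0 hα1 hq (by fun_prop) (fun x => le_max_right _ _),
    lintegral_withDensity_eq_lintegral_mul _ (measurable_stableDensity α).ennreal_ofReal
      (by fun_prop)]
  · refine setLIntegral_congr_fun measurableSet_Ioi fun x (hx : 0 < x) => ?_
    simp only [Pi.mul_apply]
    rw [max_eq_left hx.le, ← ENNReal.ofReal_mul (stableDensity_nonneg hα0 hα1 hx), mul_comm]
  · intro r hr
    have : {x : ℝ | r < max x 0} = Ioi r := by
      ext x
      simp [hr.not_gt]
    rw [this, withDensity_apply _ measurableSet_Ioi, Measure.restrict_restrict measurableSet_Ioi,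
      Ioi_inter_Ioi, max_eq_left hr.le, ← integral_stableDensity hα0 hr,
      ofReal_integral_eq_lintegral_ofReal (integrableOn_stableDensity hα0 hr)]
    filter_upwards [ae_restrict_mem measurableSet_Ioi] with x (hx : r < x)
    exact stableDensity_nonneg hα0 hα1 (hr.trans hx)

lemma integrableOn_one_sub_exp_stableDensity {α q : ℝ} (hα0 : 0 < α) (hα1 : α < 1)
    (hq : 0 ≤ q) :
    IntegrableOn (fun x => (1 - Real.exp (-(q * x))) * stableDensity α x) (Ioi 0) ∧
    ∫ x in Ioi 0, (1 - Real.exp (-(q * x))) * stableDensity α x = q ^ α := by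
  have hm : Measurable fun x => (1 - Real.exp (-(q * x))) * stableDensity α x := by
    have := measurable_stableDensity α
    fun_prop
  have hnn : 0 ≤ᵐ[volume.restrict (Ioi 0)]
      fun x => (1 - Real.exp (-(q * x))) * stableDensity α x := by
    filter_upwards [ae_restrict_mem measurableSet_Ioi] with x (hx : 0 < x)
    have : Real.exp (-(q * x)) ≤ 1 := Real.exp_le_one_iff.2 (by nlinarith)
    exact mul_nonneg (by linarith) (stableDensity_nonneg hα0 hα1 hx)
  have hl := lintegral_one_sub_exp_stableDensity hα0 hα1 hq
  constructor
  · refine ⟨hm.aestronglyMeasurable, ?_⟩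
    rw [hasFiniteIntegral_iff_ofReal hnn, hl]
    exact ENNReal.ofReal_lt_top
  · rw [integral_eq_lintegral_of_nonneg_ae hnn hm.aestronglyMeasurable, hl,
      ENNReal.toReal_ofReal (by positivity)]

/-- The Laplace exponent of the generalized gamma subordinator. -/
lemma integral_one_sub_exp_genGammaDensity {α q : ℝ} (hα0 : 0 < α) (hα1 : α < 1) (hq : 0 ≤ q) :
    ∫ x in Ioi 0, (1 - Real.exp (-q * x)) * genGammaDensity α x = (1 + q) ^ α - 1 := by
  obtain ⟨i1, h1⟩ := integrableOn_one_sub_exp_stableDensity hα0 hα1 (q := 1 + q) (by linarith)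
  obtain ⟨i2, h2⟩ := integrableOn_one_sub_exp_stableDensity hα0 hα1 (q := 1) zero_le_one
  have := integral_sub i1 i2
  rw [h1, h2, Real.one_rpow] at this
  rw [← this]
  congr 1
  ext x
  rw [genGammaDensity, stableDensity, add_mul, neg_add, Real.exp_add]
  ring_nf

lemma invTail_stableDensity {α : ℝ} (hα0 : 0 < α) (hα1 : α < 1) (u : ℝ) :
    invTail (stableDensity α) u =
      if 0 < u then (Real.Gamma (1 - α) * u) ^ (-α⁻¹) else 0 := by
  have hG := Real.Gamma_pos_of_pos (sub_pos.2 hα1)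
  have hset : {x : ℝ | 0 < x ∧ (∫ t in Ioi x, stableDensity α t) ≤ u} =
      {x : ℝ | 0 < x ∧ x ^ (-α) ≤ Real.Gamma (1 - α) * u} := by
    ext x
    refine and_congr_right fun hx => ?_
    rw [integral_stableDensity hα0 hx, div_le_iff₀ hG, mul_comm]
  rw [invTail, hset]
  split_ifs with hu
  · have : {x : ℝ | 0 < x ∧ x ^ (-α) ≤ Real.Gamma (1 - α) * u} =
        Ici ((Real.Gamma (1 - α) * u) ^ (-α⁻¹)) := by
      ext x
      have hc : 0 < Real.Gamma (1 - α) * u := by positivity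
      have hc' : 0 < (Real.Gamma (1 - α) * u) ^ (-α⁻¹) := by positivity
      have key : ((Real.Gamma (1 - α) * u) ^ (-α⁻¹)) ^ (-α) = Real.Gamma (1 - α) * u := by
        rw [← Real.rpow_mul hc.le]
        simp [hα0.ne']
      simp only [mem_ofPred_eq, mem_Ici]
      constructor
      · rintro ⟨hx, h⟩
        rw [← key] at h
        exact (Real.rpow_le_rpow_iff_of_neg hx hc' (by linarith)).1 h
      · intro h
        have hx := hc'.trans_le h
        refine ⟨hx, ?_⟩
        rw [← key]
        exact (Real.rpow_le_rpow_iff_of_neg hx hc' (by linarith)).2 h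
    rw [this, csInf_Ici]
  · have : {x : ℝ | 0 < x ∧ x ^ (-α) ≤ Real.Gamma (1 - α) * u} = ∅ := by
      refine eq_empty_of_forall_notMem fun x hx => hu ?_
      have : 0 < x ^ (-α) := Real.rpow_pos_of_pos hx.1 _
      exact (pos_iff_pos_of_mul_pos (this.trans_le hx.2)).1 hG
    rw [this, Real.sInf_empty]

lemma measurable_invTail_stableDensity {α : ℝ} (hα0 : 0 < α) (hα1 : α < 1) :
    Measurable (invTail (stableDensity α)) := by
  rw [funext (invTail_stableDensity hα0 hα1)]
  exact Measurable.ite measurableSet_Ioi (by fun_prop) measurable_const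

lemma invTail_nonneg (lam : ℝ → ℝ) (u : ℝ) : 0 ≤ invTail lam u :=
  Real.sInf_nonneg fun _ hx => hx.1.le

/-- The Laplace exponent of the stable law as an integral over the unit-rate points. -/
lemma lintegral_one_sub_exp_invTail {α q : ℝ} (hα0 : 0 < α) (hα1 : α < 1) (hq : 0 ≤ q) :
    ∫⁻ u in Ioi 0, ENNReal.ofReal (1 - Real.exp (-(q * invTail (stableDensity α) u))) =
      ENNReal.ofReal (q ^ α) := by
  have hG := Real.Gamma_pos_of_pos (sub_pos.2 hα1)
  refine lintegral_one_sub_exp_of_tail hα0 hα1 hq (measurable_invTail_stableDensity hα0 hα1)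
    (invTail_nonneg _) fun r hr => ?_
  have : {u | r < invTail (stableDensity α) u} = Ioo 0 (r ^ (-α) / Real.Gamma (1 - α)) := by
    ext u
    rw [mem_ofPred_eq, invTail_stableDensity hα0 hα1, mem_Ioo]
    split_ifs with hu
    · have hc : 0 < Real.Gamma (1 - α) * u := by positivity
      have key : (r ^ (-α)) ^ (-α⁻¹) = r := by
        rw [← Real.rpow_mul hr.le]
        simp [hα0.ne']
      simp only [hu, true_and]
      rw [lt_div_iff₀ hG, mul_comm u]
      nth_rewrite 1 [← key]
      exact Real.rpow_lt_rpow_iff_of_neg (by positivity) hc (by simpa using hα0)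
    · simp [hu, hr.le]
  rw [this, Measure.restrict_apply measurableSet_Ioo,
    inter_eq_left.2 (fun x hx => hx.1), Real.volume_Ioo, sub_zero]

/-! ### Points of a Poisson process on the half-line -/

/-- In an i.i.d. sequence the `N`-th term can be integrated out independently of the first `N`. -/
lemma lintegral_infinitePi_range_succ {X : Type*} [MeasurableSpace X] (m : Measure X)
    [IsProbabilityMeasure m] (N : ℕ) {F : (Finset.range N → X) × X → ℝ≥0∞} (hF : Measurable F) :
    ∫⁻ e, F ((Finset.range N).restrict e, e N) ∂(Measure.infinitePi fun _ : ℕ => m) =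
      ∫⁻ e, ∫⁻ u, F ((Finset.range N).restrict e, u) ∂m ∂(Measure.infinitePi fun _ : ℕ => m) := by
  have hind : iIndepFun (fun (i : ℕ) (e : ℕ → X) => e i) (Measure.infinitePi fun _ : ℕ => m) :=
    iIndepFun_infinitePi (X := fun _ x => x) fun _ => measurable_id
  have h1 := hind.indepFun_finset (Finset.range N) {N} (by simp) (fun i => by fun_prop)
  have h2 : IndepFun (fun (e : ℕ → X) => (Finset.range N).restrict e) (fun e => e N)
      (Measure.infinitePi fun _ : ℕ => m) :=
    h1.comp (φ := id) (ψ := fun g : ({N} : Finset ℕ) → X => g ⟨N, Finset.mem_singleton_self N⟩)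
      measurable_id (measurable_pi_apply (⟨N, Finset.mem_singleton_self N⟩ : ({N} : Finset ℕ)))
  have hN : Measurable fun e : ℕ → X => e N := measurable_pi_apply N
  have hR : Measurable fun e : ℕ → X => (Finset.range N).restrict e :=
    Finset.measurable_restrict _
  have h3 := (indepFun_iff_map_prod_eq_prod_map_map hR.aemeasurable hN.aemeasurable).1 h2
  rw [Measure.infinitePi_map_eval] at h3
  rw [← lintegral_map (f := F) (g := fun e : ℕ → X => ((Finset.range N).restrict e, e N)) hF
    (hR.prodMk hN), h3, lintegral_prod _ hF.aemeasurable,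
    lintegral_map (hF.lintegral_prod_right') hR]

/-- The sum of the first `N` spacings. -/
def spacingSum (e : ℕ → ℝ) (N : ℕ) : ℝ := ∑ i ∈ Finset.range N, e i

lemma arrival_eq (e : ℕ → ℝ) (n : ℕ) : arrival e n = spacingSum e (n + 1) := rfl

lemma spacingSum_succ (e : ℕ → ℝ) (N : ℕ) : spacingSum e (N + 1) = spacingSum e N + e N :=
  Finset.sum_range_succ _ _

@[fun_prop]
lemma measurable_spacingSum (N : ℕ) : Measurable fun e => spacingSum e N := by
  unfold spacingSum; fun_prop

lemma ae_expSeqLaw_pos : ∀ᵐ e ∂expSeqLaw, ∀ n, 0 < e n := by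
  rw [ae_all_iff]
  intro n
  exact (measurePreserving_eval_infinitePi (fun _ : ℕ => expMeasure 1) n).quasiMeasurePreserving.ae
    (ae_pos_gammaMeasure 1)

lemma spacingSum_nonneg {e : ℕ → ℝ} (he : ∀ n, 0 < e n) (N : ℕ) : 0 ≤ spacingSum e N :=
  Finset.sum_nonneg fun i _ => (he i).le

lemma integrable_expMeasure : Integrable (fun x : ℝ => x) (expMeasure 1) ∧
    ∫ x, x ∂(expMeasure 1) = 1 := by
  have h0 : 0 ≤ᵐ[expMeasure 1] fun x : ℝ => x := by
    filter_upwards [ae_pos_gammaMeasure 1] with x hx using hx.le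
  have hl : ∫⁻ x, ENNReal.ofReal x ∂(expMeasure 1) = 1 := by
    rw [expMeasure, lintegral_gammaMeasure_one 1 (by fun_prop)]
    have := lintegral_rpow_mul_exp_neg (a := 2) (r := 1) (by norm_num) (by norm_num)
    rw [Real.one_rpow, Real.Gamma_two] at this
    simp only [mul_one, ENNReal.ofReal_one] at this
    rw [← this]
    refine setLIntegral_congr_fun measurableSet_Ioi fun x (hx : 0 < x) => ?_
    rw [← ENNReal.ofReal_mul (by simp; positivity)]
    congr 1
    norm_num
    ring
  refine ⟨⟨by fun_prop, ?_⟩, ?_⟩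
  · rw [hasFiniteIntegral_iff_ofReal h0, hl]
    exact ENNReal.one_lt_top
  · rw [integral_eq_lintegral_of_nonneg_ae h0 (by fun_prop), hl]
    simp

/-- The law of large numbers for the arrival times. -/
lemma ae_tendsto_spacingSum_div : ∀ᵐ e ∂expSeqLaw,
    Filter.Tendsto (fun n : ℕ => spacingSum e n / n) Filter.atTop (nhds 1) := by
  have hmp (i : ℕ) := measurePreserving_eval_infinitePi (fun _ : ℕ => expMeasure 1) i
  have hind : iIndepFun (fun (i : ℕ) (e : ℕ → ℝ) => e i) expSeqLaw :=
    iIndepFun_infinitePi (X := fun _ x => x) fun _ => measurable_id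
  have h := strong_law_ae_real (μ := expSeqLaw) (fun (i : ℕ) (e : ℕ → ℝ) => e i)
    ((hmp 0).integrable_comp_of_integrable integrable_expMeasure.1)
    (fun i j hij => hind.indepFun hij)
    (fun i => ⟨(measurable_pi_apply i).aemeasurable, (measurable_pi_apply 0).aemeasurable, (hmp i).map_eq.trans (hmp 0).map_eq.symm⟩)
  have hmean : ∫ e : ℕ → ℝ, e 0 ∂expSeqLaw = 1 := by
    rw [← integrable_expMeasure.2]
    conv_rhs => rw [← (hmp 0).map_eq]
    rw [integral_map (hmp 0).measurable.aemeasurable (by fun_prop)]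
    rfl
  rw [hmean] at h
  exact h

lemma tendsto_spacingSum_atTop {e : ℕ → ℝ}
    (he : Filter.Tendsto (fun n : ℕ => spacingSum e n / n) Filter.atTop (nhds 1)) :
    Filter.Tendsto (spacingSum e) Filter.atTop Filter.atTop := by
  have h := he.pos_mul_atTop one_pos tendsto_natCast_atTop_atTop
  refine h.congr' ?_
  filter_upwards [Filter.eventually_gt_atTop 0] with n hn
  have : (n : ℝ) ≠ 0 := by positivity
  field_simp

/-- If `H(a) = E[φ(a + e) H(a + e)]` for a standard exponential variable `e`, then the product of
the first `N` values of `φ` along the arrival times, times the value of `H` at the last one, has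
expectation `H 0`. -/
lemma lintegral_prod_mul_spacingSum {φ H : ℝ → ℝ≥0∞} (hφ : Measurable φ) (hH : Measurable H)
    (hrec : ∀ a, 0 ≤ a → ∫⁻ u, φ (a + u) * H (a + u) ∂(expMeasure 1) = H a) (N : ℕ) :
    ∫⁻ e, (∏ n ∈ Finset.range N, φ (spacingSum e (n + 1))) * H (spacingSum e N) ∂expSeqLaw =
      H 0 := by
  induction N with
  | zero => simp [spacingSum]
  | succ N ih =>
    rw [← ih]
    -- extend a finite vector of spacings by zero
    let ext : (Finset.range N → ℝ) → ℕ → ℝ := fun g i =>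
      if h : i ∈ Finset.range N then g ⟨i, h⟩ else 0
    have hext : Measurable ext := by
      refine measurable_pi_lambda _ fun i => ?_
      by_cases h : i ∈ Finset.range N <;> simp only [ext, h, dite_true, dite_false] <;> fun_prop
    have hsum (e : ℕ → ℝ) (n : ℕ) (hn : n ≤ N) :
        spacingSum (ext ((Finset.range N).restrict e)) n = spacingSum e n := by
      refine Finset.sum_congr rfl fun i hi => ?_
      have : i ∈ Finset.range N := Finset.mem_range.2 ((Finset.mem_range.1 hi).trans_le hn)
      simp only [ext, dif_pos this, Finset.restrict]
    let F : (Finset.range N → ℝ) × ℝ → ℝ≥0∞ := fun p =>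
      (∏ n ∈ Finset.range N, φ (spacingSum (ext p.1) (n + 1))) *
        (φ (spacingSum (ext p.1) N + p.2) * H (spacingSum (ext p.1) N + p.2))
    have hF : Measurable F := by
      have h (n : ℕ) : Measurable fun p : (Finset.range N → ℝ) × ℝ => spacingSum (ext p.1) n :=
        (measurable_spacingSum n).comp (hext.comp measurable_fst)
      refine (Finset.measurable_prod _ fun n _ => hφ.comp (h (n + 1))).mul
        ((hφ.comp ((h N).add measurable_snd)).mul (hH.comp ((h N).add measurable_snd)))
    have h1 : ∀ e : ℕ → ℝ, (∏ n ∈ Finset.range (N + 1), φ (spacingSum e (n + 1))) *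
        H (spacingSum e (N + 1)) = F ((Finset.range N).restrict e, e N) := by
      intro e
      simp only [F]
      rw [Finset.prod_range_succ, hsum e N le_rfl, spacingSum_succ, mul_assoc]
      congr 1
      refine Finset.prod_congr rfl fun n hn => ?_
      rw [hsum e (n + 1) (Finset.mem_range.1 hn)]
    simp_rw [h1]
    rw [expSeqLaw, lintegral_infinitePi_range_succ _ N hF]
    refine lintegral_congr_ae ?_
    filter_upwards [ae_expSeqLaw_pos] with e he
    simp only [F]
    rw [lintegral_const_mul _ (by fun_prop), hsum e N le_rfl, hrec _ (spacingSum_nonneg he N)]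
    congr 1
    refine Finset.prod_congr rfl fun n hn => ?_
    rw [hsum e (n + 1) (Finset.mem_range.1 hn)]

/-- The function `a ↦ exp (-∫_a^∞ (1 - φ))` solves the renewal equation of the Poisson process. -/
lemma lintegral_exp_tail_renewal {φ : ℝ → ℝ} (hc : ContinuousOn φ (Ioi 0)) (h0 : ∀ u, 0 ≤ φ u)
    (hi : IntegrableOn (fun u => 1 - φ u) (Ioi 0)) (h1 : ∀ u, φ u ≤ 1) (hm : Measurable φ)
    {a : ℝ} (ha : 0 ≤ a) :
    ∫⁻ u, ENNReal.ofReal (φ (a + u)) *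
      ENNReal.ofReal (Real.exp (-∫ t in Ioi (a + u), (1 - φ t))) ∂(expMeasure 1) =
    ENNReal.ofReal (Real.exp (-∫ t in Ioi a, (1 - φ t))) := by
  set T : ℝ → ℝ := fun a => ∫ t in Ioi a, (1 - φ t)
  have hT_eq (v : ℝ) (hv : 0 ≤ v) : T v = T 0 - ∫ t in (0 : ℝ)..v, (1 - φ t) := by
    have := intervalIntegral.integral_Ioi_sub_Ioi (f := fun t => 1 - φ t) hi hv
    rw [← this]
    ring
  have hii (v : ℝ) (hv : 0 ≤ v) : IntervalIntegrable (fun t => 1 - φ t) volume 0 v :=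
    (intervalIntegrable_iff_integrableOn_Ioc_of_le hv).2 (hi.mono_set Ioc_subset_Ioi_self)
  have hT_cont : ContinuousOn T (Ici 0) := by
    have : ContinuousOn (fun v => T 0 - ∫ t in (0 : ℝ)..v, (1 - φ t)) (Ici 0) := by
      refine continuousOn_const.sub ?_
      intro v hv
      have h2 := intervalIntegral.continuousOn_primitive_interval' (μ := volume)
        (f := fun t => 1 - φ t) (a := 0) (b₁ := 0) (b₂ := v + 1)
        (hii _ (by linarith [mem_Ici.1 hv])) (left_mem_uIcc)
      have hv1 : (0 : ℝ) ≤ v + 1 := by linarith [mem_Ici.1 hv]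
      rw [uIcc_of_le hv1] at h2
      have h3 := h2 v ⟨hv, by linarith⟩
      refine h3.mono_of_mem_nhdsWithin ?_
      rw [mem_nhdsWithin]
      exact ⟨Iio (v + 1), isOpen_Iio, by simp, fun x hx => ⟨hx.2, hx.1.le⟩⟩
    exact this.congr fun v hv => hT_eq v hv
  have hT_deriv (v : ℝ) (hv : 0 < v) : HasDerivAt T (-(1 - φ v)) v := by
    have h2 : HasDerivAt (fun v => T 0 - ∫ t in (0 : ℝ)..v, (1 - φ t)) (-(1 - φ v)) v := by
      have hca : ContinuousAt (fun t => 1 - φ t) v :=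
        continuousAt_const.sub ((hc v hv).continuousAt (Ioi_mem_nhds hv))
      exact (intervalIntegral.integral_hasDerivAt_right (hii v hv.le)
        ((measurable_const.sub hm).stronglyMeasurable.stronglyMeasurableAtFilter) hca).const_sub _
    refine h2.congr_of_eventuallyEq ?_
    filter_upwards [Ioi_mem_nhds hv] with x hx using hT_eq x (le_of_lt hx)
  have hT_nonneg (v : ℝ) : 0 ≤ T v := integral_nonneg fun t => sub_nonneg.2 (h1 t)
  have hexp1 (v : ℝ) : Real.exp (-T v) ≤ 1 := Real.exp_le_one_iff.2 (by linarith [hT_nonneg v])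
  -- the derivative of `v ↦ -exp (-v) exp (-T v)` is `exp (-v) φ v exp (-T v)`
  have hderiv (v : ℝ) (hv : v ∈ Ioi a) :
      HasDerivAt (fun v => -(Real.exp (-v) * Real.exp (-T v)))
        (Real.exp (-v) * (φ v * Real.exp (-T v))) v := by
    have hv' : 0 < v := ha.trans_lt hv
    have := (((hasDerivAt_id v).neg.exp).mul ((hT_deriv v hv').neg.exp)).neg
    convert! this using 1
    simp
    ring
  have hcw : ContinuousWithinAt (fun v => -(Real.exp (-v) * Real.exp (-T v))) (Ici a) a := by
    have h2 := (hT_cont a ha).mono (Ici_subset_Ici.2 ha)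
    have h3 : ContinuousWithinAt (fun v => Real.exp (-v)) (Ici a) a :=
      (Continuous.continuousWithinAt (by fun_prop))
    exact (h3.mul h2.neg.rexp).neg
  have hpos : ∀ v ∈ Ioi a, 0 ≤ Real.exp (-v) * (φ v * Real.exp (-T v)) := fun v _ => by
    have := h0 v
    positivity
  have htend : Filter.Tendsto (fun v => -(Real.exp (-v) * Real.exp (-T v))) Filter.atTop
      (nhds 0) := by
    rw [← neg_zero]
    refine Filter.Tendsto.neg ?_
    refine squeeze_zero (fun v => by positivity) (fun v => ?_)
      (Real.tendsto_exp_neg_atTop_nhds_zero)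
    exact mul_le_of_le_one_right (Real.exp_nonneg _) (hexp1 v)
  have hint := integrableOn_Ioi_deriv_of_nonneg hcw hderiv hpos htend
  have hval := integral_Ioi_of_hasDerivAt_of_nonneg hcw hderiv hpos htend
  have hTm : ∫⁻ v in Ioi a, ENNReal.ofReal (Real.exp (-v) * (φ v * Real.exp (-T v))) =
      ENNReal.ofReal (Real.exp (-a) * Real.exp (-T a)) := by
    rw [← ofReal_integral_eq_lintegral_ofReal hint
      (by filter_upwards [ae_restrict_mem measurableSet_Ioi] with v hv using hpos v hv), hval]
    simp
  -- shift the variable by `a`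
  have hAE : AEMeasurable (fun u => ENNReal.ofReal (φ (a + u)) *
      ENNReal.ofReal (Real.exp (-T (a + u)))) (volume.restrict (Ioi 0)) := by
    refine (by fun_prop : Measurable fun u => ENNReal.ofReal (φ (a + u))).aemeasurable.mul ?_
    refine ((ContinuousOn.aemeasurable (f := fun u => Real.exp (-T (a + u))) ?_
      measurableSet_Ioi).ennreal_ofReal)
    refine (ContinuousOn.neg (hT_cont.comp (by fun_prop) fun u hu => ?_)).rexp
    exact add_nonneg ha (le_of_lt hu)
  rw [expMeasure_one_eq, lintegral_withDensity_eq_lintegral_mul₀ (by fun_prop) hAE]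
  have hshift : ∫⁻ u in Ioi (0 : ℝ), ENNReal.ofReal (Real.exp (-(a + u)) *
      (φ (a + u) * Real.exp (-T (a + u)))) =
      ENNReal.ofReal (Real.exp (-a) * Real.exp (-T a)) := by
    rw [← hTm, ← lintegral_indicator measurableSet_Ioi, ← lintegral_indicator measurableSet_Ioi]
    rw [← lintegral_add_left_eq_self ((Ioi a).indicator _) a]
    refine lintegral_congr fun u => ?_
    by_cases hu : 0 < u
    · rw [indicator_of_mem (mem_Ioi.2 hu), indicator_of_mem (mem_Ioi.2 (by linarith))]
    · rw [indicator_of_notMem (mt mem_Ioi.1 hu),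
        indicator_of_notMem (mt mem_Ioi.1 (by linarith))]
  have h4 : ∀ u : ℝ, ENNReal.ofReal (Real.exp (-u)) * (ENNReal.ofReal (φ (a + u)) *
      ENNReal.ofReal (Real.exp (-T (a + u)))) = ENNReal.ofReal (Real.exp a) *
      ENNReal.ofReal (Real.exp (-(a + u)) * (φ (a + u) * Real.exp (-T (a + u)))) := by
    intro u
    have := h0 (a + u)
    rw [← ENNReal.ofReal_mul this, ← ENNReal.ofReal_mul (by positivity),
      ← ENNReal.ofReal_mul (by positivity), ← mul_assoc (Real.exp a), ← Real.exp_add]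
    simp
  simp only [Pi.mul_apply, h4]
  rw [lintegral_const_mul' _ _ ENNReal.ofReal_ne_top, hshift, ← ENNReal.ofReal_mul (by positivity),
    ← mul_assoc, ← Real.exp_add, add_neg_cancel, Real.exp_zero, one_mul]

/-- The tail integral of an integrable function tends to zero at infinity. -/
lemma tendsto_integral_Ioi_atTop {g : ℝ → ℝ} (hi : IntegrableOn g (Ioi 0)) :
    Filter.Tendsto (fun a => ∫ t in Ioi a, g t) Filter.atTop (nhds 0) := by
  have h := intervalIntegral_tendsto_integral_Ioi 0 hi Filter.tendsto_id
  have h2 : Filter.Tendsto (fun a => (∫ t in Ioi 0, g t) - ∫ t in (0 : ℝ)..a, g t) Filter.atTop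
      (nhds 0) := by
    simpa using h.const_sub (∫ t in Ioi 0, g t)
  refine h2.congr' ?_
  filter_upwards [Filter.eventually_ge_atTop 0] with a ha
  rw [← intervalIntegral.integral_Ioi_sub_Ioi hi ha]
  ring

/-- The generating functional of the unit-rate Poisson process, with the infinite product given as
the limit `V` of its partial products. -/
lemma lintegral_prod_spacingSum_limit {φ : ℝ → ℝ} (hc : ContinuousOn φ (Ioi 0))
    (h0 : ∀ u, 0 ≤ φ u) (h1 : ∀ u, φ u ≤ 1) (hm : Measurable φ)
    (hi : IntegrableOn (fun u => 1 - φ u) (Ioi 0)) {V : (ℕ → ℝ) → ℝ≥0∞}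
    (hV : ∀ᵐ e ∂expSeqLaw, Filter.Tendsto
      (fun N => ∏ n ∈ Finset.range N, ENNReal.ofReal (φ (spacingSum e (n + 1)))) Filter.atTop
      (nhds (V e))) :
    ∫⁻ e, V e ∂expSeqLaw = ENNReal.ofReal (Real.exp (-∫ t in Ioi 0, (1 - φ t))) := by
  let H : ℝ → ℝ≥0∞ := fun a => ENNReal.ofReal (Real.exp (-∫ t in Ioi a, (1 - φ t)))
  have hHm : Measurable H := by
    have : Measurable fun a : ℝ => ∫ t, (Ioi a).indicator (fun t => 1 - φ t) t := by
      have h2 : Measurable fun p : ℝ × ℝ => (Ioi p.1).indicator (fun t => 1 - φ t) p.2 := by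
        have : (fun p : ℝ × ℝ => (Ioi p.1).indicator (fun t => 1 - φ t) p.2) =
            {p : ℝ × ℝ | p.1 < p.2}.indicator fun p => 1 - φ p.2 := by
          ext p
          simp only [indicator, mem_Ioi, mem_ofPred_eq]
        rw [this]
        exact (by fun_prop : Measurable fun p : ℝ × ℝ => 1 - φ p.2).indicator
          (measurableSet_lt measurable_fst measurable_snd)
      exact (h2.stronglyMeasurable.integral_prod_right (ν := volume)).measurable
    simp only [integral_indicator measurableSet_Ioi] at this
    exact this.neg.exp.ennreal_ofReal
  have hrec := lintegral_prod_mul_spacingSum (φ := fun u => ENNReal.ofReal (φ u)) (H := H)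
    hm.ennreal_ofReal hHm (fun a ha => lintegral_exp_tail_renewal hc h0 hi h1 hm ha)
  have hφ1 (u : ℝ) : ENNReal.ofReal (φ u) ≤ 1 := ENNReal.ofReal_le_one.2 (h1 u)
  have hH1 (a : ℝ) : H a ≤ 1 := by
    refine ENNReal.ofReal_le_one.2 (Real.exp_le_one_iff.2 (neg_nonpos.2 ?_))
    exact integral_nonneg fun t => sub_nonneg.2 (h1 t)
  have hlim := tendsto_lintegral_of_dominated_convergence (μ := expSeqLaw)
    (F := fun N e => (∏ n ∈ Finset.range N, ENNReal.ofReal (φ (spacingSum e (n + 1)))) *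
      H (spacingSum e N)) (f := V) (fun _ => 1)
    (fun N => (Finset.measurable_prod _ fun n _ =>
      (by fun_prop : Measurable fun e : ℕ → ℝ => ENNReal.ofReal (φ (spacingSum e (n + 1))))).mul
        (hHm.comp (measurable_spacingSum N)))
    (fun N => ae_of_all _ fun e => mul_le_one' (Finset.prod_le_one' fun n _ => hφ1 _) (hH1 _))
    (by simp) ?_
  · simp only [hrec] at hlim
    exact (tendsto_nhds_unique hlim tendsto_const_nhds)
  · filter_upwards [hV, ae_tendsto_spacingSum_div] with e he1 he2
    have h3 := (tendsto_integral_Ioi_atTop hi).comp (tendsto_spacingSum_atTop he2)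
    have h4 : Filter.Tendsto (fun N => H (spacingSum e N)) Filter.atTop (nhds 1) := by
      have := ENNReal.tendsto_ofReal (h3.neg.rexp)
      simpa using this
    simpa using ENNReal.Tendsto.mul he1 (Or.inr (by simp)) h4 (Or.inr
      (ne_top_of_le_ne_top ENNReal.one_ne_top
        (le_of_tendsto' he1 fun N => Finset.prod_le_one' fun n _ => hφ1 _)))

/-! ### The stable random measure on the unit interval -/

/-- The purely atomic measure with masses `z.1 n` at the points `z.2 n`. -/
def atomicMeasure (z : (ℕ → ℝ) × (ℕ → unitInterval)) : Measure unitInterval :=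
  Measure.sum fun n => ENNReal.ofReal (z.1 n) • Measure.dirac (z.2 n)

lemma lintegral_atomicMeasure (z : (ℕ → ℝ) × (ℕ → unitInterval)) {f : unitInterval → ℝ≥0∞}
    (hf : Measurable f) :
    ∫⁻ x, f x ∂(atomicMeasure z) = ∑' n, ENNReal.ofReal (z.1 n) * f (z.2 n) := by
  rw [atomicMeasure, lintegral_sum_measure]
  refine tsum_congr fun n => ?_
  rw [lintegral_smul_measure, lintegral_dirac' _ hf, smul_eq_mul]

lemma atomicMeasure_univ (z : (ℕ → ℝ) × (ℕ → unitInterval)) :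
    atomicMeasure z univ = ∑' n, ENNReal.ofReal (z.1 n) := by
  rw [← lintegral_one, lintegral_atomicMeasure z measurable_const]
  simp

@[fun_prop]
lemma measurable_atomicMeasure : Measurable atomicMeasure := by
  refine Measure.measurable_of_measurable_coe _ fun B hB => ?_
  have : (fun z => atomicMeasure z B) =
      fun z => ∑' n, ENNReal.ofReal (z.1 n) * B.indicator 1 (z.2 n) := by
    ext z
    rw [← lintegral_indicator_one hB, lintegral_atomicMeasure z (measurable_one.indicator hB)]
  rw [this]
  refine Measurable.tsum fun n => ?_
  exact ((measurable_pi_apply n).comp measurable_fst).ennreal_ofReal.mul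
    ((measurable_one.indicator hB).comp ((measurable_pi_apply n).comp measurable_snd))

lemma measurable_expNeg_lintegral {Ω E : Type*} [MeasurableSpace Ω] [MeasurableSpace E]
    {f : E → ℝ≥0} (hf : Measurable f) {M : Ω → Measure E} (hM : Measurable M) :
    Measurable fun ω => expNeg (∫⁻ x, f x ∂(M ω)) :=
  measurable_expNeg.comp ((Measure.measurable_lintegral hf.coe_nnreal_ennreal).comp hM)

/-- The law of the spacings and locations from which the stable random measure is built. -/
def markedLaw : Measure ((ℕ → ℝ) × (ℕ → unitInterval)) :=
  expSeqLaw.prod (Measure.infinitePi fun _ => volume)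

instance : IsProbabilityMeasure markedLaw := by unfold markedLaw; infer_instance

/-- The stable random measure on `[0,1]`, with uniform locations. -/
def stableCRM (α : ℝ) (z : (ℕ → ℝ) × (ℕ → unitInterval)) : Measure unitInterval :=
  atomicMeasure (rankedJump (stableDensity α) z.1, z.2)

section

variable {α : ℝ}

lemma measurable_rankedJump (hα0 : 0 < α) (hα1 : α < 1) :
    Measurable (rankedJump (stableDensity α)) :=
  measurable_pi_lambda _ fun n => (measurable_invTail_stableDensity hα0 hα1).comp
    (measurable_spacingSum (n + 1))

lemma measurable_stableCRM (hα0 : 0 < α) (hα1 : α < 1) : Measurable (stableCRM α) :=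
  measurable_atomicMeasure.comp
    (((measurable_rankedJump hα0 hα1).comp measurable_fst).prodMk measurable_snd)

lemma rankedJump_nonneg (lam : ℝ → ℝ) (e : ℕ → ℝ) (n : ℕ) : 0 ≤ rankedJump lam e n :=
  invTail_nonneg _ _

lemma totalJump_eq_toReal (lam : ℝ → ℝ) (e : ℕ → ℝ) :
    totalJump lam e = (∑' n, ENNReal.ofReal (rankedJump lam e n)).toReal := by
  rw [ENNReal.tsum_toReal_eq fun n => ENNReal.ofReal_ne_top]
  exact tsum_congr fun n => (ENNReal.toReal_ofReal (rankedJump_nonneg _ _ _)).symm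

lemma measurable_totalJump (hα0 : 0 < α) (hα1 : α < 1) :
    Measurable (totalJump (stableDensity α)) := by
  rw [funext (totalJump_eq_toReal (stableDensity α))]
  exact (Measurable.tsum fun n =>
    ((measurable_pi_apply n).comp (measurable_rankedJump hα0 hα1)).ennreal_ofReal).ennreal_toReal

/-- The jumps are almost surely positive and summable: the `n`-th one is of order
`n ^ (-1/α)`. -/
lemma ae_rankedJump (hα0 : 0 < α) (hα1 : α < 1) : ∀ᵐ e ∂expSeqLaw,
    (∀ n, 0 < rankedJump (stableDensity α) e n) ∧ Summable (rankedJump (stableDensity α) e) := by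
  have hG := Real.Gamma_pos_of_pos (sub_pos.2 hα1)
  filter_upwards [ae_expSeqLaw_pos, ae_tendsto_spacingSum_div] with e he hlim
  have hpos (n : ℕ) : 0 < spacingSum e (n + 1) :=
    Finset.sum_pos (fun i _ => he i) ⟨0, by simp⟩
  have hJ (n : ℕ) : rankedJump (stableDensity α) e n =
      (Real.Gamma (1 - α) * spacingSum e (n + 1)) ^ (-α⁻¹) := by
    rw [rankedJump, arrival_eq, invTail_stableDensity hα0 hα1, if_pos (hpos n)]
  refine ⟨fun n => ?_, ?_⟩
  · rw [hJ]
    exact Real.rpow_pos_of_pos (mul_pos hG (hpos n)) _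
  · have hs : Summable fun n : ℕ =>
        (Real.Gamma (1 - α) / 2) ^ (-α⁻¹) * ((n + 1 : ℕ) : ℝ) ^ (-α⁻¹) := by
      refine Summable.mul_left _ ((summable_nat_add_iff 1).2 (Real.summable_nat_rpow.2 ?_))
      have := (one_lt_inv₀ hα0).2 hα1
      linarith
    refine hs.of_norm_bounded_eventually_nat ?_
    have h1 : ∀ᶠ n : ℕ in Filter.atTop, 1 / 2 < spacingSum e n / n :=
      hlim.eventually (lt_mem_nhds (by norm_num))
    filter_upwards [(Filter.tendsto_add_atTop_nat 1).eventually h1] with n hn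
    have hn0 : (0 : ℝ) < (n + 1 : ℕ) := by positivity
    rw [lt_div_iff₀ hn0] at hn
    rw [Real.norm_of_nonneg (rankedJump_nonneg _ _ _), hJ,
      ← Real.mul_rpow (by positivity) hn0.le]
    refine Real.rpow_le_rpow_of_nonpos (by positivity) ?_ (by simpa using hα0.le)
    nlinarith

lemma stableCRM_univ_of_summable {z : (ℕ → ℝ) × (ℕ → unitInterval)}
    (hz : Summable (rankedJump (stableDensity α) z.1)) :
    stableCRM α z univ = ENNReal.ofReal (totalJump (stableDensity α) z.1) := by
  rw [stableCRM, atomicMeasure_univ, totalJump,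
    ENNReal.ofReal_tsum_of_nonneg (rankedJump_nonneg _ _) hz]

lemma ae_markedLaw_of_ae_expSeqLaw {p : (ℕ → ℝ) → Prop} (h : ∀ᵐ e ∂expSeqLaw, p e) :
    ∀ᵐ z ∂markedLaw, p z.1 :=
  Measure.quasiMeasurePreserving_fst.ae h

lemma ae_stableCRM (hα0 : 0 < α) (hα1 : α < 1) : ∀ᵐ z ∂markedLaw,
    stableCRM α z univ = ENNReal.ofReal (totalJump (stableDensity α) z.1) ∧
      0 < totalJump (stableDensity α) z.1 := by
  filter_upwards [ae_markedLaw_of_ae_expSeqLaw (ae_rankedJump hα0 hα1)] with z hz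
  exact ⟨stableCRM_univ_of_summable hz.2,
    hz.2.tsum_pos (rankedJump_nonneg _ _) 0 (hz.1 0)⟩

/-- The mean of `exp (-f(ω) J(u))` over a uniform location `ω`, with `J` the inverse tail. -/
def meanExp (α : ℝ) (f : unitInterval → ℝ≥0) (u : ℝ) : ℝ :=
  ∫ x, Real.exp (-(f x * invTail (stableDensity α) u))

variable {f : unitInterval → ℝ≥0}

lemma exp_neg_mul_mem_Icc {a b : ℝ} (ha : 0 ≤ a) (hb : 0 ≤ b) :
    Real.exp (-(a * b)) ∈ Icc (0 : ℝ) 1 :=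
  ⟨Real.exp_nonneg _, Real.exp_le_one_iff.2 (neg_nonpos.2 (mul_nonneg ha hb))⟩

lemma integrable_exp_neg_mul (hf : Measurable f) {j : ℝ} (hj : 0 ≤ j) :
    Integrable (fun x => Real.exp (-(f x * j))) (volume : Measure unitInterval) := by
  refine Integrable.of_bound (by fun_prop) 1 (ae_of_all _ fun x => ?_)
  have := exp_neg_mul_mem_Icc (f x).coe_nonneg hj
  rw [Real.norm_of_nonneg this.1]
  exact this.2

lemma ofReal_meanExp (hf : Measurable f) (u : ℝ) : ENNReal.ofReal (meanExp α f u) =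
    ∫⁻ x, expNeg (ENNReal.ofReal (invTail (stableDensity α) u) * f x) := by
  rw [meanExp, ofReal_integral_eq_lintegral_ofReal (integrable_exp_neg_mul hf (invTail_nonneg _ _))
    (ae_of_all _ fun x => Real.exp_nonneg _)]
  refine lintegral_congr fun x => ?_
  rw [← expNeg_ofReal (mul_nonneg (f x).coe_nonneg (invTail_nonneg _ _)), mul_comm,
    ENNReal.ofReal_mul (invTail_nonneg _ _), ENNReal.ofReal_coe_nnreal]

lemma meanExp_mem_Icc (u : ℝ) : meanExp α f u ∈ Icc (0 : ℝ) 1 := by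
  refine ⟨integral_nonneg fun x => Real.exp_nonneg _, ?_⟩
  have := integral_mono_of_nonneg (μ := (volume : Measure unitInterval))
    (f := fun x => Real.exp (-(f x * invTail (stableDensity α) u))) (g := fun _ => 1)
    (ae_of_all _ fun x => Real.exp_nonneg _) (integrable_const _)
    (ae_of_all _ fun x => (exp_neg_mul_mem_Icc (f x).coe_nonneg (invTail_nonneg _ u)).2)
  simpa [meanExp] using this

lemma measurable_meanExp (hα0 : 0 < α) (hα1 : α < 1) (hf : Measurable f) :
    Measurable (meanExp α f) := by
  have := measurable_invTail_stableDensity hα0 hα1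
  have h : Measurable fun p : ℝ × unitInterval =>
      Real.exp (-(f p.2 * invTail (stableDensity α) p.1)) := by fun_prop
  exact (h.stronglyMeasurable.integral_prod_right (ν := volume)).measurable

lemma continuousOn_meanExp (hα0 : 0 < α) (hα1 : α < 1) (hf : Measurable f) :
    ContinuousOn (meanExp α f) (Ioi 0) := by
  have hG := Real.Gamma_pos_of_pos (sub_pos.2 hα1)
  refine continuousOn_of_dominated (bound := fun _ => 1) (fun u _ => by fun_prop)
    (fun u _ => ae_of_all _ fun x => ?_) (integrable_const _) (ae_of_all _ fun x => ?_)
  · have := exp_neg_mul_mem_Icc (f x).coe_nonneg (invTail_nonneg (stableDensity α) u)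
    rw [Real.norm_of_nonneg this.1]
    exact this.2
  · have : ContinuousOn (invTail (stableDensity α)) (Ioi 0) := by
      have h : ContinuousOn (fun u => (Real.Gamma (1 - α) * u) ^ (-α⁻¹)) (Ioi 0) :=
        ContinuousOn.rpow_const (by fun_prop) fun u hu => Or.inl (mul_pos hG hu).ne'
      refine h.congr fun u hu => ?_
      exact (invTail_stableDensity hα0 hα1 u).trans (if_pos hu)
    exact (continuousOn_const.mul this).neg.rexp

lemma integrable_rpow_of_bound {p : ℝ} (hp : 0 ≤ p) (hf : Measurable f) {C : ℝ≥0}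
    (hC : ∀ x, f x ≤ C) :
    Integrable (fun x => (f x : ℝ) ^ p) (volume : Measure unitInterval) := by
  refine Integrable.of_bound (by fun_prop) ((C : ℝ) ^ p) (ae_of_all _ fun x => ?_)
  rw [Real.norm_of_nonneg (by positivity)]
  exact Real.rpow_le_rpow (f x).coe_nonneg (NNReal.coe_le_coe.2 (hC x)) hp

lemma integral_one_sub_meanExp (hα0 : 0 < α) (hα1 : α < 1) (hf : Measurable f) {C : ℝ≥0}
    (hC : ∀ x, f x ≤ C) :
    IntegrableOn (fun u => 1 - meanExp α f u) (Ioi 0) ∧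
      ∫ u in Ioi 0, (1 - meanExp α f u) = ∫ x, (f x : ℝ) ^ α := by
  have hJm := measurable_invTail_stableDensity hα0 hα1
  have hm := measurable_meanExp hα0 hα1 hf
  have hnn : 0 ≤ᵐ[volume.restrict (Ioi 0)] fun u => 1 - meanExp α f u :=
    ae_of_all _ fun u => sub_nonneg.2 (meanExp_mem_Icc u).2
  have hl : ∫⁻ u in Ioi 0, ENNReal.ofReal (1 - meanExp α f u) =
      ENNReal.ofReal (∫ x, (f x : ℝ) ^ α) := by
    have h1 (u : ℝ) : ENNReal.ofReal (1 - meanExp α f u) =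
        ∫⁻ x, ENNReal.ofReal (1 - Real.exp (-(f x * invTail (stableDensity α) u))) := by
      have hi := integrable_exp_neg_mul hf (invTail_nonneg (stableDensity α) u)
      have hs : Integrable (fun x => 1 - Real.exp (-(f x * invTail (stableDensity α) u)))
          (volume : Measure unitInterval) := (integrable_const 1).sub hi
      rw [← ofReal_integral_eq_lintegral_ofReal hs (ae_of_all _ fun x =>
          sub_nonneg.2 (exp_neg_mul_mem_Icc (f x).coe_nonneg (invTail_nonneg _ u)).2),
        integral_sub (integrable_const 1) hi]
      simp [meanExp]
    simp_rw [h1]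
    rw [lintegral_lintegral_swap (by fun_prop),
      ofReal_integral_eq_lintegral_ofReal (integrable_rpow_of_bound hα0.le hf hC)
        (ae_of_all _ fun x => by positivity)]
    exact lintegral_congr fun x => lintegral_one_sub_exp_invTail hα0 hα1 (f x).coe_nonneg
  constructor
  · refine ⟨by fun_prop, ?_⟩
    rw [hasFiniteIntegral_iff_ofReal hnn, hl]
    exact ENNReal.ofReal_lt_top
  · rw [integral_eq_lintegral_of_nonneg_ae hnn (by fun_prop), hl, ENNReal.toReal_ofReal]
    exact integral_nonneg fun x => by positivity

/-- Laplace functional of the stable random measure. -/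
theorem laplace_stableCRM (hα0 : 0 < α) (hα1 : α < 1) (hf : Measurable f) {C : ℝ≥0}
    (hC : ∀ x, f x ≤ C) :
    ∫⁻ z, expNeg (∫⁻ x, f x ∂(stableCRM α z)) ∂markedLaw =
      ENNReal.ofReal (Real.exp (-∫ x, (f x : ℝ) ^ α)) := by
  obtain ⟨hi, hval⟩ := integral_one_sub_meanExp hα0 hα1 hf hC
  have hJ := measurable_rankedJump hα0 hα1
  rw [markedLaw, lintegral_prod _
    (measurable_expNeg_lintegral hf (measurable_stableCRM hα0 hα1)).aemeasurable]
  rw [← hval]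
  refine lintegral_prod_spacingSum_limit (continuousOn_meanExp hα0 hα1 hf)
    (fun u => (meanExp_mem_Icc u).1) (fun u => (meanExp_mem_Icc u).2)
    (measurable_meanExp hα0 hα1 hf) hi (ae_of_all _ fun e => ?_)
  have hcoord (n : ℕ) : Measurable fun ω : ℕ → unitInterval =>
      ENNReal.ofReal (rankedJump (stableDensity α) e n) * f (ω n) :=
    (hf.comp (measurable_pi_apply n)).coe_nnreal_ennreal.const_mul _
  -- integrate the independent locations one by one
  have hfin (N : ℕ) : ∏ n ∈ Finset.range N, ENNReal.ofReal (meanExp α f (spacingSum e (n + 1))) =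
      ∫⁻ ω : ℕ → unitInterval, expNeg (∑ n ∈ Finset.range N,
        ENNReal.ofReal (rankedJump (stableDensity α) e n) * f (ω n))
          ∂(Measure.infinitePi fun _ => volume) := by
    simp_rw [expNeg_sum]
    have hind : iIndepFun (fun (n : ℕ) (ω : ℕ → unitInterval) =>
        expNeg (ENNReal.ofReal (rankedJump (stableDensity α) e n) * f (ω n)))
        (Measure.infinitePi fun _ => volume) :=
      iIndepFun_infinitePi (X := fun n x =>
        expNeg (ENNReal.ofReal (rankedJump (stableDensity α) e n) * f x)) fun n => by fun_prop
    rw [lintegral_prod_eq_prod_lintegral_of_indepFun _ _ hind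
      fun n => measurable_expNeg.comp (hcoord n)]
    refine Finset.prod_congr rfl fun n _ => ?_
    rw [ofReal_meanExp hf, ← (measurePreserving_eval_infinitePi
      (fun _ : ℕ => (volume : Measure unitInterval)) n).lintegral_comp (by fun_prop)]
    rfl
  simp_rw [hfin]
  refine tendsto_lintegral_of_dominated_convergence (fun _ => 1)
    (fun N => measurable_expNeg.comp (Finset.measurable_sum _ fun n _ => hcoord n))
    (fun N => ae_of_all _ fun ω => expNeg_le_one _) (by simp) (ae_of_all _ fun ω => ?_)
  rw [stableCRM, lintegral_atomicMeasure _ hf.coe_nnreal_ennreal]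
  exact (continuous_expNeg.tendsto _).comp (ENNReal.tendsto_nat_tsum _)

end

/-! ### Exponential and linear tilts of the stable random measure -/

section

variable {α : ℝ} {f : unitInterval → ℝ≥0}

lemma totalJump_nonneg (lam : ℝ → ℝ) (e : ℕ → ℝ) : 0 ≤ totalJump lam e :=
  tsum_nonneg fun n => rankedJump_nonneg lam e n

/-- Laplace functional of the stable random measure under an exponential tilt. -/
lemma laplace_stableCRM_exp_tilt (hα0 : 0 < α) (hα1 : α < 1) (hf : Measurable f) {C : ℝ≥0}
    (hC : ∀ x, f x ≤ C) {β : ℝ} (hβ : 0 ≤ β) :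
    ∫⁻ z, ENNReal.ofReal (Real.exp (-(β * totalJump (stableDensity α) z.1))) *
      expNeg (∫⁻ x, f x ∂(stableCRM α z)) ∂markedLaw =
      ENNReal.ofReal (Real.exp (-∫ x, (β + f x) ^ α)) := by
  have h := laplace_stableCRM hα0 hα1 (f := fun x => β.toNNReal + f x) (by fun_prop)
    (C := β.toNNReal + C) (fun x => by gcongr; exact hC x)
  simp only [NNReal.coe_add, Real.coe_toNNReal _ hβ] at h
  rw [← h]
  refine lintegral_congr_ae ?_
  filter_upwards [ae_stableCRM hα0 hα1] with z hz
  simp only [ENNReal.coe_add]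
  rw [lintegral_add_left measurable_const, lintegral_const, hz.1, expNeg_add,
    ← ENNReal.ofReal, ← ENNReal.ofReal_mul hβ,
    expNeg_ofReal (mul_nonneg hβ (totalJump_nonneg _ _))]

lemma mul_exp_neg_le {c s : ℝ} (hc : 0 < c) : s * Real.exp (-(c * s)) ≤ c⁻¹ := by
  have h1 : c * s ≤ Real.exp (c * s) := by linarith [Real.add_one_le_exp (c * s)]
  rw [Real.exp_neg, ← div_eq_mul_inv, div_le_iff₀ (Real.exp_pos _), ← div_eq_inv_mul,
    le_div_iff₀ hc]
  linarith

lemma hasDerivAt_integral_add_rpow (hα0 : 0 < α) (hα1 : α < 1) (hf : Measurable f) {C : ℝ≥0}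
    (hC : ∀ x, f x ≤ C) {β : ℝ} (hβ : 0 < β) :
    HasDerivAt (fun β : ℝ => ∫ x, (β + f x) ^ α) (∫ x, α * (β + f x) ^ (α - 1)) β := by
  have hball {y : ℝ} (hy : y ∈ Metric.ball β (β / 2)) : β / 2 < y := by
    have := (abs_lt.1 (Real.dist_eq y β ▸ Metric.mem_ball.1 hy)).1
    linarith
  refine (hasDerivAt_integral_of_dominated_loc_of_deriv_le (μ := (volume : Measure unitInterval))
    (F := fun (β : ℝ) x => (β + f x : ℝ) ^ α)
    (F' := fun (β : ℝ) x => α * (β + f x : ℝ) ^ (α - 1))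
    (bound := fun _ => α * (β / 2) ^ (α - 1)) (Metric.ball_mem_nhds β (half_pos hβ))
    (Filter.Eventually.of_forall fun y => (by fun_prop : Measurable _).aestronglyMeasurable) ?_
    (by fun_prop : Measurable _).aestronglyMeasurable
    (ae_of_all _ fun x y hy => ?_) (integrable_const _) (ae_of_all _ fun x y hy => ?_)).2
  · have := integrable_rpow_of_bound (f := fun x => β.toNNReal + f x) hα0.le (by fun_prop)
      (C := β.toNNReal + C) (fun x => by gcongr; exact hC x)
    simpa only [NNReal.coe_add, Real.coe_toNNReal _ hβ.le] using this
  · have h1 := hball hy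
    have h2 : 0 < y + f x := by linarith [(f x).coe_nonneg]
    rw [Real.norm_of_nonneg (by positivity)]
    gcongr α * ?_
    exact Real.rpow_le_rpow_of_nonpos (by linarith) (by linarith [(f x).coe_nonneg]) (by linarith)
  · have h1 := hball hy
    have h2 : 0 < y + f x := by linarith [(f x).coe_nonneg]
    have := ((hasDerivAt_id y).add_const (f x : ℝ)).rpow_const (p := α) (Or.inl h2.ne')
    convert! this using 1
    simp

/-- Laplace functional of the stable random measure under an exponential tilt and a tilt by the
total mass, by differentiation in the parameter of the exponential tilt. -/
lemma laplace_stableCRM_mul_exp_tilt (hα0 : 0 < α) (hα1 : α < 1) (hf : Measurable f) {C : ℝ≥0}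
    (hC : ∀ x, f x ≤ C) {β : ℝ} (hβ : 0 < β) :
    ∫⁻ z, ENNReal.ofReal (totalJump (stableDensity α) z.1 *
      Real.exp (-(β * totalJump (stableDensity α) z.1))) *
        expNeg (∫⁻ x, f x ∂(stableCRM α z)) ∂markedLaw =
      ENNReal.ofReal ((∫ x, α * (β + f x) ^ (α - 1)) * Real.exp (-∫ x, (β + f x) ^ α)) := by
  set S : (ℕ → ℝ) × (ℕ → unitInterval) → ℝ := fun z => totalJump (stableDensity α) z.1
  set Y : (ℕ → ℝ) × (ℕ → unitInterval) → ℝ := fun z => (expNeg (∫⁻ x, f x ∂(stableCRM α z))).toReal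
  have hS0 (z) : 0 ≤ S z := totalJump_nonneg _ _
  have hY0 (z) : 0 ≤ Y z := ENNReal.toReal_nonneg
  have hY1 (z) : Y z ≤ 1 := ENNReal.toReal_le_of_le_ofReal zero_le_one (by simpa using expNeg_le_one _)
  have hYo (z) : ENNReal.ofReal (Y z) = expNeg (∫⁻ x, f x ∂(stableCRM α z)) :=
    ENNReal.ofReal_toReal (ne_top_of_le_ne_top ENNReal.one_ne_top (expNeg_le_one _))
  have hSm : Measurable S := (measurable_totalJump hα0 hα1).comp measurable_fst
  have hYm : Measurable Y :=
    (measurable_expNeg_lintegral hf (measurable_stableCRM hα0 hα1)).ennreal_toReal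
  have hball {y : ℝ} (hy : y ∈ Metric.ball β (β / 2)) : β / 2 < y := by
    have := (abs_lt.1 (Real.dist_eq y β ▸ Metric.mem_ball.1 hy)).1
    linarith
  have hexp1 {y : ℝ} (hy : 0 ≤ y) (z) : Real.exp (-(y * S z)) ≤ 1 :=
    (exp_neg_mul_mem_Icc hy (hS0 z)).2
  have hderiv := hasDerivAt_integral_of_dominated_loc_of_deriv_le (μ := markedLaw)
    (F := fun β z => Real.exp (-(β * S z)) * Y z)
    (F' := fun β z => -(S z * Real.exp (-(β * S z)) * Y z))
    (bound := fun _ => (β / 2)⁻¹) (Metric.ball_mem_nhds β (half_pos hβ))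
    (Filter.Eventually.of_forall fun y => by fun_prop)
    (Integrable.of_bound (by fun_prop) 1 (ae_of_all _ fun z => by
      rw [Real.norm_of_nonneg (mul_nonneg (Real.exp_nonneg _) (hY0 z))]
      exact mul_le_one₀ (hexp1 hβ.le z) (hY0 z) (hY1 z))) (by fun_prop)
    (ae_of_all _ fun z y hy => by
      have h1 := hball hy
      have h2 : 0 < y := by linarith
      rw [norm_neg, Real.norm_of_nonneg (mul_nonneg (mul_nonneg (hS0 z) (Real.exp_nonneg _)) (hY0 z))]
      calc S z * Real.exp (-(y * S z)) * Y z ≤ S z * Real.exp (-(y * S z)) * 1 := by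
            gcongr
            · exact mul_nonneg (hS0 z) (Real.exp_nonneg _)
            · exact hY1 z
        _ ≤ y⁻¹ := by rw [mul_one]; exact mul_exp_neg_le h2
        _ ≤ (β / 2)⁻¹ := inv_anti₀ (half_pos hβ) h1.le) (integrable_const _)
    (ae_of_all _ fun z y hy => by
      have := (((hasDerivAt_id y).mul_const (S z)).neg.exp).mul_const (Y z)
      convert! this using 1
      simp only [Pi.neg_apply, id]
      ring)
  have hval (y : ℝ) (hy : 0 ≤ y) : ∫ z, Real.exp (-(y * S z)) * Y z ∂markedLaw =
      Real.exp (-∫ x, (y + f x) ^ α) := by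
    rw [integral_eq_lintegral_of_nonneg_ae
      (ae_of_all _ fun z => mul_nonneg (Real.exp_nonneg _) (hY0 z)) (by fun_prop),
      ← ENNReal.toReal_ofReal (Real.exp_nonneg (-∫ x, (y + f x) ^ α)),
      ← laplace_stableCRM_exp_tilt hα0 hα1 hf hC hy]
    congr 1
    refine lintegral_congr fun z => ?_
    rw [ENNReal.ofReal_mul (Real.exp_nonneg _), hYo]
  have hderiv2 : HasDerivAt (fun y => ∫ z, Real.exp (-(y * S z)) * Y z ∂markedLaw)
      (Real.exp (-∫ x, (β + f x) ^ α) * -∫ x, α * (β + f x) ^ (α - 1)) β := by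
    refine ((hasDerivAt_integral_add_rpow hα0 hα1 hf hC hβ).neg.exp).congr_of_eventuallyEq ?_
    filter_upwards [Ioi_mem_nhds hβ] with y hy using hval y (le_of_lt hy)
  have heq := hderiv.2.unique hderiv2
  rw [integral_neg, mul_neg, neg_inj] at heq
  have hint : Integrable (fun z => S z * Real.exp (-(β * S z)) * Y z) markedLaw := by
    simpa using hderiv.1.neg
  rw [mul_comm, ← heq, ofReal_integral_eq_lintegral_ofReal hint
    (ae_of_all _ fun z => mul_nonneg (mul_nonneg (hS0 z) (Real.exp_nonneg _)) (hY0 z))]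
  refine lintegral_congr fun z => ?_
  rw [ENNReal.ofReal_mul (mul_nonneg (hS0 z) (Real.exp_nonneg _)), hYo]

end

/-! ### The generalized gamma subordinator -/

/-- The Laplace exponent `(1 + y) ^ α - 1` of the generalized gamma subordinator. -/
def genGammaExponent (α y : ℝ) : ℝ := (1 + y) ^ α - 1

/-- The law of the spacings and locations reweighted by `exp (1 - S)`, with `S` the total mass:
under it the stable random measure is a generalized gamma random measure. -/
def genGammaLaw (α : ℝ) : Measure ((ℕ → ℝ) × (ℕ → unitInterval)) :=
  markedLaw.withDensity fun z => ENNReal.ofReal (Real.exp (1 - totalJump (stableDensity α) z.1))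

/-- The law of an i.i.d. sequence of such spacings and locations, one for each unit interval of
the half-line. -/
def subordinatorLaw (α : ℝ) : Measure (ℕ → (ℕ → ℝ) × (ℕ → unitInterval)) :=
  Measure.infinitePi fun _ => genGammaLaw α

/-- The generalized gamma random measure on the half-line: independent copies of the random measure
on `[0,1]`, translated to the intervals `[k, k + 1]`. -/
def halfLineCRM (α : ℝ) (w : ℕ → (ℕ → ℝ) × (ℕ → unitInterval)) : Measure ℝ :=
  Measure.sum fun k : ℕ => (stableCRM α (w k)).map fun x : unitInterval => (k : ℝ) + x

/-- The generalized gamma subordinator, the distribution function of the random measure. -/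
def genGammaProcess (α : ℝ) (t : ℝ≥0) (w : ℕ → (ℕ → ℝ) × (ℕ → unitInterval)) : ℝ :=
  (halfLineCRM α w (Ioc 0 (t : ℝ))).toReal

lemma measurable_natCast_add (k : ℕ) : Measurable fun x : unitInterval => (k : ℝ) + x := by
  fun_prop

lemma lintegral_halfLineCRM (α : ℝ) (w : ℕ → (ℕ → ℝ) × (ℕ → unitInterval)) {F : ℝ → ℝ≥0∞}
    (hF : Measurable F) :
    ∫⁻ x, F x ∂(halfLineCRM α w) = ∑' k : ℕ, ∫⁻ x, F (k + x) ∂(stableCRM α (w k)) := by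
  rw [halfLineCRM, lintegral_sum_measure]
  exact tsum_congr fun k => lintegral_map hF (measurable_natCast_add k)

section

variable {α : ℝ}

lemma genGammaExponent_zero : genGammaExponent α 0 = 0 := by simp [genGammaExponent]

lemma genGammaExponent_nonneg (hα0 : 0 < α) {y : ℝ} (hy : 0 ≤ y) : 0 ≤ genGammaExponent α y :=
  sub_nonneg.2 (Real.one_le_rpow (by linarith) hα0.le)

lemma genGammaExponent_le (hα0 : 0 < α) {x y : ℝ} (hx : 0 ≤ x) (hy : x ≤ y) :
    genGammaExponent α x ≤ genGammaExponent α y :=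
  sub_le_sub_right (Real.rpow_le_rpow (by linarith) (by linarith) hα0.le) 1

@[fun_prop]
lemma measurable_genGammaExponent : Measurable (genGammaExponent α) := by
  unfold genGammaExponent; fun_prop

/-- Laplace functional of the generalized gamma random measure on `[0,1]`. -/
lemma laplace_genGammaLaw (hα0 : 0 < α) (hα1 : α < 1) {f : unitInterval → ℝ≥0}
    (hf : Measurable f) {C : ℝ≥0} (hC : ∀ x, f x ≤ C) :
    ∫⁻ z, expNeg (∫⁻ x, f x ∂(stableCRM α z)) ∂(genGammaLaw α) =
      ENNReal.ofReal (Real.exp (-∫ x, genGammaExponent α (f x))) := by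
  have hS := measurable_totalJump hα0 hα1
  rw [genGammaLaw, lintegral_withDensity_eq_lintegral_mul _ (by fun_prop)
    (measurable_expNeg_lintegral hf (measurable_stableCRM hα0 hα1))]
  have h1 : ∀ z : (ℕ → ℝ) × (ℕ → unitInterval),
      ENNReal.ofReal (Real.exp (1 - totalJump (stableDensity α) z.1)) *
        expNeg (∫⁻ x, f x ∂(stableCRM α z)) = ENNReal.ofReal (Real.exp 1) *
      (ENNReal.ofReal (Real.exp (-(1 * totalJump (stableDensity α) z.1))) *
        expNeg (∫⁻ x, f x ∂(stableCRM α z))) := by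
    intro z
    rw [← mul_assoc, ← ENNReal.ofReal_mul (Real.exp_nonneg _), ← Real.exp_add]
    ring_nf
  simp only [Pi.mul_apply, h1]
  rw [lintegral_const_mul' _ _ ENNReal.ofReal_ne_top,
    laplace_stableCRM_exp_tilt hα0 hα1 hf hC zero_le_one,
    ← ENNReal.ofReal_mul (Real.exp_nonneg _), ← Real.exp_add]
  have hi := integrable_rpow_of_bound (f := fun x => 1 + f x) hα0.le (by fun_prop)
    (C := 1 + C) (fun x => by gcongr; exact hC x)
  simp only [NNReal.coe_add, NNReal.coe_one] at hi
  simp only [genGammaExponent]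
  rw [integral_sub hi (integrable_const 1)]
  simp only [integral_const, probReal_univ, smul_eq_mul, mul_one, neg_sub, ← sub_eq_add_neg]

lemma isProbabilityMeasure_genGammaLaw (hα0 : 0 < α) (hα1 : α < 1) :
    IsProbabilityMeasure (genGammaLaw α) := by
  have h := laplace_genGammaLaw hα0 hα1 (f := fun _ => 0) measurable_const (C := 0) (by simp)
  constructor
  simpa [genGammaExponent_zero] using h

lemma isProbabilityMeasure_subordinatorLaw (hα0 : 0 < α) (hα1 : α < 1) :
    IsProbabilityMeasure (subordinatorLaw α) := by
  have := isProbabilityMeasure_genGammaLaw hα0 hα1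
  unfold subordinatorLaw
  infer_instance

/-- Integrals against the random measure on the half-line depend measurably on a parameter and on
the underlying point. -/
lemma measurable_lintegral_halfLineCRM (hα0 : 0 < α) (hα1 : α < 1) {E : Type*}
    [MeasurableSpace E] {F : E × ℝ → ℝ≥0∞} (hF : Measurable F) :
    Measurable fun p : E × (ℕ → (ℕ → ℝ) × (ℕ → unitInterval)) =>
      ∫⁻ x, F (p.1, x) ∂(halfLineCRM α p.2) := by
  have h1 (p : E × (ℕ → (ℕ → ℝ) × (ℕ → unitInterval))) :
      ∫⁻ x, F (p.1, x) ∂(halfLineCRM α p.2) = ∑' k : ℕ, ∑' n : ℕ,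
        ENNReal.ofReal (rankedJump (stableDensity α) (p.2 k).1 n) *
          F (p.1, (k : ℝ) + (p.2 k).2 n) := by
    rw [lintegral_halfLineCRM _ _ (by fun_prop)]
    refine tsum_congr fun k => ?_
    rw [stableCRM, lintegral_atomicMeasure _ (by fun_prop)]
  simp_rw [h1]
  refine Measurable.tsum fun k => Measurable.tsum fun n => Measurable.mul ?_ (hF.comp ?_)
  · exact ((measurable_pi_apply n).comp ((measurable_rankedJump hα0 hα1).comp
      (measurable_fst.comp ((measurable_pi_apply k).comp measurable_snd)))).ennreal_ofReal
  · exact measurable_fst.prodMk (measurable_const.add (measurable_subtype_coe.comp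
      ((measurable_pi_apply n).comp
        (measurable_snd.comp ((measurable_pi_apply k).comp measurable_snd)))))

lemma measurable_halfLineCRM (hα0 : 0 < α) (hα1 : α < 1) : Measurable (halfLineCRM α) := by
  refine Measure.measurable_of_measurable_coe _ fun B hB => ?_
  have hF : Measurable fun p : Unit × ℝ => B.indicator (1 : ℝ → ℝ≥0∞) p.2 :=
    (measurable_one.indicator hB).comp measurable_snd
  have h1 := measurable_lintegral_halfLineCRM hα0 hα1 hF
  have h2 := h1.comp (measurable_prodMk_left (x := ()))
  have h3 : (fun w => halfLineCRM α w B) =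
      fun w => ∫⁻ x, B.indicator (1 : ℝ → ℝ≥0∞) x ∂(halfLineCRM α w) := by
    ext w
    rw [lintegral_indicator_one hB]
  rw [h3]
  exact h2

lemma ae_halfLineCRM_lt_top (hα0 : 0 < α) (hα1 : α < 1) :
    ∀ᵐ w ∂(subordinatorLaw α), ∀ t : ℝ, halfLineCRM α w (Ioc 0 t) < ∞ := by
  have := isProbabilityMeasure_genGammaLaw hα0 hα1
  have h1 : ∀ᵐ z ∂(genGammaLaw α), stableCRM α z univ < ∞ := by
    refine (withDensity_absolutelyContinuous _ _).ae_le ?_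
    filter_upwards [ae_stableCRM hα0 hα1] with z hz
    rw [hz.1]
    exact ENNReal.ofReal_lt_top
  have h2 : ∀ᵐ w ∂(subordinatorLaw α), ∀ k, stableCRM α (w k) univ < ∞ :=
    ae_all_iff.2 fun k => (measurePreserving_eval_infinitePi
      (fun _ : ℕ => genGammaLaw α) k).quasiMeasurePreserving.ae h1
  filter_upwards [h2] with w hw t
  obtain ⟨K, hK⟩ := exists_nat_ge t
  rw [halfLineCRM, Measure.sum_apply _ measurableSet_Ioc]
  rw [tsum_eq_sum (s := Finset.range (K + 1))]
  · refine ENNReal.sum_lt_top.2 fun k _ => ?_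
    rw [Measure.map_apply (measurable_natCast_add k) measurableSet_Ioc]
    exact (measure_mono (subset_univ _)).trans_lt (hw k)
  · intro k hk
    have hk' : K + 1 ≤ k := by simpa using hk
    rw [Measure.map_apply (measurable_natCast_add k) measurableSet_Ioc]
    have : (fun x : unitInterval => (k : ℝ) + x) ⁻¹' Ioc 0 t = ∅ := by
      refine eq_empty_of_forall_notMem fun x hx => ?_
      have h1 : (k : ℝ) + x ≤ t := hx.2
      have h2 : (K + 1 : ℝ) ≤ k := by exact_mod_cast hk'
      linarith [x.2.1]
    rw [this, measure_empty]

lemma integral_unitInterval (g : ℝ → ℝ) :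
    ∫ x : unitInterval, g x = ∫ x in (0 : ℝ)..1, g x := by
  rw [intervalIntegral.integral_of_le zero_le_one, ← integral_Icc_eq_integral_Ioc]
  exact integral_subtype_comap measurableSet_Icc g

lemma integrableOn_genGammaExponent (hα0 : 0 < α) {F : ℝ → ℝ≥0} (hF : Measurable F) {C : ℝ≥0}
    (hC : ∀ x, F x ≤ C) {s : Set ℝ} (hs : volume s ≠ ∞) :
    IntegrableOn (fun x => genGammaExponent α (F x)) s := by
  refine Measure.integrableOn_of_bounded (M := genGammaExponent α C) hs
    (by fun_prop : Measurable _).aestronglyMeasurable (ae_of_all _ fun x => ?_)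
  rw [Real.norm_of_nonneg (genGammaExponent_nonneg hα0 (F x).coe_nonneg)]
  exact genGammaExponent_le hα0 (F x).coe_nonneg (NNReal.coe_le_coe.2 (hC x))

/-- Laplace functional of the generalized gamma random measure on the half-line. -/
theorem laplace_halfLineCRM (hα0 : 0 < α) (hα1 : α < 1) {F : ℝ → ℝ≥0} (hF : Measurable F)
    {C : ℝ≥0} (hC : ∀ x, F x ≤ C) {K : ℕ} (hK : ∀ x, (K : ℝ) ≤ x → F x = 0) :
    ∫⁻ w, expNeg (∫⁻ x, F x ∂(halfLineCRM α w)) ∂(subordinatorLaw α) =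
      ENNReal.ofReal (Real.exp (-∫ x in Ioi 0, genGammaExponent α (F x))) := by
  have := isProbabilityMeasure_genGammaLaw hα0 hα1
  have h1 (w : ℕ → (ℕ → ℝ) × (ℕ → unitInterval)) : expNeg (∫⁻ x, F x ∂(halfLineCRM α w)) =
      ∏ k ∈ Finset.range K, expNeg (∫⁻ x, F (k + x) ∂(stableCRM α (w k))) := by
    rw [lintegral_halfLineCRM _ _ hF.coe_nnreal_ennreal, tsum_eq_sum (s := Finset.range K),
      expNeg_sum]
    intro k hk
    have hk' : (K : ℝ) ≤ k := by exact_mod_cast (by simpa using hk : K ≤ k)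
    have h2 (x : unitInterval) : F (k + x) = 0 := hK _ (by linarith [x.2.1])
    simp [h2]
  have hm (k : ℕ) : Measurable fun z => expNeg (∫⁻ x, F (k + x) ∂(stableCRM α z)) :=
    measurable_expNeg_lintegral (f := fun x : unitInterval => F (k + x)) (by fun_prop)
      (measurable_stableCRM hα0 hα1)
  have hind : iIndepFun (fun (k : ℕ) (w : ℕ → (ℕ → ℝ) × (ℕ → unitInterval)) =>
      expNeg (∫⁻ x, F (k + x) ∂(stableCRM α (w k)))) (subordinatorLaw α) :=
    iIndepFun_infinitePi (X := fun (k : ℕ) z => expNeg (∫⁻ x, F (k + x) ∂(stableCRM α z))) hm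
  have hblock (k : ℕ) : ∫⁻ w : ℕ → (ℕ → ℝ) × (ℕ → unitInterval),
      expNeg (∫⁻ x, F (k + x) ∂(stableCRM α (w k))) ∂(subordinatorLaw α) =
      ENNReal.ofReal (Real.exp (-∫ x in (k : ℝ)..(k + 1 : ℕ), genGammaExponent α (F x))) := by
    have h2 := (measurePreserving_eval_infinitePi
      (fun _ : ℕ => genGammaLaw α) k).lintegral_comp (hm k)
    rw [laplace_genGammaLaw hα0 hα1 (f := fun x : unitInterval => F (k + x)) (by fun_prop)
      (fun x => hC _), integral_unitInterval fun x => genGammaExponent α (F (k + x)),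
      intervalIntegral.integral_comp_add_left (fun x => genGammaExponent α (F x))] at h2
    simpa [subordinatorLaw] using h2
  simp_rw [h1]
  rw [lintegral_prod_eq_prod_lintegral_of_indepFun _ _ hind fun k =>
    (hm k).comp (measurable_pi_apply k), Finset.prod_congr rfl fun k _ => hblock k,
    ← ENNReal.ofReal_prod_of_nonneg fun k _ => Real.exp_nonneg _, ← Real.exp_sum,
    Finset.sum_neg_distrib, intervalIntegral.sum_integral_adjacent_intervals]
  · congr 3
    rw [Nat.cast_zero, intervalIntegral.integral_of_le (Nat.cast_nonneg K)]
    refine (setIntegral_eq_of_subset_of_forall_sdiff_eq_zero measurableSet_Ioi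
      Ioc_subset_Ioi_self fun x hx => ?_).symm
    have hx2 : (K : ℝ) < x := by
      by_contra h
      exact hx.2 ⟨hx.1, not_lt.1 h⟩
    rw [hK x hx2.le, NNReal.coe_zero, genGammaExponent_zero]
  · intro k _
    exact (intervalIntegrable_iff_integrableOn_Ioc_of_le (by simp)).2
      (integrableOn_genGammaExponent hα0 hF hC (by simp))

lemma halfLineCRM_Ioc_sub {w : ℕ → (ℕ → ℝ) × (ℕ → unitInterval)}
    (hw : ∀ t : ℝ, halfLineCRM α w (Ioc 0 t) < ∞) {s t : ℝ≥0} (hst : s ≤ t) :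
    genGammaProcess α t w - genGammaProcess α s w =
      (halfLineCRM α w (Ioc (s : ℝ) t)).toReal := by
  have h : halfLineCRM α w (Ioc 0 (t : ℝ)) =
      halfLineCRM α w (Ioc 0 (s : ℝ)) + halfLineCRM α w (Ioc (s : ℝ) t) := by
    rw [← Ioc_union_Ioc_eq_Ioc s.coe_nonneg (NNReal.coe_le_coe.2 hst),
      measure_union (Ioc_disjoint_Ioc_of_le le_rfl) measurableSet_Ioc]
  have hle : halfLineCRM α w (Ioc (s : ℝ) t) < ∞ :=
    (measure_mono (Ioc_subset_Ioc_left s.coe_nonneg)).trans_lt (hw t)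
  rw [genGammaProcess, genGammaProcess, h, ENNReal.toReal_add (hw s).ne hle.ne]
  ring

/-- Joint Laplace transform of the masses of disjoint intervals. -/
lemma laplace_increments (hα0 : 0 < α) (hα1 : α < 1) {n : ℕ} {t : Fin (n + 1) → ℝ≥0}
    (ht : Monotone t) (c : Fin n → ℝ≥0) :
    ∫⁻ w, expNeg (∑ i, c i * halfLineCRM α w (Ioc (t i.castSucc : ℝ) (t i.succ)))
      ∂(subordinatorLaw α) =
    ∏ i, ENNReal.ofReal (Real.exp (-(((t i.succ : ℝ) - t i.castSucc) *
      genGammaExponent α (c i)))) := by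
  classical
  let A (i : Fin n) : Set ℝ := Ioc (t i.castSucc : ℝ) (t i.succ)
  have hdisj {i j : Fin n} (hij : i ≠ j) {x : ℝ} (hi : x ∈ A i) : x ∉ A j := by
    intro hj
    rcases lt_or_gt_of_ne hij with h | h
    · have h1 : t i.succ ≤ t j.castSucc := ht (Fin.le_castSucc_iff.2 (by simpa using h))
      have := NNReal.coe_le_coe.2 h1
      linarith [hi.2, hj.1]
    · have h1 : t j.succ ≤ t i.castSucc := ht (Fin.le_castSucc_iff.2 (by simpa using h))
      have := NNReal.coe_le_coe.2 h1
      linarith [hj.2, hi.1]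
  let F : ℝ → ℝ≥0 := fun x => ∑ i, (A i).indicator (fun _ => c i) x
  have hF : Measurable F :=
    Finset.measurable_sum _ fun i _ => measurable_const.indicator measurableSet_Ioc
  have hFC (x) : F x ≤ ∑ i, c i := Finset.sum_le_sum fun i _ => indicator_le_self _ _ _
  obtain ⟨K, hK⟩ := exists_nat_gt (t (Fin.last n) : ℝ)
  have hFK (x : ℝ) (hx : (K : ℝ) ≤ x) : F x = 0 := by
    refine Finset.sum_eq_zero fun i _ => indicator_of_notMem (fun hi => ?_) _
    have := NNReal.coe_le_coe.2 (ht (Fin.le_last i.succ))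
    linarith [hi.2]
  have hψ (x : ℝ) : genGammaExponent α (F x) =
      ∑ i, (A i).indicator (fun _ => genGammaExponent α (c i)) x := by
    by_cases hx : ∃ i, x ∈ A i
    · obtain ⟨i, hi⟩ := hx
      have h1 : F x = c i := by
        simp only [F]
        rw [Finset.sum_eq_single i (fun j _ hj => indicator_of_notMem (hdisj hj.symm hi) _)
          (by simp), indicator_of_mem hi]
      rw [h1, Finset.sum_eq_single i (fun j _ hj => indicator_of_notMem (hdisj hj.symm hi) _)
          (by simp), indicator_of_mem hi]
    · push Not at hx
      have h1 : F x = 0 := Finset.sum_eq_zero fun i _ => indicator_of_notMem (hx i) _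
      rw [h1, NNReal.coe_zero, genGammaExponent_zero,
        Finset.sum_eq_zero fun i _ => indicator_of_notMem (hx i) _]
  have h := laplace_halfLineCRM hα0 hα1 hF hFC hFK
  have hA (i : Fin n) : A i ⊆ Ioi 0 := fun x hx => (t i.castSucc).coe_nonneg.trans_lt hx.1
  have hAvol (i : Fin n) : volume (A i) ≠ ∞ := by simp [A]
  have hI : ∫ x in Ioi 0, genGammaExponent α (F x) =
      ∑ i, ((t i.succ : ℝ) - t i.castSucc) * genGammaExponent α (c i) := by
    simp_rw [hψ]
    rw [integral_finsetSum _ fun i _ =>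
      ((integrable_indicator_iff measurableSet_Ioc).2
        (integrableOn_const (hAvol i))).mono_measure Measure.restrict_le_self]
    refine Finset.sum_congr rfl fun i _ => ?_
    rw [setIntegral_indicator measurableSet_Ioc, inter_eq_right.2 (hA i), setIntegral_const]
    have h1 : t i.castSucc ≤ t i.succ := ht (Fin.castSucc_lt_succ).le
    rw [Real.volume_real_Ioc_of_le (NNReal.coe_le_coe.2 h1), smul_eq_mul]
  rw [hI, ← Finset.sum_neg_distrib, Real.exp_sum,
    ENNReal.ofReal_prod_of_nonneg fun i _ => Real.exp_nonneg _] at h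
  rw [← h]
  refine lintegral_congr fun w => ?_
  congr 1
  simp only [F, ENNReal.ofNNReal_finsetSum]
  rw [lintegral_finsetSum _ fun i _ => (measurable_const.indicator
    measurableSet_Ioc).coe_nnreal_ennreal]
  refine Finset.sum_congr rfl fun i _ => ?_
  rw [← lintegral_indicator_const measurableSet_Ioc]
  refine lintegral_congr fun x => ?_
  by_cases hx : x ∈ A i <;> simp [A, hx]

/-- Laplace transform of the mass of an interval. -/
lemma laplace_increment (hα0 : 0 < α) (hα1 : α < 1) {s t : ℝ≥0} (hst : s ≤ t) (c : ℝ≥0) :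
    ∫⁻ w, expNeg (c * halfLineCRM α w (Ioc (s : ℝ) t)) ∂(subordinatorLaw α) =
      ENNReal.ofReal (Real.exp (-(((t : ℝ) - s) * genGammaExponent α c))) := by
  have h := laplace_increments hα0 hα1 (n := 1) (t := ![s, t])
    (by intro i j hij; fin_cases i <;> fin_cases j <;> simp_all) (fun _ => c)
  simpa using h

lemma measurable_halfLineCRM_apply (hα0 : 0 < α) (hα1 : α < 1) {B : Set ℝ}
    (hB : MeasurableSet B) : Measurable fun w => halfLineCRM α w B :=
  (Measure.measurable_coe hB).comp (measurable_halfLineCRM hα0 hα1)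

lemma measurable_genGammaProcess (hα0 : 0 < α) (hα1 : α < 1) (t : ℝ≥0) :
    Measurable (genGammaProcess α t) :=
  (measurable_halfLineCRM_apply hα0 hα1 measurableSet_Ioc).ennreal_toReal

/-- The distribution function of the random measure is a generalized gamma subordinator. -/
theorem isSubordinator_genGammaProcess (hα0 : 0 < α) (hα1 : α < 1) :
    IsSubordinator (subordinatorLaw α) (genGammaDensity α) (genGammaProcess α) where
  measurable := measurable_genGammaProcess hα0 hα1
  zero := ae_of_all _ fun w => by simp [genGammaProcess]
  mono := by
    filter_upwards [ae_halfLineCRM_lt_top hα0 hα1] with w hw s t hst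
    exact ENNReal.toReal_mono (hw t).ne
      (measure_mono (Ioc_subset_Ioc_right (NNReal.coe_le_coe.2 hst)))
  rightCont := by
    filter_upwards [ae_halfLineCRM_lt_top hα0 hα1] with w hw t
    rw [← continuousWithinAt_Ioi_iff_Ici]
    refine (ENNReal.tendsto_toReal (hw t).ne).comp ?_
    have h := tendsto_measure_biInter_gt (μ := halfLineCRM α w) (a := t)
      (s := fun r : ℝ≥0 => Ioc 0 (r : ℝ)) (fun r _ => measurableSet_Ioc.nullMeasurableSet)
      (fun i j _ hij => Ioc_subset_Ioc_right (NNReal.coe_le_coe.2 hij))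
      ⟨t + 1, by simp, (hw _).ne⟩
    have hInter : ⋂ r > t, Ioc 0 (r : ℝ) = Ioc 0 (t : ℝ) := by
      ext x
      simp only [mem_iInter, mem_Ioc]
      constructor
      · intro hx
        refine ⟨(hx (t + 1) (by simp)).1, le_of_forall_gt_imp_ge_of_dense fun r hr => ?_⟩
        have hr0 : 0 ≤ r := t.coe_nonneg.trans hr.le
        exact (hx ⟨r, hr0⟩ hr).2
      · intro hx r hr
        exact ⟨hx.1, hx.2.trans (NNReal.coe_le_coe.2 (le_of_lt hr))⟩
    rw [hInter] at h
    exact h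
  indep := by
    intro n t ht
    have := isProbabilityMeasure_subordinatorLaw hα0 hα1
    let X (i : Fin n) (w : ℕ → (ℕ → ℝ) × (ℕ → unitInterval)) : ℝ≥0 :=
      (halfLineCRM α w (Ioc (t i.castSucc : ℝ) (t i.succ))).toNNReal
    have hfin : ∀ᵐ w ∂(subordinatorLaw α), ∀ i,
        (X i w : ℝ≥0∞) = halfLineCRM α w (Ioc (t i.castSucc : ℝ) (t i.succ)) := by
      filter_upwards [ae_halfLineCRM_lt_top hα0 hα1] with w hw i
      exact ENNReal.coe_toNNReal ((measure_mono
        (Ioc_subset_Ioc_left (t i.castSucc).coe_nonneg)).trans_lt (hw _)).ne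
    have hX : iIndepFun X (subordinatorLaw α) := by
      refine iIndepFun_of_laplace (fun i => (measurable_halfLineCRM_apply hα0 hα1
        measurableSet_Ioc).ennreal_toNNReal.aemeasurable) fun c => ?_
      have h1 : ∫⁻ w, expNeg (∑ i, c i * X i w) ∂(subordinatorLaw α) =
          ∫⁻ w, expNeg (∑ i, c i * halfLineCRM α w (Ioc (t i.castSucc : ℝ) (t i.succ)))
            ∂(subordinatorLaw α) := by
        refine lintegral_congr_ae ?_
        filter_upwards [hfin] with w hw
        simp only [hw]
      rw [h1, laplace_increments hα0 hα1 ht]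
      refine Finset.prod_congr rfl fun i _ => ?_
      rw [← laplace_increment hα0 hα1 (ht (Fin.castSucc_lt_succ).le)]
      refine lintegral_congr_ae ?_
      filter_upwards [hfin] with w hw
      simp only [hw]
    refine (hX.comp (fun _ x => (x : ℝ)) fun _ => by fun_prop).congr fun i => ?_
    filter_upwards [ae_halfLineCRM_lt_top hα0 hα1] with w hw
    rw [halfLineCRM_Ioc_sub hw (ht (Fin.castSucc_lt_succ).le)]
    rfl
  laplace := by
    intro s t hst q hq
    have hm := measurable_genGammaProcess (α := α) hα0 hα1
    have := hm s
    have := hm t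
    rw [integral_eq_lintegral_of_nonneg_ae (ae_of_all _ fun w => Real.exp_nonneg _)
      (by fun_prop : Measurable _).aestronglyMeasurable,
      ← ENNReal.toReal_ofReal (Real.exp_nonneg (-((t : ℝ) - s) * _)),
      integral_one_sub_exp_genGammaDensity hα0 hα1 hq]
    congr 1
    have h := laplace_increment hα0 hα1 hst q.toNNReal
    rw [Real.coe_toNNReal _ hq, ← neg_mul] at h
    rw [genGammaExponent] at h
    rw [← h]
    refine lintegral_congr_ae ?_
    filter_upwards [ae_halfLineCRM_lt_top hα0 hα1] with w hw
    have hle : halfLineCRM α w (Ioc (s : ℝ) t) < ∞ :=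
      (measure_mono (Ioc_subset_Ioc_left s.coe_nonneg)).trans_lt (hw t)
    rw [halfLineCRM_Ioc_sub hw hst, ← ENNReal.ofReal, ← ENNReal.ofReal_toReal hle.ne,
      ← ENNReal.ofReal_mul hq, expNeg_ofReal (by positivity), neg_mul,
      ENNReal.toReal_ofReal ENNReal.toReal_nonneg]

end

/-! ### The two bridge constructions -/

/-- The generalized inverse, with values in `[0,1]`, of the time change
`y ↦ y * h + g * 1{u ≤ y}`. -/
def inverseTime (h g : ℝ) (u : unitInterval) (x : ℝ) : unitInterval :=
  projIcc 0 1 zero_le_one (max (min (x / h) u) ((x - g) / h))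

/-- The random measure on `[0,1]` with distribution function `y ↦ τ(y * h + g * 1{u ≤ y}) / β`,
where `τ` is the subordinator built from `w`. -/
def bridgeMeasure (α β h g : ℝ) (u : unitInterval) (w : ℕ → (ℕ → ℝ) × (ℕ → unitInterval)) :
    Measure unitInterval :=
  ENNReal.ofReal β⁻¹ • ((halfLineCRM α w).restrict (Ioc 0 (h + g))).map (inverseTime h g u)

lemma inverseTime_le_iff {h g x : ℝ} {u y : unitInterval} (hh : 0 < h) (hg : 0 ≤ g)
    (hx : x ∈ Ioc 0 (h + g)) :
    inverseTime h g u x ≤ y ↔ x ≤ y * h + g * (Ici u).indicator 1 y := by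
  have hv0 : 0 ≤ max (min (x / h) u) ((x - g) / h) :=
    le_max_of_le_left (le_min (div_nonneg hx.1.le hh.le) u.2.1)
  have hv1 : max (min (x / h) u) ((x - g) / h) ≤ 1 := by
    refine max_le ((min_le_right _ _).trans u.2.2) ?_
    rw [div_le_one hh]
    linarith [hx.2]
  rw [inverseTime, projIcc_of_mem zero_le_one ⟨hv0, hv1⟩, ← Subtype.coe_le_coe]
  simp only [max_le_iff, min_le_iff, div_le_iff₀ hh, Subtype.coe_le_coe]
  by_cases huy : u ≤ y
  · rw [indicator_of_mem (mem_Ici.2 huy)]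
    simp only [huy, or_true, true_and, Pi.one_apply, mul_one]
    constructor <;> intro h <;> linarith
  · rw [indicator_of_notMem (mt mem_Ici.1 huy)]
    simp only [huy, or_false, mul_zero, add_zero]
    constructor
    · exact fun h => h.1
    · exact fun h1 => ⟨h1, by linarith⟩

@[fun_prop]
lemma measurable_inverseTime (h g : ℝ) (u : unitInterval) : Measurable (inverseTime h g u) := by
  have : Measurable (projIcc (0 : ℝ) 1 zero_le_one) := continuous_projIcc.measurable
  unfold inverseTime
  fun_prop

lemma lintegral_bridgeMeasure (α β h g : ℝ) (u : unitInterval)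
    (w : ℕ → (ℕ → ℝ) × (ℕ → unitInterval)) {f : unitInterval → ℝ≥0∞} (hf : Measurable f) :
    ∫⁻ y, f y ∂(bridgeMeasure α β h g u w) = ∫⁻ x, (Ioc 0 (h + g)).indicator
      (fun x => ENNReal.ofReal β⁻¹ * f (inverseTime h g u x)) x ∂(halfLineCRM α w) := by
  rw [bridgeMeasure, lintegral_smul_measure, lintegral_map hf (by fun_prop),
    lintegral_indicator measurableSet_Ioc, lintegral_const_mul _ (by fun_prop), smul_eq_mul]

section

variable {α : ℝ}

/-- The bridge measure depends measurably on all its parameters. -/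
lemma measurable_bridgeMeasure (hα0 : 0 < α) (hα1 : α < 1) {E : Type*} [MeasurableSpace E]
    {β h g : E → ℝ} {u : E → unitInterval} (hβ : Measurable β) (hh : Measurable h)
    (hg : Measurable g) (hu : Measurable u) :
    Measurable fun p : E × (ℕ → (ℕ → ℝ) × (ℕ → unitInterval)) =>
      bridgeMeasure α (β p.1) (h p.1) (g p.1) (u p.1) p.2 := by
  refine Measure.measurable_of_measurable_coe _ fun B hB => ?_
  have hpi : Measurable (projIcc (0 : ℝ) 1 zero_le_one) := continuous_projIcc.measurable
  have h1 : Measurable fun q : E × ℝ => inverseTime (h q.1) (g q.1) (u q.1) q.2 := by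
    unfold inverseTime
    fun_prop
  have h2 : Measurable fun q : E × ℝ => (Ioc 0 (h q.1 + g q.1)).indicator
      (fun x => ENNReal.ofReal (β q.1)⁻¹ *
        B.indicator 1 (inverseTime (h q.1) (g q.1) (u q.1) x)) q.2 := by
    have h3 : (fun q : E × ℝ => (Ioc 0 (h q.1 + g q.1)).indicator
        (fun x => ENNReal.ofReal (β q.1)⁻¹ *
          B.indicator 1 (inverseTime (h q.1) (g q.1) (u q.1) x)) q.2) =
        ({q : E × ℝ | 0 < q.2} ∩ {q | q.2 ≤ h q.1 + g q.1}).indicator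
          fun q => ENNReal.ofReal (β q.1)⁻¹ *
            B.indicator 1 (inverseTime (h q.1) (g q.1) (u q.1) q.2) := by
      ext q
      simp only [indicator, mem_Ioc, mem_inter_iff, mem_ofPred_eq]
    rw [h3]
    have h4 : Measurable fun q : E × ℝ =>
        B.indicator (1 : unitInterval → ℝ≥0∞) (inverseTime (h q.1) (g q.1) (u q.1) q.2) :=
      (measurable_one.indicator hB).comp h1
    exact Measurable.indicator (by fun_prop) ((measurableSet_lt (by fun_prop) (by fun_prop)).inter
      (measurableSet_le (by fun_prop) (by fun_prop)))
  have h5 : (fun p : E × (ℕ → (ℕ → ℝ) × (ℕ → unitInterval)) =>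
      bridgeMeasure α (β p.1) (h p.1) (g p.1) (u p.1) p.2 B) = fun p =>
      ∫⁻ x, (Ioc 0 (h p.1 + g p.1)).indicator (fun x => ENNReal.ofReal (β p.1)⁻¹ *
        B.indicator 1 (inverseTime (h p.1) (g p.1) (u p.1) x)) x ∂(halfLineCRM α p.2) := by
    ext p
    rw [← lintegral_indicator_one hB, lintegral_bridgeMeasure _ _ _ _ _ _
      (measurable_one.indicator hB)]
  rw [h5]
  exact measurable_lintegral_halfLineCRM hα0 hα1 h2

/-- The distribution function of the bridge measure. -/
lemma bridgeMeasure_Iic {w : ℕ → (ℕ → ℝ) × (ℕ → unitInterval)}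
    (hw : ∀ t : ℝ, halfLineCRM α w (Ioc 0 t) < ∞) {β h g : ℝ} (hβ : 0 < β) (hh : 0 < h)
    (hg : 0 ≤ g) (u y : unitInterval) :
    bridgeMeasure α β h g u w (Iic y) = ENNReal.ofReal
      (genGammaProcess α (Real.toNNReal (y * h + g * (Ici u).indicator 1 y)) w / β) := by
  have h0 : 0 ≤ (y : ℝ) * h + g * (Ici u).indicator 1 y := by
    have : (0 : ℝ) ≤ (Ici u).indicator 1 y := indicator_nonneg (fun _ _ => zero_le_one) _
    have := y.2.1
    positivity
  have h1 : (y : ℝ) * h + g * (Ici u).indicator 1 y ≤ h + g := by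
    have h2 : (Ici u).indicator (1 : unitInterval → ℝ) y ≤ 1 :=
      indicator_le_self' (fun _ _ => zero_le_one) _
    nlinarith [y.2.2]
  have hset : inverseTime h g u ⁻¹' Iic y ∩ Ioc 0 (h + g) =
      Ioc 0 (y * h + g * (Ici u).indicator 1 y) := by
    ext x
    simp only [mem_inter_iff, mem_preimage, mem_Iic, mem_Ioc]
    constructor
    · rintro ⟨h3, h4⟩
      exact ⟨h4.1, (inverseTime_le_iff hh hg h4).1 h3⟩
    · rintro ⟨h3, h4⟩
      have h5 : x ∈ Ioc 0 (h + g) := ⟨h3, h4.trans h1⟩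
      exact ⟨(inverseTime_le_iff hh hg h5).2 h4, h5⟩
  rw [bridgeMeasure, Measure.smul_apply, Measure.map_apply (by fun_prop) measurableSet_Iic,
    Measure.restrict_apply (measurable_inverseTime h g u measurableSet_Iic), hset,
    genGammaProcess, Real.coe_toNNReal _ h0, div_eq_inv_mul,
    ENNReal.ofReal_mul (by positivity), ENNReal.ofReal_toReal (hw _).ne, smul_eq_mul]

lemma bridgeMeasure_univ_lt_top {w : ℕ → (ℕ → ℝ) × (ℕ → unitInterval)}
    (hw : ∀ t : ℝ, halfLineCRM α w (Ioc 0 t) < ∞) {β h g : ℝ} (u : unitInterval) :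
    bridgeMeasure α β h g u w univ < ∞ := by
  rw [bridgeMeasure, Measure.smul_apply, Measure.map_apply (by fun_prop) .univ, preimage_univ,
    Measure.restrict_apply_univ]
  exact ENNReal.mul_lt_top ENNReal.ofReal_lt_top (hw _)

/-- The inverse time change pushes Lebesgue measure to `h` times Lebesgue measure plus an atom of
mass `g` at `u`. -/
lemma integral_comp_inverseTime {h g : ℝ} (hh : 0 < h) (hg : 0 ≤ g) (u : unitInterval)
    {k : unitInterval → ℝ} (hk : Measurable k) {C : ℝ} (hC : ∀ x, |k x| ≤ C) :
    ∫ x in (0 : ℝ)..(h + g), k (inverseTime h g u x) = h * (∫ x, k x) + g * k u := by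
  have hpi : Measurable (projIcc (0 : ℝ) 1 zero_le_one) := continuous_projIcc.measurable
  let p : ℝ → ℝ := fun x => k (projIcc (0 : ℝ) 1 zero_le_one x)
  have hint {q : ℝ → ℝ} (hq : Measurable q) (hqC : ∀ x, |q x| ≤ C) (a b : ℝ) :
      IntervalIntegrable q volume a b :=
    (intervalIntegrable_const (c := C)).mono_fun' hq.aestronglyMeasurable
      (ae_of_all _ fun x => hqC x)
  have hi1 (a b : ℝ) : IntervalIntegrable (fun x => k (inverseTime h g u x)) volume a b :=
    hint (by fun_prop) (fun x => hC _) a b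
  have hip (a b : ℝ) : IntervalIntegrable p volume a b :=
    hint (by fun_prop) (fun x => hC _) a b
  have hu0 : (0 : ℝ) ≤ u := u.2.1
  have hu1 : (u : ℝ) ≤ 1 := u.2.2
  have hhu : h * u ≤ h := by nlinarith
  have hhu0 : 0 ≤ h * u := by positivity
  have e1 : ∫ x in (0 : ℝ)..(h * u), k (inverseTime h g u x) = h * ∫ x in (0 : ℝ)..u, p x := by
    have : ∫ x in (0 : ℝ)..(h * u), k (inverseTime h g u x) =
        ∫ x in (0 : ℝ)..(h * u), p (x / h) := by
      refine intervalIntegral.integral_congr fun x hx => ?_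
      rw [uIcc_of_le hhu0] at hx
      have h1 : x / h ≤ u := by rw [div_le_iff₀ hh]; linarith [hx.2]
      have h2 : (x - g) / h ≤ x / h := by gcongr; linarith
      simp only [inverseTime, p]
      rw [min_eq_left h1, max_eq_left h2]
    rw [this, intervalIntegral.integral_comp_div _ hh.ne', zero_div, mul_div_cancel_left₀ _ hh.ne',
      smul_eq_mul]
  have e2 : ∫ x in (h * u)..(h * u + g), k (inverseTime h g u x) = g * k u := by
    have : ∫ x in (h * u)..(h * u + g), k (inverseTime h g u x) =
        ∫ x in (h * u)..(h * u + g), k u := by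
      refine intervalIntegral.integral_congr fun x hx => ?_
      rw [uIcc_of_le (by linarith)] at hx
      have h1 : (u : ℝ) ≤ x / h := by rw [le_div_iff₀ hh]; linarith [hx.1]
      have h2 : (x - g) / h ≤ u := by rw [div_le_iff₀ hh]; linarith [hx.2]
      simp only [inverseTime]
      rw [min_eq_right h1, max_eq_left h2, projIcc_val]
    rw [this, intervalIntegral.integral_const, smul_eq_mul]
    ring
  have e3 : ∫ x in (h * u + g)..(h + g), k (inverseTime h g u x) = h * ∫ x in (u : ℝ)..1, p x := by
    have : ∫ x in (h * u + g)..(h + g), k (inverseTime h g u x) =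
        ∫ x in (h * u + g)..(h + g), p ((x - g) / h) := by
      refine intervalIntegral.integral_congr fun x hx => ?_
      rw [uIcc_of_le (by linarith)] at hx
      have h2 : (u : ℝ) ≤ (x - g) / h := by rw [le_div_iff₀ hh]; linarith [hx.1]
      simp only [inverseTime, p]
      rw [max_eq_right ((min_le_right _ _).trans h2)]
    rw [this, intervalIntegral.integral_comp_sub_right (fun x => p (x / h)),
      intervalIntegral.integral_comp_div _ hh.ne', add_sub_cancel_right, add_sub_cancel_right,
      mul_div_cancel_left₀ _ hh.ne', div_self hh.ne', smul_eq_mul]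
  have e4 : ∫ x, k x = ∫ x in (0 : ℝ)..1, p x := by
    rw [← integral_unitInterval]
    simp [p]
  rw [e4, ← intervalIntegral.integral_add_adjacent_intervals (hi1 0 (h * u)) (hi1 _ _),
    ← intervalIntegral.integral_add_adjacent_intervals (hi1 (h * u) (h * u + g)) (hi1 _ _),
    ← intervalIntegral.integral_add_adjacent_intervals (hip 0 u) (hip _ _), e1, e2, e3]
  ring

/-- Laplace functional of the bridge measure for fixed parameters. -/
lemma laplace_bridgeMeasure (hα0 : 0 < α) (hα1 : α < 1) {β h g : ℝ} (hβ : 0 < β) (hh : 0 < h)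
    (hg : 0 ≤ g) (u : unitInterval) {f : unitInterval → ℝ≥0} (hf : Measurable f) {C : ℝ≥0}
    (hC : ∀ x, f x ≤ C) :
    ∫⁻ w, expNeg (∫⁻ y, f y ∂(bridgeMeasure α β h g u w)) ∂(subordinatorLaw α) =
      ENNReal.ofReal (Real.exp (-(h * (∫ x, genGammaExponent α (f x / β)) +
        g * genGammaExponent α (f u / β)))) := by
  let F : ℝ → ℝ≥0 := fun x => (Ioc 0 (h + g)).indicator
    (fun x => β.toNNReal⁻¹ * f (inverseTime h g u x)) x
  have hF : Measurable F := Measurable.indicator (by fun_prop) measurableSet_Ioc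
  have hFC (x) : F x ≤ β.toNNReal⁻¹ * C := by
    refine (indicator_le_self _ _ _).trans ?_
    gcongr
    exact hC _
  obtain ⟨K, hK⟩ := exists_nat_gt (h + g)
  have h1 := laplace_halfLineCRM hα0 hα1 hF hFC (K := K) fun x hx =>
    indicator_of_notMem (fun hx' => by linarith [hx'.2]) _
  have hk : Measurable fun x => genGammaExponent α (f x / β) := by fun_prop
  have h2 : ∫ x in Ioi 0, genGammaExponent α (F x) =
      h * (∫ x, genGammaExponent α (f x / β)) + g * genGammaExponent α (f u / β) := by
    rw [← integral_comp_inverseTime hh hg u hk (C := genGammaExponent α (C / β)),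
      intervalIntegral.integral_of_le (by linarith), ← integral_indicator measurableSet_Ioi,
      ← integral_indicator measurableSet_Ioc]
    · congr 1
      ext x
      by_cases hx : x ∈ Ioc 0 (h + g)
      · rw [indicator_of_mem hx, indicator_of_mem (mem_Ioi.2 hx.1)]
        simp only [F, indicator_of_mem hx, NNReal.coe_mul, NNReal.coe_inv,
          Real.coe_toNNReal _ hβ.le]
        rw [div_eq_inv_mul]
      · rw [indicator_of_notMem hx]
        refine indicator_apply_eq_zero.2 fun _ => ?_
        simp only [F, indicator_of_notMem hx, NNReal.coe_zero, genGammaExponent_zero]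
    · intro x
      rw [abs_of_nonneg (genGammaExponent_nonneg hα0 (by positivity))]
      refine genGammaExponent_le hα0 (by positivity) ?_
      gcongr
      exact hC x
  rw [← h2, ← h1]
  refine lintegral_congr fun w => ?_
  rw [lintegral_bridgeMeasure _ _ _ _ _ _ hf.coe_nnreal_ennreal]
  congr 1
  refine lintegral_congr fun x => ?_
  by_cases hx : x ∈ Ioc 0 (h + g)
  · simp only [F, indicator_of_mem hx]
    rw [ENNReal.coe_mul, ← Real.toNNReal_inv]
    rfl
  · simp only [F, indicator_of_notMem hx, ENNReal.coe_zero]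

end

/-! ### The tilted stable random measure with an independent gamma variable -/

section

variable {α b ν : ℝ}

/-- The law of `x / r` for a gamma variable `x`. -/
lemma lintegral_gammaMeasure_comp_div (a : ℝ) {r : ℝ} (hr : 0 < r) {φ : ℝ → ℝ≥0∞}
    (hφ : Measurable φ) :
    ∫⁻ x, φ (x / r) ∂(gammaMeasure a 1) = ∫⁻ s in Ioi 0,
      ENNReal.ofReal (r ^ a * (s ^ (a - 1) * Real.exp (-(s * r)) / Real.Gamma a)) * φ s := by
  rw [lintegral_gammaMeasure_one a (by fun_prop), ← lintegral_indicator measurableSet_Ioi,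
    ← lintegral_indicator measurableSet_Ioi]
  set F : ℝ → ℝ≥0∞ := (Ioi 0).indicator fun x =>
    ENNReal.ofReal (x ^ (a - 1) * Real.exp (-x) / Real.Gamma a) * φ (x / r) with hF
  have hFm : Measurable F := Measurable.indicator (by fun_prop) measurableSet_Ioi
  have h1 : ∫⁻ x, F x = ENNReal.ofReal r * ∫⁻ s, F (r * s) := by
    -- `s ↦ r * s` multiplies Lebesgue measure by `r⁻¹`
    conv_lhs => rw [← Real.smul_map_volume_mul_left hr.ne', abs_of_pos hr]
    rw [lintegral_smul_measure, lintegral_map hFm (by fun_prop), smul_eq_mul]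
  rw [h1, ← lintegral_const_mul _ (by fun_prop)]
  refine lintegral_congr fun s => ?_
  by_cases hs : 0 < s
  · rw [indicator_of_mem (mem_Ioi.2 hs), hF, indicator_of_mem (mem_Ioi.2 (mul_pos hr hs)),
      ← mul_assoc, ← ENNReal.ofReal_mul hr.le, mul_div_cancel_left₀ _ hr.ne',
      Real.mul_rpow hr.le hs.le, Real.rpow_sub_one hr.ne' a]
    congr 2
    field_simp
  · have hrs : r * s ∉ Ioi (0 : ℝ) := fun h => hs ((mul_pos_iff_of_pos_left hr).1 (mem_Ioi.1 h))
    rw [indicator_of_notMem (mt mem_Ioi.1 hs), hF, indicator_of_notMem hrs, mul_zero]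

/-- The Laplace functional at `f` of either bridge, given that the scale `b + ξ` equals `β`. -/
def bridgeLaplace (α β : ℝ) (f : unitInterval → ℝ≥0) : ℝ :=
  Real.exp (-(β ^ α * ∫ x, genGammaExponent α (f x / β))) * ∫ x, (1 + f x / β) ^ (α - 1)

variable {f : unitInterval → ℝ≥0}

lemma integral_mul_exp_eq_bridgeLaplace (hα0 : 0 < α) (hf : Measurable f)
    {C : ℝ≥0} (hC : ∀ x, f x ≤ C) {β : ℝ} (hβ : 0 < β) :
    (∫ x, α * (β + f x) ^ (α - 1)) * Real.exp (-∫ x, (β + f x) ^ α) =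
      α * β ^ (α - 1) * Real.exp (-β ^ α) * bridgeLaplace α β f := by
  have h0 (x) : (β + f x : ℝ) = β * (1 + f x / β) := by field_simp
  have h1 (x) : (0 : ℝ) ≤ 1 + f x / β := by positivity
  have h2 : ∫ x, α * (β + f x) ^ (α - 1) = α * β ^ (α - 1) * ∫ x, (1 + f x / β) ^ (α - 1) := by
    rw [← integral_const_mul]
    congr 1
    ext x
    rw [h0, Real.mul_rpow hβ.le (h1 x), mul_assoc]
  have h3 : ∫ x, (β + f x) ^ α = β ^ α + β ^ α * ∫ x, genGammaExponent α (f x / β) := by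
    have hi : Integrable (fun x => (β + f x : ℝ) ^ α) (volume : Measure unitInterval) := by
      have := integrable_rpow_of_bound (f := fun x => β.toNNReal + f x) hα0.le (by fun_prop)
        (C := β.toNNReal + C) (fun x => by gcongr; exact hC x)
      simpa only [NNReal.coe_add, Real.coe_toNNReal _ hβ.le] using this
    have h4 : β ^ α * ∫ x, genGammaExponent α (f x / β) = ∫ x, ((β + f x) ^ α - β ^ α) := by
      rw [← integral_const_mul]
      congr 1
      ext x
      rw [genGammaExponent, h0, Real.mul_rpow hβ.le (h1 x)]
      ring
    rw [h4, integral_sub hi (integrable_const _)]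
    simp
  rw [h2, h3, bridgeLaplace, neg_add, Real.exp_add]
  ring

lemma measurable_bridgeLaplace (hf : Measurable f) :
    Measurable fun β => bridgeLaplace α β f := by
  have h1 : Measurable fun p : ℝ × unitInterval => genGammaExponent α (f p.2 / p.1) := by fun_prop
  have h2 : Measurable fun p : ℝ × unitInterval => (1 + f p.2 / p.1 : ℝ) ^ (α - 1) := by fun_prop
  have h3 := (h1.stronglyMeasurable.integral_prod_right' (ν := volume)).measurable
  have h4 := (h2.stronglyMeasurable.integral_prod_right' (ν := volume)).measurable
  unfold bridgeLaplace
  fun_prop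

lemma bridgeLaplace_zero {α β : ℝ} : bridgeLaplace α β (fun _ => 0) = 1 := by
  simp [bridgeLaplace, genGammaExponent_zero]

/-- Given the stable random measure with total mass `S`, let `ξ = x / S` for an independent gamma
variable `x`. The weight `S ^ (1 - ν) * exp (-(b * S))` and the density of `ξ` combine to the tilt
by `S * exp (-((b + s) * S))`. -/
lemma lintegral_stableCRM_gamma (hα0 : 0 < α) (hα1 : α < 1) (hb : 0 < b) (hν : 0 < ν)
    (hf : Measurable f) {C : ℝ≥0} (hC : ∀ x, f x ≤ C) {φ : ℝ → ℝ≥0∞} (hφ : Measurable φ) :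
    ∫⁻ z, ENNReal.ofReal (totalJump (stableDensity α) z.1 ^ (1 - ν) *
        Real.exp (-(b * totalJump (stableDensity α) z.1))) *
      (expNeg (∫⁻ x, f x ∂(stableCRM α z)) *
        ∫⁻ x, φ (x / totalJump (stableDensity α) z.1) ∂(gammaMeasure ν 1)) ∂markedLaw =
    ∫⁻ s in Ioi 0, ENNReal.ofReal (s ^ (ν - 1) / Real.Gamma ν) * φ s *
      ENNReal.ofReal (α * (b + s) ^ (α - 1) * Real.exp (-(b + s) ^ α) *
        bridgeLaplace α (b + s) f) := by
  have hS := measurable_totalJump hα0 hα1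
  have hM := measurable_expNeg_lintegral hf (measurable_stableCRM hα0 hα1)
  have hΓ := Real.Gamma_pos_of_pos hν
  have h1 : ∀ᵐ z ∂markedLaw, ENNReal.ofReal (totalJump (stableDensity α) z.1 ^ (1 - ν) *
        Real.exp (-(b * totalJump (stableDensity α) z.1))) *
      (expNeg (∫⁻ x, f x ∂(stableCRM α z)) *
        ∫⁻ x, φ (x / totalJump (stableDensity α) z.1) ∂(gammaMeasure ν 1)) =
      ∫⁻ s in Ioi 0, ENNReal.ofReal (s ^ (ν - 1) / Real.Gamma ν) * φ s *
        (ENNReal.ofReal (totalJump (stableDensity α) z.1 *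
          Real.exp (-((b + s) * totalJump (stableDensity α) z.1))) *
          expNeg (∫⁻ x, f x ∂(stableCRM α z))) := by
    filter_upwards [ae_stableCRM hα0 hα1] with z hz
    set S := totalJump (stableDensity α) z.1
    rw [lintegral_gammaMeasure_comp_div ν hz.2 hφ, ← mul_assoc,
      ← lintegral_const_mul _ (by fun_prop)]
    refine setLIntegral_congr_fun measurableSet_Ioi fun s (hs : 0 < s) => ?_
    have h2 : ENNReal.ofReal (S ^ (1 - ν) * Real.exp (-(b * S))) *
        ENNReal.ofReal (S ^ ν * (s ^ (ν - 1) * Real.exp (-(s * S)) / Real.Gamma ν)) =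
        ENNReal.ofReal (s ^ (ν - 1) / Real.Gamma ν) *
          ENNReal.ofReal (S * Real.exp (-((b + s) * S))) := by
      have hS0 := hz.2
      rw [← ENNReal.ofReal_mul (by positivity), ← ENNReal.ofReal_mul (by positivity)]
      congr 1
      have h3 : S = S ^ (1 - ν) * S ^ ν := by
        rw [← Real.rpow_add hS0, sub_add_cancel, Real.rpow_one]
      have h4 : Real.exp (-((b + s) * S)) = Real.exp (-(b * S)) * Real.exp (-(s * S)) := by
        rw [← Real.exp_add]; ring_nf
      rw [h4]
      conv_rhs => enter [2, 1]; rw [h3]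
      ring
    calc _ = (ENNReal.ofReal (S ^ (1 - ν) * Real.exp (-(b * S))) *
        ENNReal.ofReal (S ^ ν * (s ^ (ν - 1) * Real.exp (-(s * S)) / Real.Gamma ν))) *
          (expNeg (∫⁻ x, f x ∂(stableCRM α z)) * φ s) := by ring
      _ = _ := by rw [h2]; ring
  have hswap {S : (ℕ → ℝ) × (ℕ → unitInterval) → ℝ} {Y : (ℕ → ℝ) × (ℕ → unitInterval) → ℝ≥0∞}
      (hS : Measurable S) (hY : Measurable Y) :
      ∫⁻ z, (∫⁻ s in Ioi (0 : ℝ), ENNReal.ofReal (s ^ (ν - 1) / Real.Gamma ν) * φ s *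
        (ENNReal.ofReal (S z * Real.exp (-((b + s) * S z))) * Y z)) ∂markedLaw =
      ∫⁻ s in Ioi (0 : ℝ), ENNReal.ofReal (s ^ (ν - 1) / Real.Gamma ν) * φ s *
        ∫⁻ z, ENNReal.ofReal (S z * Real.exp (-((b + s) * S z))) * Y z ∂markedLaw := by
    rw [lintegral_lintegral_swap]
    · exact lintegral_congr fun s => lintegral_const_mul _ (by fun_prop)
    · have h3 : Measurable fun p : ((ℕ → ℝ) × (ℕ → unitInterval)) × ℝ =>
          ENNReal.ofReal (p.2 ^ (ν - 1) / Real.Gamma ν) * φ p.2 *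
            (ENNReal.ofReal (S p.1 * Real.exp (-((b + p.2) * S p.1))) * Y p.1) := by fun_prop
      exact h3.aemeasurable
  rw [lintegral_congr_ae h1, hswap (hS.fun_comp measurable_fst) hM]
  refine setLIntegral_congr_fun measurableSet_Ioi fun s (hs : 0 < s) => ?_
  rw [laplace_stableCRM_mul_exp_tilt hα0 hα1 hf hC
    (add_pos hb hs), integral_mul_exp_eq_bridgeLaplace hα0 hf hC (add_pos hb hs)]

/-- The moment normalizing the polynomial tilt, as a Lebesgue integral over `ξ`. -/
lemma lintegral_rpow_tiltedStableLaw (hα0 : 0 < α) (hα1 : α < 1) (hb : 0 < b) (hν : 0 < ν) :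
    ∫⁻ t, ENNReal.ofReal (t ^ (1 - ν)) ∂(tiltedStableLaw α b) =
      ENNReal.ofReal (Real.exp (b ^ α)) * ∫⁻ s in Ioi 0,
        ENNReal.ofReal (s ^ (ν - 1) / Real.Gamma ν) *
          ENNReal.ofReal (α * (b + s) ^ (α - 1) * Real.exp (-(b + s) ^ α)) := by
  have hS := measurable_totalJump hα0 hα1
  have := isProbabilityMeasure_gammaMeasure hν one_pos
  have h := lintegral_stableCRM_gamma hα0 hα1 hb hν (f := fun _ => 0) measurable_const (C := 0)
    (by simp) (φ := fun _ => 1) measurable_const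
  simp only [ENNReal.coe_zero, lintegral_zero, expNeg_zero, lintegral_one, measure_univ, mul_one,
    bridgeLaplace_zero] at h
  rw [← h, tiltedStableLaw, lintegral_withDensity_eq_lintegral_mul _ (by fun_prop) (by fun_prop),
    stableLaw, totalMassLaw, lintegral_map (by fun_prop) hS, ← lintegral_const_mul _ (by fun_prop),
    ← (measurePreserving_fst (μ := expSeqLaw) (ν := Measure.infinitePi fun _ : ℕ =>
      (volume : Measure unitInterval))).lintegral_comp (by fun_prop)]
  refine lintegral_congr fun z => ?_
  simp only [Pi.mul_apply]
  rw [← ENNReal.ofReal_mul (Real.exp_nonneg _), ← ENNReal.ofReal_mul (Real.exp_nonneg _),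
    Real.exp_add]
  ring_nf

lemma ae_pos_tiltedStableLaw (hα0 : 0 < α) (hα1 : α < 1) :
    ∀ᵐ t ∂(tiltedStableLaw α b), 0 < t := by
  refine (withDensity_absolutelyContinuous _ _).ae_le ?_
  rw [stableLaw, totalMassLaw]
  refine (ae_map_iff (measurable_totalJump hα0 hα1).aemeasurable measurableSet_Ioi).2 ?_
  filter_upwards [ae_rankedJump hα0 hα1] with e he
  exact he.2.tsum_pos (rankedJump_nonneg _ _) 0 (he.1 0)

/-- The moment normalizing the polynomial tilt is finite and positive. -/
lemma integral_rpow_tiltedStableLaw_pos (hα0 : 0 < α) (hα1 : α < 1) (hb : 0 < b) (hν : 0 < ν) :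
    0 < ∫ t, t ^ (1 - ν) ∂(tiltedStableLaw α b) ∧
      ∫⁻ t, ENNReal.ofReal (t ^ (1 - ν)) ∂(tiltedStableLaw α b) =
        ENNReal.ofReal (∫ t, t ^ (1 - ν) ∂(tiltedStableLaw α b)) := by
  have hΓ := Real.Gamma_pos_of_pos hν
  set m := ∫⁻ t, ENNReal.ofReal (t ^ (1 - ν)) ∂(tiltedStableLaw α b) with hm
  have hlin := lintegral_rpow_tiltedStableLaw hα0 hα1 hb hν
  -- the integrand over `s` is at most a multiple of `s ^ (ν - 1) * exp (-s ^ α)`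
  have hfin : m < ∞ := by
    rw [hm, hlin]
    refine ENNReal.mul_lt_top ENNReal.ofReal_lt_top ?_
    have hint : IntegrableOn (fun s : ℝ => α * b ^ (α - 1) / Real.Gamma ν *
        (s ^ (ν - 1) * Real.exp (-s ^ α))) (Ioi 0) :=
      (integrableOn_rpow_mul_exp_neg_rpow (by linarith) hα0).const_mul _
    refine lt_of_le_of_lt (setLIntegral_mono' measurableSet_Ioi fun s (hs : 0 < s) => ?_)
      (hasFiniteIntegral_iff_ofReal ((ae_restrict_mem measurableSet_Ioi).mono
        fun s (hs : 0 < s) => ?_) |>.1 hint.2)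
    · rw [← ENNReal.ofReal_mul (by positivity)]
      refine ENNReal.ofReal_le_ofReal ?_
      have h1 : (b + s) ^ (α - 1) ≤ b ^ (α - 1) :=
        Real.rpow_le_rpow_of_nonpos hb (by linarith) (by linarith)
      have h2 : Real.exp (-(b + s) ^ α) ≤ Real.exp (-s ^ α) :=
        Real.exp_le_exp.2 (neg_le_neg (Real.rpow_le_rpow hs.le (by linarith) hα0.le))
      calc s ^ (ν - 1) / Real.Gamma ν * (α * (b + s) ^ (α - 1) * Real.exp (-(b + s) ^ α))
          ≤ s ^ (ν - 1) / Real.Gamma ν * (α * b ^ (α - 1) * Real.exp (-s ^ α)) := by gcongr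
        _ = _ := by ring
    · simp only [Pi.zero_apply]
      positivity
  have hpos : m ≠ 0 := by
    rw [hm, hlin]
    refine mul_ne_zero (by simpa using Real.exp_pos _) fun h0 => ?_
    rw [setLIntegral_eq_zero_iff measurableSet_Ioi (by fun_prop)] at h0
    have h1 : ∀ᵐ s : ℝ, s ∉ Ioi (0 : ℝ) := by
      filter_upwards [h0] with s hs hs0
      have hs0' : 0 < s := hs0
      have hbs : 0 < b + s := by linarith
      have h2 : 0 < s ^ (ν - 1) / Real.Gamma ν := by positivity
      have h3 : 0 < α * (b + s) ^ (α - 1) * Real.exp (-(b + s) ^ α) := by positivity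
      rcases mul_eq_zero.1 (hs hs0) with h | h
      · exact (ENNReal.ofReal_pos.2 h2).ne' h
      · exact (ENNReal.ofReal_pos.2 h3).ne' h
    have h2 : volume (Ioi (0 : ℝ)) = 0 := by
      rw [measure_eq_zero_iff_ae_notMem]
      exact h1
    simp at h2
  have heq : ∫ t, t ^ (1 - ν) ∂(tiltedStableLaw α b) = m.toReal := by
    rw [integral_eq_lintegral_of_nonneg_ae _ (by fun_prop : Measurable _).aestronglyMeasurable]
    filter_upwards [ae_pos_tiltedStableLaw hα0 hα1] with t ht
    simp only [Pi.zero_apply]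
    positivity
  rw [heq, ENNReal.ofReal_toReal hfin.ne]
  exact ⟨ENNReal.toReal_pos hpos hfin.ne, rfl⟩

/-- The density of `X_{α,b}^{[ν-1]}` with respect to the stable law. -/
def tiltDensity (α b ν t : ℝ) : ℝ :=
  Real.exp (-b * t + b ^ α) * (t ^ (1 - ν) / ∫ x, x ^ (1 - ν) ∂(tiltedStableLaw α b))

@[fun_prop]
lemma measurable_tiltDensity : Measurable (tiltDensity α b ν) := by
  unfold tiltDensity; fun_prop

lemma polyTilt_tiltedStableLaw (α b ν : ℝ) : polyTilt (ν - 1) (tiltedStableLaw α b) =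
    (stableLaw α).withDensity fun t => ENNReal.ofReal (tiltDensity α b ν t) := by
  rw [polyTilt, neg_sub]
  conv_lhs => enter [1]; rw [tiltedStableLaw]
  rw [← withDensity_mul _ (by fun_prop) (by fun_prop)]
  congr 1
  ext t
  rw [Pi.mul_apply, tiltDensity, ENNReal.ofReal_mul (Real.exp_nonneg _)]

/-- The law of the spacings and locations, reweighted so that the total mass of the stable random
measure has the law of `X_{α,b}^{[ν-1]}`. -/
def tiltedMarkedLaw (α b ν : ℝ) : Measure ((ℕ → ℝ) × (ℕ → unitInterval)) :=
  markedLaw.withDensity fun z =>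
    ENNReal.ofReal (tiltDensity α b ν (totalJump (stableDensity α) z.1))

lemma isProbabilityMeasure_polyTilt (hα0 : 0 < α) (hα1 : α < 1) (hb : 0 < b) (hν : 0 < ν) :
    IsProbabilityMeasure (polyTilt (ν - 1) (tiltedStableLaw α b)) := by
  obtain ⟨h1, h2⟩ := integral_rpow_tiltedStableLaw_pos hα0 hα1 hb hν
  constructor
  rw [polyTilt, withDensity_apply _ .univ, Measure.restrict_univ, neg_sub]
  set c := ∫ t, t ^ (1 - ν) ∂(tiltedStableLaw α b)
  simp_rw [div_eq_mul_inv, ENNReal.ofReal_mul' (inv_nonneg.2 h1.le)]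
  rw [lintegral_mul_const _ (by fun_prop), h2, ← ENNReal.ofReal_mul h1.le, mul_inv_cancel₀ h1.ne',
    ENNReal.ofReal_one]

lemma map_withDensity_comp {E F : Type*} [MeasurableSpace E] [MeasurableSpace F] (m : Measure E)
    {S : E → F} (hS : Measurable S) {g : F → ℝ≥0∞} (hg : Measurable g) :
    (m.withDensity fun z => g (S z)).map S = (m.map S).withDensity g := by
  ext B hB
  rw [Measure.map_apply hS hB, withDensity_apply _ (hS hB), withDensity_apply _ hB,
    setLIntegral_map hB hg hS]

/-- Under the reweighted law the total mass has the law of `X_{α,b}^{[ν-1]}`. -/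
lemma map_totalJump_tiltedMarkedLaw (hα0 : 0 < α) (hα1 : α < 1) :
    (tiltedMarkedLaw α b ν).map (fun z => totalJump (stableDensity α) z.1) =
      polyTilt (ν - 1) (tiltedStableLaw α b) := by
  have hS := measurable_totalJump hα0 hα1
  rw [tiltedMarkedLaw, polyTilt_tiltedStableLaw, map_withDensity_comp _
    (S := fun z : (ℕ → ℝ) × (ℕ → unitInterval) => totalJump (stableDensity α) z.1)
    (g := fun t => ENNReal.ofReal (tiltDensity α b ν t)) (by fun_prop) (by fun_prop), stableLaw,
    totalMassLaw]
  congr 1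
  change Measure.map (totalJump (stableDensity α) ∘ Prod.fst) markedLaw = _
  rw [← Measure.map_map hS measurable_fst]
  congr 1
  exact measurePreserving_fst.map_eq

lemma isProbabilityMeasure_tiltedMarkedLaw (hα0 : 0 < α) (hα1 : α < 1) (hb : 0 < b)
    (hν : 0 < ν) : IsProbabilityMeasure (tiltedMarkedLaw α b ν) := by
  have := isProbabilityMeasure_polyTilt hα0 hα1 hb hν
  constructor
  rw [← measure_univ (μ := polyTilt (ν - 1) (tiltedStableLaw α b)),
    ← map_totalJump_tiltedMarkedLaw hα0 hα1,
    Measure.map_apply (by have := measurable_totalJump hα0 hα1; fun_prop) .univ, preimage_univ]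

/-- Joint law of `ξ` and of the tilted stable random measure. -/
lemma lintegral_tiltedMarkedLaw_gamma (hα0 : 0 < α) (hα1 : α < 1) (hb : 0 < b) (hν : 0 < ν)
    (hf : Measurable f) {C : ℝ≥0} (hC : ∀ x, f x ≤ C) {φ : ℝ → ℝ≥0∞} (hφ : Measurable φ) :
    ∫⁻ p, φ (p.2 / totalJump (stableDensity α) p.1.1) * expNeg (∫⁻ x, f x ∂(stableCRM α p.1))
      ∂((tiltedMarkedLaw α b ν).prod (gammaMeasure ν 1)) =
    ∫⁻ s, φ s * ENNReal.ofReal (bridgeLaplace α (b + s) f) ∂(xiLaw α b ν) := by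
  have hS := measurable_totalJump hα0 hα1
  have hM := measurable_expNeg_lintegral hf (measurable_stableCRM hα0 hα1)
  have hΓ := Real.Gamma_pos_of_pos hν
  obtain ⟨hc, -⟩ := integral_rpow_tiltedStableLaw_pos hα0 hα1 hb hν
  set c := ∫ t, t ^ (1 - ν) ∂(tiltedStableLaw α b) with hcdef
  set K : ℝ := Real.exp (b ^ α) / c with hK
  have hK0 : 0 ≤ K := by positivity
  have hpγ := isProbabilityMeasure_gammaMeasure hν one_pos
  have hφS : Measurable fun p : ((ℕ → ℝ) × (ℕ → unitInterval)) × ℝ =>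
      φ (p.2 / totalJump (stableDensity α) p.1.1) := by fun_prop
  rw [lintegral_prod _ (hφS.fun_mul (hM.fun_comp measurable_fst)).aemeasurable]
  have h1 (z : (ℕ → ℝ) × (ℕ → unitInterval)) :
      ∫⁻ x, φ (x / totalJump (stableDensity α) z.1) * expNeg (∫⁻ x, f x ∂(stableCRM α z))
        ∂(gammaMeasure ν 1) = expNeg (∫⁻ x, f x ∂(stableCRM α z)) *
          ∫⁻ x, φ (x / totalJump (stableDensity α) z.1) ∂(gammaMeasure ν 1) := by
    rw [lintegral_mul_const _ (by fun_prop), mul_comm]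
  simp only [h1]
  have hin : Measurable fun z : (ℕ → ℝ) × (ℕ → unitInterval) =>
      ∫⁻ x, φ (x / totalJump (stableDensity α) z.1) ∂(gammaMeasure ν 1) :=
    hφS.lintegral_prod_right'
  have h2 (z : (ℕ → ℝ) × (ℕ → unitInterval)) :
      ENNReal.ofReal (tiltDensity α b ν (totalJump (stableDensity α) z.1)) = ENNReal.ofReal K *
        ENNReal.ofReal (totalJump (stableDensity α) z.1 ^ (1 - ν) *
          Real.exp (-(b * totalJump (stableDensity α) z.1))) := by
    rw [← ENNReal.ofReal_mul hK0, tiltDensity, Real.exp_add]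
    congr 1
    rw [hK, neg_mul]
    ring
  rw [tiltedMarkedLaw, lintegral_withDensity_eq_lintegral_mul _ (by fun_prop) (hM.fun_mul hin)]
  simp only [Pi.mul_apply, h2, mul_assoc]
  rw [lintegral_const_mul, lintegral_stableCRM_gamma hα0 hα1 hb hν hf hC hφ, xiLaw]
  · have hL : Measurable fun s => ENNReal.ofReal (bridgeLaplace α (b + s) f) :=
      ((measurable_bridgeLaplace hf).comp (measurable_const_add b)).ennreal_ofReal
    rw [lintegral_withDensity_eq_lintegral_mul _ (by fun_prop) (hφ.fun_mul hL),
      ← lintegral_const_mul']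
    · refine setLIntegral_congr_fun measurableSet_Ioi fun s (hs : 0 < s) => ?_
      have hbs : 0 < b + s := by linarith
      simp only [Pi.mul_apply, ← hcdef]
      rw [ENNReal.ofReal_mul (p := α * (b + s) ^ (α - 1) * Real.exp (-(b + s) ^ α))
        (by positivity)]
      have h3 : ENNReal.ofReal (α * (b + s) ^ (α - 1) * Real.exp (-(b + s) ^ α + b ^ α) *
          s ^ (ν - 1) / (Real.Gamma ν * c)) = ENNReal.ofReal K *
          ENNReal.ofReal (s ^ (ν - 1) / Real.Gamma ν) *
          ENNReal.ofReal (α * (b + s) ^ (α - 1) * Real.exp (-(b + s) ^ α)) := by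
        rw [← ENNReal.ofReal_mul hK0, ← ENNReal.ofReal_mul (by positivity), Real.exp_add, hK]
        congr 1
        field_simp
      rw [h3]
      ring
    · exact ENNReal.ofReal_ne_top
  · exact Measurable.mul (by fun_prop) (hM.mul hin)

lemma isProbabilityMeasure_xiLaw (hα0 : 0 < α) (hα1 : α < 1) (hb : 0 < b) (hν : 0 < ν) :
    IsProbabilityMeasure (xiLaw α b ν) := by
  have h := lintegral_tiltedMarkedLaw_gamma hα0 hα1 hb hν (f := fun _ => 0) measurable_const
    (C := 0) (by simp) (φ := fun _ => 1) measurable_const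
  have hpm := isProbabilityMeasure_tiltedMarkedLaw hα0 hα1 hb hν
  have hpγ := isProbabilityMeasure_gammaMeasure hν one_pos
  constructor
  simpa [bridgeLaplace_zero] using h.symm

lemma ae_pos_xiLaw (α b ν : ℝ) : ∀ᵐ s ∂(xiLaw α b ν), 0 < s :=
  (withDensity_absolutelyContinuous _ _).ae_le (ae_restrict_mem measurableSet_Ioi)

end

/-! ### The laws of the two bridges -/

section

variable {α b ν a : ℝ}

/-- The product of the laws of `ξ`, of the gamma variable, of the uniform variable and of the
randomness behind the subordinator. -/
def bridgeLaw (α b ν a : ℝ) :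
    Measure (ℝ × ℝ × unitInterval × (ℕ → (ℕ → ℝ) × (ℕ → unitInterval))) :=
  (xiLaw α b ν).prod ((gammaMeasure a 1).prod (volume.prod (subordinatorLaw α)))

/-- The size-biased bridge: a subordinator run up to a fixed time, plus a gamma atom. -/
def sizeBiasedBridge (α b : ℝ)
    (p : ℝ × ℝ × unitInterval × (ℕ → (ℕ → ℝ) × (ℕ → unitInterval))) : Measure unitInterval :=
  bridgeMeasure α (b + p.1) ((b + p.1) ^ α) 0 p.2.2.1 p.2.2.2 +
    ENNReal.ofReal (p.2.1 / (b + p.1)) • Measure.dirac p.2.2.1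

/-- The time-shifted bridge: a subordinator run with a gamma jump in its clock. -/
def timeShiftedBridge (α b : ℝ)
    (p : ℝ × ℝ × unitInterval × (ℕ → (ℕ → ℝ) × (ℕ → unitInterval))) : Measure unitInterval :=
  bridgeMeasure α (b + p.1) ((b + p.1) ^ α) p.2.1 p.2.2.1 p.2.2.2

lemma isProbabilityMeasure_bridgeLaw (hα0 : 0 < α) (hα1 : α < 1) (hb : 0 < b) (hν : 0 < ν)
    (ha : 0 < a) : IsProbabilityMeasure (bridgeLaw α b ν a) := by
  have := isProbabilityMeasure_xiLaw hα0 hα1 hb hν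
  have := isProbabilityMeasure_gammaMeasure ha one_pos
  have := isProbabilityMeasure_subordinatorLaw hα0 hα1
  unfold bridgeLaw
  infer_instance

lemma measurable_timeShiftedBridge (hα0 : 0 < α) (hα1 : α < 1) :
    Measurable (timeShiftedBridge α b) := by
  have h := measurable_bridgeMeasure hα0 hα1 (E := ℝ × ℝ × unitInterval)
    (β := fun e => b + e.1) (h := fun e => (b + e.1) ^ α) (g := fun e => e.2.1)
    (u := fun e => e.2.2) (by fun_prop) (by fun_prop) (by fun_prop) (by fun_prop)
  exact h.comp (g := fun _ => _) (f := fun p : ℝ × ℝ × unitInterval ×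
    (ℕ → (ℕ → ℝ) × (ℕ → unitInterval)) => ((p.1, p.2.1, p.2.2.1), p.2.2.2)) (by fun_prop)

lemma measurable_sizeBiasedBridge (hα0 : 0 < α) (hα1 : α < 1) :
    Measurable (sizeBiasedBridge α b) := by
  have h := measurable_bridgeMeasure hα0 hα1 (E := ℝ × ℝ × unitInterval)
    (β := fun e => b + e.1) (h := fun e => (b + e.1) ^ α) (g := fun e => 0)
    (u := fun e => e.2.2) (by fun_prop) (by fun_prop) (by fun_prop) (by fun_prop)
  have h1 := h.fun_comp (f := fun p : ℝ × ℝ × unitInterval ×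
    (ℕ → (ℕ → ℝ) × (ℕ → unitInterval)) => ((p.1, p.2.1, p.2.2.1), p.2.2.2)) (by fun_prop)
  refine Measure.measurable_of_measurable_coe _ fun B hB => ?_
  have h2 := (Measure.measurable_coe hB).comp h1
  have h3 : Measurable fun p : ℝ × ℝ × unitInterval × (ℕ → (ℕ → ℝ) × (ℕ → unitInterval)) =>
      ENNReal.ofReal (p.2.1 / (b + p.1)) * B.indicator 1 p.2.2.1 :=
    Measurable.mul (by fun_prop) ((measurable_one.indicator hB).comp (by fun_prop))
  convert! h2.add h3 using 2 with p
  simp only [sizeBiasedBridge, Measure.add_apply, Measure.smul_apply, Measure.dirac_apply' _ hB,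
    smul_eq_mul, Pi.add_apply, Function.comp_apply]

lemma bridgeInputs_bridgeLaw (hα0 : 0 < α) (hα1 : α < 1) (hb : 0 < b) (hν : 0 < ν)
    (ha : 0 < a) : BridgeInputs (bridgeLaw α b ν a) α b ν a (fun p => p.1)
      (fun t p => genGammaProcess α t p.2.2.2) (fun p => p.2.1) (fun p => p.2.2.1) := by
  have := isProbabilityMeasure_xiLaw hα0 hα1 hb hν
  have := isProbabilityMeasure_gammaMeasure ha one_pos
  have := isProbabilityMeasure_subordinatorLaw hα0 hα1
  have hτ := measurable_genGammaProcess hα0 hα1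
  have hτ' : Measurable fun w t => genGammaProcess α t w := measurable_pi_lambda _ hτ
  have p1 : MeasurePreserving Prod.snd (bridgeLaw α b ν a)
    ((gammaMeasure a 1).prod (volume.prod (subordinatorLaw α))) := measurePreserving_snd
  have p2 : MeasurePreserving (fun p => p.2.2) (bridgeLaw α b ν a)
    (volume.prod (subordinatorLaw α)) := measurePreserving_snd.comp p1
  have p3 : MeasurePreserving (fun p => p.2.2.2) (bridgeLaw α b ν a) (subordinatorLaw α) :=
    measurePreserving_snd.comp p2
  refine ⟨measurePreserving_fst.hasLaw, (isSubordinator_genGammaProcess hα0 hα1).comp p3,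
    (measurePreserving_fst.comp p1).hasLaw, (measurePreserving_fst.comp p2).hasLaw, ?_, ?_, ?_⟩
  · exact indepFun_prod (X := fun x => x) (Y := fun q : ℝ × unitInterval ×
      (ℕ → (ℕ → ℝ) × (ℕ → unitInterval)) => (q.1, q.2.1, fun t => genGammaProcess α t q.2.2))
      measurable_id (by fun_prop)
  · exact p1.indepFun_comp (X := Prod.fst) (Y := fun q : ℝ × unitInterval ×
      (ℕ → (ℕ → ℝ) × (ℕ → unitInterval)) => (q.2.1, fun t => genGammaProcess α t q.2.2))
      measurable_fst (by fun_prop) (indepFun_prod (X := fun x => x) (Y := fun q : unitInterval ×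
        (ℕ → (ℕ → ℝ) × (ℕ → unitInterval)) => (q.1, fun t => genGammaProcess α t q.2))
        measurable_id (by fun_prop))
  · exact p2.indepFun_comp (X := Prod.fst) (Y := fun q : unitInterval ×
      (ℕ → (ℕ → ℝ) × (ℕ → unitInterval)) => (fun t => genGammaProcess α t q.2))
      measurable_fst (by fun_prop) (indepFun_prod (X := fun x => x)
        (Y := fun w t => genGammaProcess α t w) measurable_id (by fun_prop))

lemma ae_bridgeLaw (hα0 : 0 < α) (hα1 : α < 1) (hb : 0 < b) (hν : 0 < ν) (ha : 0 < a) :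
    ∀ᵐ p ∂(bridgeLaw α b ν a), 0 < p.1 ∧ 0 < p.2.1 ∧
      ∀ t : ℝ, halfLineCRM α p.2.2.2 (Ioc 0 t) < ∞ := by
  have := isProbabilityMeasure_xiLaw hα0 hα1 hb hν
  have := isProbabilityMeasure_gammaMeasure ha one_pos
  have := isProbabilityMeasure_subordinatorLaw hα0 hα1
  unfold bridgeLaw
  filter_upwards [Measure.quasiMeasurePreserving_fst.ae (ae_pos_xiLaw α b ν),
    Measure.quasiMeasurePreserving_snd.ae
      (Measure.quasiMeasurePreserving_fst.ae (ae_pos_gammaMeasure a)),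
    Measure.quasiMeasurePreserving_snd.ae (Measure.quasiMeasurePreserving_snd.ae
      (Measure.quasiMeasurePreserving_snd.ae (ae_halfLineCRM_lt_top hα0 hα1)))] with p h1 h2 h3
  exact ⟨h1, h2, h3⟩

lemma timeShiftedBridge_Iic (hb : 0 < b)
    {p : ℝ × ℝ × unitInterval × (ℕ → (ℕ → ℝ) × (ℕ → unitInterval))} (h1 : 0 < p.1)
    (h2 : 0 < p.2.1) (h3 : ∀ t : ℝ, halfLineCRM α p.2.2.2 (Ioc 0 t) < ∞) (y : unitInterval) :
    timeShiftedBridge α b p (Iic y) = ENNReal.ofReal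
      (genGammaProcess α (Real.toNNReal ((y : ℝ) * (b + p.1) ^ α +
        p.2.1 * (Ici p.2.2.1).indicator 1 y)) p.2.2.2 / (b + p.1)) :=
  bridgeMeasure_Iic h3 (by positivity) (by positivity) h2.le _ _

lemma sizeBiasedBridge_Iic (hb : 0 < b)
    {p : ℝ × ℝ × unitInterval × (ℕ → (ℕ → ℝ) × (ℕ → unitInterval))} (h1 : 0 < p.1)
    (h2 : 0 < p.2.1) (h3 : ∀ t : ℝ, halfLineCRM α p.2.2.2 (Ioc 0 t) < ∞) (y : unitInterval) :
    sizeBiasedBridge α b p (Iic y) = ENNReal.ofReal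
      (genGammaProcess α (Real.toNNReal ((y : ℝ) * (b + p.1) ^ α)) p.2.2.2 / (b + p.1) +
        p.2.1 / (b + p.1) * (Ici p.2.2.1).indicator 1 y) := by
  have hτ : 0 ≤ genGammaProcess α (Real.toNNReal ((y : ℝ) * (b + p.1) ^ α)) p.2.2.2 :=
    ENNReal.toReal_nonneg
  have hi : (0 : ℝ) ≤ (Ici p.2.2.1).indicator 1 y := indicator_nonneg (fun _ _ => zero_le_one) _
  rw [sizeBiasedBridge, Measure.add_apply, Measure.smul_apply,
    bridgeMeasure_Iic h3 (by positivity) (by positivity) le_rfl, zero_mul, add_zero,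
    ENNReal.ofReal_add (by positivity) (by positivity), ENNReal.ofReal_mul (by positivity),
    Measure.dirac_apply' _ measurableSet_Iic, smul_eq_mul]
  congr 2
  by_cases huy : p.2.2.1 ≤ y
  · rw [indicator_of_mem (mem_Iic.2 huy), indicator_of_mem (mem_Ici.2 huy)]
    simp
  · rw [indicator_of_notMem (mt mem_Iic.1 huy), indicator_of_notMem (mt mem_Ici.1 huy)]
    simp

lemma timeShiftedBridge_univ_lt_top
    {p : ℝ × ℝ × unitInterval × (ℕ → (ℕ → ℝ) × (ℕ → unitInterval))}
    (h : ∀ t : ℝ, halfLineCRM α p.2.2.2 (Ioc 0 t) < ∞) : timeShiftedBridge α b p univ < ∞ :=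
  bridgeMeasure_univ_lt_top h _

lemma sizeBiasedBridge_univ_lt_top
    {p : ℝ × ℝ × unitInterval × (ℕ → (ℕ → ℝ) × (ℕ → unitInterval))}
    (h : ∀ t : ℝ, halfLineCRM α p.2.2.2 (Ioc 0 t) < ∞) : sizeBiasedBridge α b p univ < ∞ := by
  rw [sizeBiasedBridge, Measure.add_apply, Measure.smul_apply]
  exact ENNReal.add_lt_top.2 ⟨bridgeMeasure_univ_lt_top h _,
    ENNReal.mul_lt_top ENNReal.ofReal_lt_top (measure_lt_top _ _)⟩

variable {f : unitInterval → ℝ≥0}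

/-- Integrating out the gamma and the uniform variable produces the factor
`∫ (1 + f / β) ^ (α - 1)` of the bridge Laplace functional. -/
lemma lintegral_gamma_uniform (hα1 : α < 1) (ha : 0 < a) (hf : Measurable f)
    {β : ℝ} (hβ : 0 < β) {e : unitInterval → ℝ} (he : Measurable e) (he0 : ∀ u, 0 ≤ e u)
    (hef : ∀ u, (1 + e u) ^ (-a) = (1 + f u / β) ^ (α - 1)) {E : ℝ} (hE : 0 ≤ E) :
    ∫⁻ g, ∫⁻ u, ENNReal.ofReal E * expNeg (ENNReal.ofReal (g * e u)) ∂(volume : Measure unitInterval)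
      ∂(gammaMeasure a 1) =
      ENNReal.ofReal (E * ∫ x, (1 + f x / β) ^ (α - 1)) := by
  have hm : Measurable fun p : ℝ × unitInterval =>
      ENNReal.ofReal E * expNeg (ENNReal.ofReal (p.1 * e p.2)) := by fun_prop
  have h1 (x) : (1 : ℝ) ≤ 1 + f x / β := le_add_of_nonneg_right (by positivity)
  have h0 (x) : (0 : ℝ) ≤ (1 + f x / β) ^ (α - 1) := Real.rpow_nonneg (zero_le_one.trans (h1 x)) _
  rw [lintegral_lintegral_swap hm.aemeasurable, ENNReal.ofReal_mul hE,
    ofReal_integral_eq_lintegral_ofReal (Integrable.of_bound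
      (by fun_prop : Measurable _).aestronglyMeasurable 1 (ae_of_all _ fun x => by
        rw [Real.norm_of_nonneg (h0 x)]
        exact Real.rpow_le_one_of_one_le_of_nonpos (h1 x) (by linarith))) (ae_of_all _ h0),
    ← lintegral_const_mul _ (by fun_prop)]
  refine lintegral_congr fun u => ?_
  rw [lintegral_const_mul _ (by fun_prop), lintegral_expNeg_gammaMeasure ha (he0 u), hef]

/-- Conditional Laplace functional of the time-shifted bridge. -/
lemma laplace_timeShifted (hα0 : 0 < α) (hα1 : α < 1) (hf : Measurable f) {C : ℝ≥0}
    (hC : ∀ x, f x ≤ C) {β : ℝ} (hβ : 0 < β) :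
    ∫⁻ g, ∫⁻ u, ∫⁻ w, expNeg (∫⁻ y, f y ∂(bridgeMeasure α β (β ^ α) g u w))
      ∂(subordinatorLaw α) ∂(volume : Measure unitInterval) ∂(gammaMeasure ((1 - α) / α) 1) =
      ENNReal.ofReal (bridgeLaplace α β f) := by
  have he0 (u) : 0 ≤ genGammaExponent α (f u / β) := genGammaExponent_nonneg hα0 (by positivity)
  rw [bridgeLaplace, ← lintegral_gamma_uniform hα1 (div_pos (sub_pos.2 hα1) hα0) hf hβ
    (e := fun u => genGammaExponent α (f u / β)) (by fun_prop) he0 (fun u => ?_)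
    (Real.exp_nonneg _)]
  · refine lintegral_congr_ae ?_
    filter_upwards [ae_pos_gammaMeasure _] with g hg
    refine lintegral_congr fun u => ?_
    rw [laplace_bridgeMeasure hα0 hα1 hβ (by positivity) hg.le u hf hC,
      expNeg_ofReal (mul_nonneg hg.le (he0 u)), ← ENNReal.ofReal_mul (Real.exp_nonneg _),
      ← Real.exp_add, neg_add]
  · rw [genGammaExponent, add_sub_cancel, ← Real.rpow_mul (by positivity)]
    congr 1
    field_simp
    ring

/-- Conditional Laplace functional of the size-biased bridge. -/
lemma laplace_sizeBiased (hα0 : 0 < α) (hα1 : α < 1) (hf : Measurable f) {C : ℝ≥0}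
    (hC : ∀ x, f x ≤ C) {β : ℝ} (hβ : 0 < β) :
    ∫⁻ g, ∫⁻ u, ∫⁻ w, expNeg (∫⁻ y, f y ∂(bridgeMeasure α β (β ^ α) 0 u w +
        ENNReal.ofReal (g / β) • Measure.dirac u))
      ∂(subordinatorLaw α) ∂(volume : Measure unitInterval) ∂(gammaMeasure (1 - α) 1) =
      ENNReal.ofReal (bridgeLaplace α β f) := by
  have he0 (u) : (0 : ℝ) ≤ f u / β := by positivity
  rw [bridgeLaplace, ← lintegral_gamma_uniform hα1 (sub_pos.2 hα1) hf hβ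
    (e := fun u => f u / β) (by fun_prop) he0 (fun u => by rw [neg_sub]) (Real.exp_nonneg _)]
  refine lintegral_congr_ae ?_
  filter_upwards [ae_pos_gammaMeasure _] with g hg
  refine lintegral_congr fun u => ?_
  have h1 : ENNReal.ofReal (g * (f u / β)) = ENNReal.ofReal (g / β) * f u := by
    rw [← ENNReal.ofReal_coe_nnreal, ← ENNReal.ofReal_mul (by positivity)]
    congr 1
    ring
  simp_rw [lintegral_add_measure, expNeg_add, lintegral_smul_measure,
    lintegral_dirac' u hf.coe_nnreal_ennreal, smul_eq_mul]
  rw [lintegral_mul_const', laplace_bridgeMeasure hα0 hα1 hβ (by positivity) le_rfl u hf hC, h1]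
  · simp
  · exact ne_top_of_le_ne_top ENNReal.one_ne_top (expNeg_le_one _)

/-- Disintegration with respect to `ξ`. -/
lemma lintegral_bridgeLaw (hα0 : 0 < α) (hα1 : α < 1) (hb : 0 < b) (hν : 0 < ν) (ha : 0 < a)
    {M : ℝ × ℝ × unitInterval × (ℕ → (ℕ → ℝ) × (ℕ → unitInterval)) → Measure unitInterval}
    (hM : Measurable M) (hf : Measurable f)
    (h : ∀ s, 0 < s → ∫⁻ g, ∫⁻ u, ∫⁻ w, expNeg (∫⁻ y, f y ∂(M (s, g, u, w)))
      ∂(subordinatorLaw α) ∂(volume : Measure unitInterval) ∂(gammaMeasure a 1) =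
      ENNReal.ofReal (bridgeLaplace α (b + s) f)) {φ : ℝ → ℝ≥0∞} (hφ : Measurable φ) :
    ∫⁻ p, φ p.1 * expNeg (∫⁻ x, f x ∂(M p)) ∂(bridgeLaw α b ν a) =
      ∫⁻ s, φ s * ENNReal.ofReal (bridgeLaplace α (b + s) f) ∂(xiLaw α b ν) := by
  have := isProbabilityMeasure_xiLaw hα0 hα1 hb hν
  have := isProbabilityMeasure_gammaMeasure ha one_pos
  have := isProbabilityMeasure_subordinatorLaw hα0 hα1
  have hY := measurable_expNeg_lintegral hf hM
  rw [bridgeLaw, lintegral_prod _ ((hφ.fun_comp measurable_fst).fun_mul hY).aemeasurable]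
  refine lintegral_congr_ae ?_
  filter_upwards [ae_pos_xiLaw α b ν] with s hs
  have hY1 : Measurable fun q : ℝ × unitInterval × (ℕ → (ℕ → ℝ) × (ℕ → unitInterval)) =>
    expNeg (∫⁻ x, f x ∂(M (s, q))) := hY.fun_comp (measurable_prodMk_left (x := s))
  rw [lintegral_const_mul _ hY1, ← h s hs, lintegral_prod _ hY1.aemeasurable]
  congr 1
  refine lintegral_congr fun g => ?_
  have hY2 : Measurable fun q : unitInterval × (ℕ → (ℕ → ℝ) × (ℕ → unitInterval)) =>
    expNeg (∫⁻ x, f x ∂(M (s, g, q))) := hY1.fun_comp (measurable_prodMk_left (x := g))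
  rw [lintegral_prod _ hY2.aemeasurable]

lemma setLIntegral_preimage_eq_indicator_mul {Ω E : Type*} [MeasurableSpace Ω] [MeasurableSpace E]
    {m : Measure Ω} {X : Ω → E} (hX : Measurable X) {B : Set E} (hB : MeasurableSet B)
    (Y : Ω → ℝ≥0∞) :
    ∫⁻ ω in X ⁻¹' B, Y ω ∂m = ∫⁻ ω, B.indicator 1 (X ω) * Y ω ∂m := by
  rw [← lintegral_indicator (hX hB)]
  refine lintegral_congr fun ω => ?_
  by_cases hω : X ω ∈ B
  · rw [indicator_of_mem (mem_preimage.2 hω), indicator_of_mem hω, Pi.one_apply, one_mul]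
  · rw [indicator_of_notMem (mt mem_preimage.1 hω), indicator_of_notMem hω, zero_mul]

/-- A pair `(ξ, M)` with conditional Laplace functional `bridgeLaplace` has the law of the pair
built from the tilted stable random measure and an independent gamma variable. -/
lemma map_prodMk_eq_of_bridgeLaplace (hα0 : 0 < α) (hα1 : α < 1) (hb : 0 < b) (hν : 0 < ν)
    {Ω : Type*} [MeasurableSpace Ω] {m : Measure Ω} [IsFiniteMeasure m]
    {X : Ω → ℝ} {M : Ω → Measure unitInterval} (hX : Measurable X) (hM : Measurable M)
    (hM' : ∀ᵐ ω ∂m, M ω univ < ∞)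
    (h : ∀ f : unitInterval → ℝ≥0, Measurable f → (∃ C, ∀ x, f x ≤ C) → ∀ φ : ℝ → ℝ≥0∞,
      Measurable φ → ∫⁻ ω, φ (X ω) * expNeg (∫⁻ x, f x ∂(M ω)) ∂m =
        ∫⁻ s, φ s * ENNReal.ofReal (bridgeLaplace α (b + s) f) ∂(xiLaw α b ν)) :
    ((tiltedMarkedLaw α b ν).prod (gammaMeasure ν 1)).map
      (fun p => (p.2 / totalJump (stableDensity α) p.1.1, stableCRM α p.1)) =
      m.map (fun ω => (X ω, M ω)) := by
  have hS := measurable_totalJump hα0 hα1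
  have := isProbabilityMeasure_tiltedMarkedLaw hα0 hα1 hb hν
  have := isProbabilityMeasure_gammaMeasure hν one_pos
  have hξ : Measurable fun p : ((ℕ → ℝ) × (ℕ → unitInterval)) × ℝ =>
      p.2 / totalJump (stableDensity α) p.1.1 := by fun_prop
  refine map_prodMk_eq_of_laplace hξ hX ((measurable_stableCRM hα0 hα1).comp measurable_fst) hM
    ?_ hM' fun f hf hC B hB => ?_
  · suffices h1 : ∀ᵐ z ∂(tiltedMarkedLaw α b ν), stableCRM α z univ < ∞ from
      Measure.quasiMeasurePreserving_fst.ae h1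
    refine (withDensity_absolutelyContinuous _ _).ae_le ?_
    filter_upwards [ae_stableCRM hα0 hα1] with z hz
    rw [hz.1]
    exact ENNReal.ofReal_lt_top
  · obtain ⟨C, hC⟩ := hC
    rw [setLIntegral_preimage_eq_indicator_mul hξ hB, setLIntegral_preimage_eq_indicator_mul hX hB]
    have hφ : Measurable (B.indicator (1 : ℝ → ℝ≥0∞)) := measurable_one.indicator hB
    rw [lintegral_tiltedMarkedLaw_gamma hα0 hα1 hb hν hf hC hφ, h f hf ⟨C, hC⟩ _ hφ]

/-- The size-biased bridge has the law of the tilted stable random measure, jointly with `ξ`. -/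
theorem map_sizeBiasedBridge (hα0 : 0 < α) (hα1 : α < 1) (hb : 0 < b) (hν : 0 < ν) :
    ((tiltedMarkedLaw α b ν).prod (gammaMeasure ν 1)).map
      (fun p => (p.2 / totalJump (stableDensity α) p.1.1, stableCRM α p.1)) =
      (bridgeLaw α b ν (1 - α)).map (fun p => (p.1, sizeBiasedBridge α b p)) := by
  have ha : 0 < 1 - α := sub_pos.2 hα1
  have := isProbabilityMeasure_bridgeLaw hα0 hα1 hb hν ha
  refine map_prodMk_eq_of_bridgeLaplace hα0 hα1 hb hν (X := Prod.fst)
    (M := sizeBiasedBridge α b) measurable_fst (measurable_sizeBiasedBridge hα0 hα1) ?_ fun f hf ⟨C, hC⟩ φ hφ => ?_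
  · exact (ae_bridgeLaw hα0 hα1 hb hν ha).mono fun p hp => sizeBiasedBridge_univ_lt_top hp.2.2
  · exact lintegral_bridgeLaw hα0 hα1 hb hν ha (measurable_sizeBiasedBridge hα0 hα1) hf
      (fun s hs => by
        simp only [sizeBiasedBridge]
        exact laplace_sizeBiased hα0 hα1 hf hC (add_pos hb hs)) hφ

/-- The time-shifted bridge has the law of the tilted stable random measure, jointly with `ξ`. -/
theorem map_timeShiftedBridge (hα0 : 0 < α) (hα1 : α < 1) (hb : 0 < b) (hν : 0 < ν) :
    ((tiltedMarkedLaw α b ν).prod (gammaMeasure ν 1)).map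
      (fun p => (p.2 / totalJump (stableDensity α) p.1.1, stableCRM α p.1)) =
      (bridgeLaw α b ν ((1 - α) / α)).map (fun p => (p.1, timeShiftedBridge α b p)) := by
  have ha : 0 < (1 - α) / α := div_pos (sub_pos.2 hα1) hα0
  have := isProbabilityMeasure_bridgeLaw hα0 hα1 hb hν ha
  refine map_prodMk_eq_of_bridgeLaplace hα0 hα1 hb hν (X := Prod.fst)
    (M := timeShiftedBridge α b) measurable_fst (measurable_timeShiftedBridge hα0 hα1) ?_ fun f hf ⟨C, hC⟩ φ hφ => ?_
  · exact (ae_bridgeLaw hα0 hα1 hb hν ha).mono fun p hp => timeShiftedBridge_univ_lt_top hp.2.2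
  · exact lintegral_bridgeLaw hα0 hα1 hb hν ha (measurable_timeShiftedBridge hα0 hα1) hf
      (fun s hs => by
        simp only [timeShiftedBridge]
        exact laplace_timeShifted hα0 hα1 hf hC (add_pos hb hs)) hφ

end

/-! ### The normalized random measure and the coupling -/

section

variable {α b ν : ℝ}

/-- The stable random measure divided by its total mass, as a measure with ranked normalized
atoms. -/
def normalizedCRM (α : ℝ) (z : (ℕ → ℝ) × (ℕ → unitInterval)) : Measure unitInterval :=
  atomicMeasure
    (fun n => rankedJump (stableDensity α) z.1 n / totalJump (stableDensity α) z.1, z.2)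

lemma measurable_normalizedJump (hα0 : 0 < α) (hα1 : α < 1) : Measurable fun (e : ℕ → ℝ) (n : ℕ) =>
    rankedJump (stableDensity α) e n / totalJump (stableDensity α) e :=
  measurable_pi_lambda _ fun n =>
    ((measurable_pi_apply n).comp (measurable_rankedJump hα0 hα1)).div
      (measurable_totalJump hα0 hα1)

lemma measurable_normalizedCRM (hα0 : 0 < α) (hα1 : α < 1) : Measurable (normalizedCRM α) :=
  measurable_atomicMeasure.comp
    (((measurable_normalizedJump hα0 hα1).comp measurable_fst).prodMk measurable_snd)

lemma ae_normalizedCRM (hα0 : 0 < α) (hα1 : α < 1) : ∀ᵐ z ∂(tiltedMarkedLaw α b ν),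
    0 < totalJump (stableDensity α) z.1 ∧
    stableCRM α z univ = ENNReal.ofReal (totalJump (stableDensity α) z.1) ∧
    normalizedCRM α z = (stableCRM α z univ)⁻¹ • stableCRM α z := by
  refine (withDensity_absolutelyContinuous _ _).ae_le ?_
  filter_upwards [ae_stableCRM hα0 hα1] with z hz
  refine ⟨hz.2, hz.1, Measure.ext fun B hB => ?_⟩
  rw [hz.1, Measure.smul_apply, normalizedCRM, stableCRM, atomicMeasure, atomicMeasure,
    Measure.sum_apply _ hB, Measure.sum_apply _ hB, smul_eq_mul, ← ENNReal.tsum_mul_left]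
  refine tsum_congr fun n => ?_
  rw [Measure.smul_apply, Measure.smul_apply, smul_eq_mul, smul_eq_mul,
    ENNReal.ofReal_div_of_pos hz.2, div_eq_mul_inv]
  ring

/-- A random measure whose weights have the Poisson-Kingman law has the law of the normalized stable
random measure under the reweighted law. -/
lemma HasWeightLaw.map_eq (hα0 : 0 < α) (hα1 : α < 1) {Ω : Type*} [MeasurableSpace Ω]
    {μ : Measure Ω} {P : Ω → Measure unitInterval} (hP : HasWeightLaw μ P
      (poissonKingman (stableDensity α) (polyTilt (ν - 1) (tiltedStableLaw α b)))) :
    μ.map P = (tiltedMarkedLaw α b ν).map (normalizedCRM α) := by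
  have hS := measurable_totalJump hα0 hα1
  have hN := measurable_normalizedJump hα0 hα1
  have : IsProbabilityMeasure (totalMassLaw (stableDensity α)) :=
    Measure.isProbabilityMeasure_map hS.aemeasurable
  have h1 : (polyTilt (ν - 1) (tiltedStableLaw α b)).rnDeriv (totalMassLaw (stableDensity α))
      =ᵐ[totalMassLaw (stableDensity α)] fun t => ENNReal.ofReal (tiltDensity α b ν t) := by
    rw [polyTilt_tiltedStableLaw]
    exact Measure.rnDeriv_withDensity _ (by fun_prop)
  have h2 := ae_eq_comp hS.aemeasurable h1
  have h3 : (expSeqLaw.withDensity fun e => ENNReal.ofReal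
      (tiltDensity α b ν (totalJump (stableDensity α) e))).prod
        (Measure.infinitePi fun _ : ℕ => (volume : Measure unitInterval)) =
      tiltedMarkedLaw α b ν := by
    rw [prod_withDensity_left (by fun_prop)]
    rfl
  have h4 : (poissonKingman (stableDensity α) (polyTilt (ν - 1) (tiltedStableLaw α b))).prod
      (Measure.infinitePi fun _ : ℕ => (volume : Measure unitInterval)) =
      (tiltedMarkedLaw α b ν).map (Prod.map (fun e n => rankedJump (stableDensity α) e n /
        totalJump (stableDensity α) e) id) := by
    rw [← h3, ← Measure.map_prod_map _ _ hN measurable_id, Measure.map_id, poissonKingman]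
    congr 2
    exact withDensity_congr_ae h2
  rw [hP.2, h4]
  exact Measure.map_map measurable_atomicMeasure (hN.prodMap measurable_id)

/-- Coupling of two pairs, each made of a real variable and a random measure, with the same law. -/
lemma exists_coupling_pair {Ω Z : Type*} [MeasurableSpace Ω] [MeasurableSpace Z]
    [StandardBorelSpace Z] [Nonempty Z] {μ : Measure Ω} {ν : Measure Z} [IsProbabilityMeasure μ]
    [IsProbabilityMeasure ν] {X : Ω → ℝ} {Y : Z → ℝ} {M : Ω → Measure unitInterval}
    {N : Z → Measure unitInterval} (hX : Measurable X) (hY : Measurable Y) (hM : Measurable M)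
    (hN : Measurable N) (h : μ.map (fun ω => (X ω, M ω)) = ν.map (fun z => (Y z, N z)))
    (hfin : ∀ᵐ z ∂ν, N z univ < ∞) :
    ∃ μ' : Measure (Ω × Z), IsProbabilityMeasure μ' ∧ MeasurePreserving Prod.fst μ' μ ∧
      MeasurePreserving Prod.snd μ' ν ∧ ∀ᵐ p ∂μ', X p.1 = Y p.2 ∧ M p.1 = N p.2 := by
  have hD : MeasurableSet {q : (ℝ × Measure unitInterval) × (ℝ × Measure unitInterval) |
      q.1.1 = q.2.1 ∧ (q.1.2, q.2.2) ∈ unitMeasureDiag} :=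
    (measurableSet_eq_fun (by fun_prop) (by fun_prop)).inter
      (measurableSet_unitMeasureDiag.preimage (by fun_prop))
  obtain ⟨μ', h1, h2, h3, h4⟩ := exists_coupling (hX.prodMk hM) (hY.prodMk hN) h hD
    (fun q hq => Prod.ext hq.1 (eq_of_mem_unitMeasureDiag _ hq.2))
    (hfin.mono fun z hz => ⟨rfl, mem_unitMeasureDiag hz⟩)
  exact ⟨μ', h1, h2, h3, h4.mono fun p hp => Prod.ext_iff.1 hp⟩

end

end

theorem mainTheorem4 (α b ν : ℝ) (hα0 : 0 < α) (hα1 : α < 1) (hb : 0 < b) (hν : 0 < ν)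
    {Ω : Type u} [MeasurableSpace Ω] (μ : Measure Ω) [IsProbabilityMeasure μ]
    (P : Ω → Measure unitInterval)
    (hP : HasWeightLaw μ P
      (poissonKingman (stableDensity α) (polyTilt (ν - 1) (tiltedStableLaw α b)))) :
    ∃ (Ω' : Type u) (_ : MeasurableSpace Ω') (μ' : Measure Ω') (π : Ω' → Ω)
      (ξ : Ω' → ℝ) (M : Ω' → Measure unitInterval),
      MeasurePreserving π μ' μ ∧ Measurable M ∧
      IsSizeBiasedBridge μ' α b ν ξ M ∧ IsTimeShiftedBridge μ' α b ν ξ M ∧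
      (∀ᵐ ω ∂μ', P (π ω) = (M ω univ)⁻¹ • M ω) ∧
      IndepFun (fun ω => P (π ω)) (fun ω => ξ ω * (M ω).real univ) μ' ∧
      HasLaw (fun ω => ξ ω * (M ω).real univ) (gammaMeasure ν 1) μ' ∧
      HasLaw (fun ω => (M ω).real univ) (polyTilt (ν - 1) (tiltedStableLaw α b)) μ' := by
  have ha : 0 < 1 - α := sub_pos.2 hα1
  have ha' : 0 < (1 - α) / α := div_pos ha hα0
  have := isProbabilityMeasure_tiltedMarkedLaw hα0 hα1 hb hν
  have := isProbabilityMeasure_gammaMeasure hν one_pos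
  have := isProbabilityMeasure_bridgeLaw hα0 hα1 hb hν ha
  have := isProbabilityMeasure_bridgeLaw hα0 hα1 hb hν ha'
  have hS := measurable_totalJump hα0 hα1
  have hNm := measurable_normalizedCRM hα0 hα1
  set μc : Measure (((ℕ → ℝ) × (ℕ → unitInterval)) × ℝ) :=
    (tiltedMarkedLaw α b ν).prod (gammaMeasure ν 1)
  set ξc : ((ℕ → ℝ) × (ℕ → unitInterval)) × ℝ → ℝ :=
    fun p => p.2 / totalJump (stableDensity α) p.1.1
  have hξm : Measurable ξc := by fun_prop
  have hMm : Measurable fun p : ((ℕ → ℝ) × (ℕ → unitInterval)) × ℝ => stableCRM α p.1 :=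
    (measurable_stableCRM hα0 hα1).comp measurable_fst
  have hae : ∀ᵐ p ∂μc, 0 < totalJump (stableDensity α) p.1.1 ∧
      stableCRM α p.1 univ = ENNReal.ofReal (totalJump (stableDensity α) p.1.1) ∧
      normalizedCRM α p.1 = (stableCRM α p.1 univ)⁻¹ • stableCRM α p.1 :=
    Measure.quasiMeasurePreserving_fst.ae (ae_normalizedCRM hα0 hα1)
  have hfst : MeasurePreserving Prod.fst μc (tiltedMarkedLaw α b ν) := measurePreserving_fst
  have hsnd : MeasurePreserving Prod.snd μc (gammaMeasure ν 1) := measurePreserving_snd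
  -- realize the normalized stable random measure as `P`
  obtain ⟨μ1, _, p1, c1, e1⟩ := exists_coupling (μ := μ) (ν := μc) (X := P)
    (Y := fun p => normalizedCRM α p.1) hP.1 (hNm.comp measurable_fst)
    (by rw [hP.map_eq hα0 hα1, ← hfst.map_eq, Measure.map_map hNm measurable_fst]; rfl)
    measurableSet_unitMeasureDiag eq_of_mem_unitMeasureDiag (by
      filter_upwards [hae] with p hp
      refine mem_unitMeasureDiag ?_
      rw [hp.2.2, hp.2.1, Measure.smul_apply, hp.2.1, smul_eq_mul]
      exact ENNReal.mul_lt_top (ENNReal.inv_lt_top.2 (ENNReal.ofReal_pos.2 hp.1))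
        ENNReal.ofReal_lt_top)
  have hmap1 : μ1.map (fun p => (ξc p.2, stableCRM α p.2.1)) =
      μc.map (fun p => (ξc p, stableCRM α p.1)) := by
    rw [← c1.map_eq, Measure.map_map (hξm.prodMk hMm) measurable_snd]
    rfl
  have hZ : StandardBorelSpace ((ℕ → ℝ) × (ℕ → unitInterval)) := inferInstance
  have hW : StandardBorelSpace (ℕ → (ℕ → ℝ) × (ℕ → unitInterval)) :=
    @StandardBorelSpace.pi_countable _ _ _ _ fun _ => hZ
  have hB : StandardBorelSpace (ℝ × ℝ × unitInterval × (ℕ → (ℕ → ℝ) × (ℕ → unitInterval))) :=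
    inferInstance
  -- realize the unnormalized random measure and `ξ` through the size-biased bridge
  obtain ⟨μ2, _, p2, c2, e2⟩ := exists_coupling_pair (μ := μ1) (ν := bridgeLaw α b ν (1 - α))
    (X := fun p => ξc p.2) (Y := fun q => q.1) (M := fun p => stableCRM α p.2.1)
    (N := sizeBiasedBridge α b) (by fun_prop) (by fun_prop) (hMm.comp measurable_snd)
    (measurable_sizeBiasedBridge hα0 hα1) (hmap1.trans (map_sizeBiasedBridge hα0 hα1 hb hν))
    ((ae_bridgeLaw hα0 hα1 hb hν ha).mono fun p hp => sizeBiasedBridge_univ_lt_top hp.2.2)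
  have hmap2 : μ2.map (fun p => (ξc p.1.2, stableCRM α p.1.2.1)) =
      μ1.map (fun p => (ξc p.2, stableCRM α p.2.1)) := by
    rw [← p2.map_eq]
    exact (Measure.map_map ((hξm.prodMk hMm).comp measurable_snd) measurable_fst).symm
  -- realize the same pair through the time-shifted bridge
  obtain ⟨μ3, _, p3, c3, e3⟩ := exists_coupling_pair (μ := μ2)
    (ν := bridgeLaw α b ν ((1 - α) / α))
    (X := fun p => ξc p.1.2) (Y := fun q => q.1) (M := fun p => stableCRM α p.1.2.1)
    (N := timeShiftedBridge α b) (by fun_prop) (by fun_prop)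
    (hMm.comp (measurable_snd.comp measurable_fst)) (measurable_timeShiftedBridge hα0 hα1)
    ((hmap2.trans hmap1).trans (map_timeShiftedBridge hα0 hα1 hb hν))
    ((ae_bridgeLaw hα0 hα1 hb hν ha').mono fun p hp => timeShiftedBridge_univ_lt_top hp.2.2)
  have p23 : MeasurePreserving (fun p => p.1.1) μ3 μ1 := p2.comp p3
  have q1 : MeasurePreserving (fun p => p.1.1.2) μ3 μc := c1.comp p23
  have qa : MeasurePreserving (fun p => p.1.2) μ3 (bridgeLaw α b ν (1 - α)) := c2.comp p3
  have ea := p3.quasiMeasurePreserving.ae e2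
  have hae3 := q1.quasiMeasurePreserving.ae hae
  have eP := p23.quasiMeasurePreserving.ae e1
  have hT : (fun p => ξc p.1.1.2 * (stableCRM α p.1.1.2.1).real univ) =ᵐ[μ3]
      fun p => p.1.1.2.2 := by
    filter_upwards [hae3] with p hp
    rw [Measure.real, hp.2.1, ENNReal.toReal_ofReal hp.1.le]
    exact div_mul_cancel₀ _ hp.1.ne'
  refine ⟨((Ω × (((ℕ → ℝ) × (ℕ → unitInterval)) × ℝ)) ×
      (ℝ × ℝ × unitInterval × (ℕ → (ℕ → ℝ) × (ℕ → unitInterval)))) ×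
      (ℝ × ℝ × unitInterval × (ℕ → (ℕ → ℝ) × (ℕ → unitInterval))), inferInstance, μ3,
    fun p => p.1.1.1, fun p => ξc p.1.1.2, fun p => stableCRM α p.1.1.2.1, p1.comp p23,
    hMm.comp q1.measurable, ?_, ?_, ?_, ?_, ?_, ?_⟩
  · refine ⟨_, _, _, ((bridgeInputs_bridgeLaw hα0 hα1 hb hν ha).comp (by fun_prop) (by fun_prop)
      (by fun_prop) qa).congr (ea.mono fun p hp => hp.1), ?_⟩
    filter_upwards [ea, qa.quasiMeasurePreserving.ae (ae_bridgeLaw hα0 hα1 hb hν ha)]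
      with p hp hq y
    rw [hp.1, hp.2]
    exact sizeBiasedBridge_Iic hb hq.1 hq.2.1 hq.2.2 y
  · refine ⟨_, _, _, ((bridgeInputs_bridgeLaw hα0 hα1 hb hν ha').comp (by fun_prop) (by fun_prop)
      (by fun_prop) c3).congr (e3.mono fun p hp => hp.1), ?_⟩
    filter_upwards [e3, c3.quasiMeasurePreserving.ae (ae_bridgeLaw hα0 hα1 hb hν ha')]
      with p hp hq y
    rw [hp.1, hp.2]
    exact timeShiftedBridge_Iic hb hq.1 hq.2.1 hq.2.2 y
  · filter_upwards [eP, hae3] with p hp hq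
    rw [hp, hq.2.2]
  · exact (q1.indepFun_comp (X := fun p => normalizedCRM α p.1) (Y := Prod.snd)
      (hNm.comp measurable_fst) measurable_snd
      (indepFun_prod (Y := fun x => x) hNm measurable_id)).congr
        (eP.mono fun p hp => hp.symm) hT.symm
  · exact (hsnd.comp q1).hasLaw.congr hT
  · have hlaw : HasLaw (fun z => totalJump (stableDensity α) z.1)
        (polyTilt (ν - 1) (tiltedStableLaw α b)) (tiltedMarkedLaw α b ν) :=
      ⟨by fun_prop, map_totalJump_tiltedMarkedLaw hα0 hα1⟩
    refine (hlaw.comp (hfst.comp q1).hasLaw).congr ?_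
    filter_upwards [hae3] with p hp
    rw [Measure.real, hp.2.1, ENNReal.toReal_ofReal hp.1.le]
    rfl
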